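/- Let $p>2$ be a prime, $k$ a perfect field of characteristic $p$, $T$ a $k$-scheme, and $f\colon U\to T$ a smooth curve, that is, a morphism of schemes that is smooth of relative dimension $1$ (the fibres need not be connected). Let $F_T$ be the absolute Frobenius of $T$, let $U^{(1)}=U\times_{T,F_T}T$ be the Frobenius twist of $U$ over $T$, and let $F\colon U\to U^{(1)}$ be the relative Frobenius morphism. Write $\Omega=\Omega_{U/T}$, let $d\colon\mathcal O_U\to\Omega$ be the universal derivation, and let $\mathcal B=\operatorname{Im}(d)\subseteq\Omega$ be the sheaf of locally exact $1$-forms; $F_*\mathcal B$ is an $\mathcal O_{U^{(1)}}$-submodule of $F_*\Omega$. * The Cartier operator is the $\mathcal O_{U^{(1)}}$-linear map $C\colon F_*\Omega\to\Omega_{U^{(1)}/T}$ such that, for all local sections $g$ of $\mathcal O_U$, $C(dg)=0$ and $C(g^{p-1}dg)=d(g^{(1)})$, where $g^{(1)}$ is the pull-back of $g$ along the projection $U^{(1)}\to U$. * A $T$-connection on $\Omega$ is an $f^{-1}\mathcal O_T$-linear map $\nabla\colon\Omega\to\Omega\otimes\Omega$ with $\nabla(a\omega)=da\otimes\omega+a\nabla(\omega)$.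 It has vanishing $p$-curvature if $(\nabla_D)^p=\nabla_{D^{[p]}}$ for every local $T$-vector field $D$ on $U$, where $\nabla_D$ is $\nabla$ followed by contraction with $D$ and $D^{[p]}$ is the $p$-fold iterate of the derivation $D$. * A pre-Tango structure on $U/T$ is a $T$-connection $\nabla$ on $\Omega$ with vanishing $p$-curvature such that $F_*(\operatorname{Ker}\nabla)\subseteq\operatorname{Ker}C$ as subsheaves of $F_*\Omega$. * A Tango structure on $U/T$ is a line subbundle $\mathcal L\subseteq F_*\mathcal B$ (a submodule that is a line bundle on $U^{(1)}$ and such that $F_*\mathcal B/\mathcal L$ is locally free of finite rank) for which the morphism $\xi_{\mathcal L}\colon F^*\mathcal L\to\Omega$ adjoint to the inclusion $\mathcal L\hookrightarrow F_*\mathcal B\hookrightarrow F_*\Omega$ is an isomorphism. Then the Cartier operator exists and is unique, and the assignment $\nabla\mapsto F_*(\operatorname{Ker}\nabla)$ is a bijection from the set of pre-Tango structures on $U/T$ onto the set of Tango structures on $U/T$. -/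

import Mathlib

open CategoryTheory Limits AlgebraicGeometry TopologicalSpace Opposite

universe u

noncomputable section Defs

namespace TangoCurve

/-- The `p`-th power map, a ring endomorphism of a commutative ring in which `p = 0`. -/
def frobeniusHom (p : ℕ) [hp : Fact p.Prime] (R : Type u) [CommRing R] (h : (p : R) = 0) :
    R →+* R where
  toFun x := x ^ p
  map_one' := one_pow p
  map_mul' x y := mul_pow x y p
  map_zero' := zero_pow hp.out.ne_zero
  map_add' x y := by
    obtain ⟨r, hr⟩ := exists_add_pow_prime_eq hp.out x y
    rw [hr, h]; ring

/-- `X` is a scheme over `𝔽_p`, that is, `p = 0` on `X`. -/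
class IsOfChar (X : Scheme.{u}) (p : ℕ) : Prop where
  natCast_eq_zero : (p : Γ(X, ⊤)) = 0

lemma IsOfChar.section_eq_zero (X : Scheme.{u}) (p : ℕ) [IsOfChar X p] (V : X.Opens) :
    (p : Γ(X, V)) = 0 := by
  have h := congrArg (X.presheaf.map (homOfLE le_top : V ⟶ ⊤).op).hom
    (IsOfChar.natCast_eq_zero (X := X) (p := p))
  simpa using h

lemma IsOfChar.of_hom {X Y : Scheme.{u}} (f : X ⟶ Y) (p : ℕ) [IsOfChar Y p] : IsOfChar X p := by
  constructor
  have h := congrArg (f.appTop).hom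
    (IsOfChar.natCast_eq_zero (X := Y) (p := p))
  simpa using h

lemma IsOfChar.of_field {X : Scheme.{u}} {k : Type u} [Field k] (p : ℕ) [CharP k p]
    (s : X ⟶ Spec (CommRingCat.of k)) : IsOfChar X p := by
  have : IsOfChar (Spec (CommRingCat.of k)) p := by
    constructor
    have h := congrArg (Scheme.ΓSpecIso (CommRingCat.of k)).inv.hom (CharP.cast_eq_zero k p)
    rwa [map_natCast, map_zero] at h
  exact IsOfChar.of_hom s p

/-- The absolute Frobenius: the identity on the underlying space, `g ↦ g ^ p` on functions. -/
def absoluteFrobenius (p : ℕ) [hp : Fact p.Prime] (X : Scheme.{u}) [IsOfChar X p] : X ⟶ X where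
  base := 𝟙 _
  c :=
    { app := fun V => CommRingCat.ofHom
        (frobeniusHom p Γ(X, V.unop) (IsOfChar.section_eq_zero X p V.unop))
      naturality := by
        intro V W i
        ext x
        exact (map_pow (X.presheaf.map i).hom x p).symm }
  prop := by
    intro x
    constructor
    intro a ha
    obtain ⟨V, hxV, b, rfl⟩ := X.presheaf.exists_germ_eq a
    rw [PresheafedSpace.stalkMap_germ_apply] at ha
    have h2 : (X.presheaf.germ V x hxV).hom (b ^ p) = (X.presheaf.germ V x hxV).hom b ^ p :=
      map_pow _ _ _
    have h3 : IsUnit ((X.presheaf.germ V x hxV).hom (b ^ p)) := ha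
    rw [h2] at h3
    exact (isUnit_pow_iff hp.out.ne_zero).mp h3

variable {X Y : Scheme.{u}}

/-- The presheaf `V ↦ Ω_{O_X(V) / (f⁻¹O_Y)(V)}` of Kähler differentials, where `f⁻¹O_Y` is the
presheaf inverse image. -/
def differentialsPresheaf (f : X ⟶ Y) : X.PresheafOfModules :=
  PresheafOfModules.DifferentialsConstruction.relativeDifferentials'
    (S' := (TopCat.Presheaf.pullback CommRingCat f.base).obj Y.presheaf) (R := X.presheaf)
    (((TopCat.Presheaf.pullbackPushforwardAdjunction CommRingCat f.base).homEquiv _ _).symm f.c)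

/-- The sheaf of modules associated with a presheaf of modules. -/
def sheafify (M : X.PresheafOfModules) : X.Modules :=
  (PresheafOfModules.sheafification (𝟙 X.ringCatSheaf.obj)).obj M

/-- The canonical map from a presheaf of modules to the associated sheaf. -/
def toSheafify (M : X.PresheafOfModules) : M ⟶ (sheafify M).val :=
  (PresheafOfModules.sheafificationAdjunction (𝟙 X.ringCatSheaf.obj)).unit.app M

/-- The universal property of the associated sheaf of modules. -/
def sheafifyLift {M : X.PresheafOfModules} {N : X.Modules} (φ : M ⟶ N.val) : sheafify M ⟶ N :=
  ((PresheafOfModules.sheafificationAdjunction (𝟙 X.ringCatSheaf.obj)).homEquiv _ _).symm φ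

/-- The sheaf `Ω_{X/Y}` of relative differential `1`-forms. -/
abbrev Ω (f : X ⟶ Y) : X.Modules := sheafify (differentialsPresheaf f)

/-- The structure sheaf, as a module over itself. -/
abbrev 𝒪 (X : Scheme.{u}) : X.Modules := SheafOfModules.unit X.ringCatSheaf


/-- The universal derivation `d : O_X → Ω_{X/Y}` on sections over `V`. -/
def d (f : X ⟶ Y) {V : X.Opens} (g : Γ(X, V)) : Γ(Ω f, V) :=
  (toSheafify (differentialsPresheaf f)).app (op V) (CommRingCat.KaehlerDifferential.d g)

/-- The tensor product `M ⊗ N` of sheaves of modules: the sheaf associated with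
`V ↦ M(V) ⊗_{O_X(V)} N(V)`. -/
def tensor (M N : X.Modules) : X.Modules :=
  sheafify (PresheafOfModules.Monoidal.tensorObj (R := X.presheaf) M.val N.val)

open TensorProduct in
/-- The section `m ⊗ n` of `M ⊗ N`. -/
def tmul {M N : X.Modules} {V : X.Opens} (m : Γ(M, V)) (n : Γ(N, V)) : Γ(tensor M N, V) :=
  (toSheafify (PresheafOfModules.Monoidal.tensorObj (R := X.presheaf) M.val N.val)).app (op V)
    ((m : M.val.obj (op V)) ⊗ₜ[Γ(X, V)] (n : N.val.obj (op V)))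

lemma zero_tmul {M N : X.Modules} {V : X.Opens} (n : Γ(N, V)) :
    tmul (0 : Γ(M, V)) n = 0 := by
  refine Eq.trans (congrArg ((toSheafify (PresheafOfModules.Monoidal.tensorObj
    (R := X.presheaf) M.val N.val)).app (op V)) (TensorProduct.zero_tmul _ _)) (map_zero _)

/-- A `Y`-connection on the `O_X`-module `M`: an `f⁻¹O_Y`-linear map of sheaves
`∇ : M → Ω_{X/Y} ⊗ M` with `∇(a m) = da ⊗ m + a ∇(m)`. -/
structure Connection (f : X ⟶ Y) (M : X.Modules) where
  toHom : M.presheaf ⟶ (tensor (Ω f) M).presheaf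
  leibniz : ∀ (V : X.Opens) (a : Γ(X, V)) (m : Γ(M, V)),
    toHom.app (op V) (a • m) = tmul (d f a) m + a • toHom.app (op V) m
  linear : ∀ (W : Y.Opens) (V : X.Opens) (h : V ≤ f ⁻¹ᵁ W) (c : Γ(Y, W)) (m : Γ(M, V)),
    toHom.app (op V) (f.appLE W V h c • m) = f.appLE W V h c • toHom.app (op V) m

/-- A local vector field over the open set `V`: a section over `V` of the dual
`T_{X/Y} = Hom(Ω_{X/Y}, O_X)`. -/
abbrev VectorField (f : X ⟶ Y) (V : X.Opens) : Type u :=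
  (Ω f).restrict V.ι ⟶ (𝒪 X).restrict V.ι

variable {M N : X.Modules} {V : X.Opens}

/-- A morphism `M|_V → N|_V` on the sections over an open set contained in `V`. -/
def onImage (φ : M.restrict V.ι ⟶ N.restrict V.ι) (W : (V : Scheme.{u}).Opens) :
    Γ(M, V.ι ''ᵁ W) →ₗ[Γ(X, V.ι ''ᵁ W)] Γ(N, V.ι ''ᵁ W) where
  toFun m := φ.app W m
  map_add' m m' := map_add (φ.app W).hom m m'
  map_smul' r m := by
    have h := φ.app_smul ((V.ι.appIso W).hom r) (U := W) m
    have h1 : ∀ (P : X.Modules) (n : Γ(P, V.ι ''ᵁ W)),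
        (V.ι.appIso W).hom r • (show Γ(P.restrict V.ι, W) from n) =
          (show Γ(P.restrict V.ι, W) from r • n) := by
      intro P n
      have h2 := P.smul_restrictAppIso_inv_apply V.ι W r n
      exact h2.symm
    exact ((congrArg (φ.app W) (h1 M m)).symm.trans h).trans (h1 N _)

lemma onImage_map (φ : M.restrict V.ι ⟶ N.restrict V.ι) {W W' : (V : Scheme.{u}).Opens}
    (i : W' ⟶ W) (m : Γ(M, V.ι ''ᵁ W)) :
    onImage φ W' (M.presheaf.map (V.ι.opensFunctor.map i).op m) =
      N.presheaf.map (V.ι.opensFunctor.map i).op (onImage φ W m) :=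
  ConcreteCategory.congr_hom (φ.mapPresheaf.naturality i.op) m

/-- Sections of the module `O_X` are functions. -/
def sectionOfUnit {W : X.Opens} : Γ(𝒪 X, W) →ₗ[Γ(X, W)] Γ(X, W) where
  toFun g := g
  map_add' _ _ := rfl
  map_smul' _ _ := rfl

/-- The derivation `g ↦ D(dg)` of a vector field `D`, over the open subsets of `V`. -/
def VectorField.derivation {f : X ⟶ Y} {V : X.Opens} (D : VectorField f V)
    (W : (V : Scheme.{u}).Opens) (g : Γ(X, V.ι ''ᵁ W)) : Γ(X, V.ι ''ᵁ W) :=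
  sectionOfUnit (onImage D W (d f g))

/-- Restriction of sections of a module. -/
def res (M : X.Modules) {W W' : X.Opens} (h : W' ≤ W) : Γ(M, W) →+ Γ(M, W') :=
  (M.presheaf.map (homOfLE h).op).hom

lemma res_smul (M : X.Modules) {W W' : X.Opens} (h : W' ≤ W) (r : Γ(X, W)) (m : Γ(M, W)) :
    res M h (r • m) = X.presheaf.map (homOfLE h).op r • res M h m :=
  Scheme.Modules.map_smul M (homOfLE h) r m

lemma res_res (M : X.Modules) {W W' W'' : X.Opens} (h : W' ≤ W) (h' : W'' ≤ W') (m : Γ(M, W)) :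
    res M h' (res M h m) = res M (h'.trans h) m := by
  have := M.presheaf.map_comp (homOfLE h).op (homOfLE h').op
  exact (ConcreteCategory.congr_hom this m).symm

lemma smul_pushforward_restrict (N : X.Modules) (W : X.Opens) (r : Γ(X, W))
    (n : Γ(N, V.ι ''ᵁ V.ι ⁻¹ᵁ W)) :
    (show Γ((Scheme.Modules.pushforward V.ι).obj (N.restrict V.ι), W) from
      (X.presheaf.map (homOfLE (V.ι.image_preimage_le W)).op r • n)) =
    r • (show Γ((Scheme.Modules.pushforward V.ι).obj (N.restrict V.ι), W) from n) := by
  have h2 := N.smul_restrictAppIso_inv_apply V.ι (V.ι ⁻¹ᵁ W)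
    (X.presheaf.map (homOfLE (V.ι.image_preimage_le W)).op r) n
  refine Eq.trans h2 (congrArg (fun z => z • (show Γ(N.restrict V.ι, V.ι ⁻¹ᵁ W) from n)) ?_ )
  have h3 : X.presheaf.map (homOfLE (V.ι.image_preimage_le W)).op ≫
      (V.ι.appIso (V.ι ⁻¹ᵁ W)).hom = V.ι.app W := by
    simp
    exact Category.comp_id _
  exact ConcreteCategory.congr_hom h3 r

/-- The section `D(m) n` of `N` over `V ∩ W`, for `m`, `n` sections of `M`, `N` over `W` and
`D : M|_V → O_V`. -/
def pairing (D : M.restrict V.ι ⟶ (𝒪 X).restrict V.ι) (N : X.Modules) (W : X.Opens)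
    (m : Γ(M, W)) (n : Γ(N, W)) : Γ(N, V.ι ''ᵁ V.ι ⁻¹ᵁ W) :=
  sectionOfUnit (onImage D (V.ι ⁻¹ᵁ W) (res M (V.ι.image_preimage_le W) m)) •
    res N (V.ι.image_preimage_le W) n

lemma pairing_res (D : M.restrict V.ι ⟶ (𝒪 X).restrict V.ι) (N : X.Modules) (W W' : X.Opens)
    (h : W' ≤ W) (m : Γ(M, W)) (n : Γ(N, W)) :
    pairing D N W' (res M h m) (res N h n) =
      res N (V.ι.image_mono (V.ι.preimage_mono h)) (pairing D N W m n) := by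
  have h1 : ∀ (P : X.Modules) (m : Γ(P, W)), res P (V.ι.image_preimage_le W') (res P h m) =
      res P (V.ι.image_mono (V.ι.preimage_mono h)) (res P (V.ι.image_preimage_le W) m) := by
    intro P m
    rw [res_res, res_res]
  unfold pairing
  rw [h1, h1, res_smul]
  congr 1
  exact congrArg sectionOfUnit (onImage_map D (homOfLE (V.ι.preimage_mono h)) _)

/-- The pairing `(m, n) ↦ D(m) n` is bilinear. -/
def pairingLinear (D : M.restrict V.ι ⟶ (𝒪 X).restrict V.ι) (N : X.Modules) (W : X.Opens) :
    Γ(M, W) →ₗ[Γ(X, W)] Γ(N, W) →ₗ[Γ(X, W)]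
    Γ((Scheme.Modules.pushforward V.ι).obj (N.restrict V.ι), W) :=
  LinearMap.mk₂ Γ(X, W) (fun m n => pairing D N W m n)
    (fun m m' n => by
      simp only [pairing, map_add, add_smul]
      rfl)
    (fun r m n => by
      refine Eq.trans (?_ : _ = X.presheaf.map (homOfLE (V.ι.image_preimage_le W)).op r •
        pairing D N W m n) (smul_pushforward_restrict N W r (pairing D N W m n))
      simp only [pairing, res_smul, map_smul, smul_eq_mul, mul_smul])
    (fun m n n' => by
      simp only [pairing, map_add, smul_add]
      rfl)
    (fun r m n => by
      refine Eq.trans (?_ : _ = X.presheaf.map (homOfLE (V.ι.image_preimage_le W)).op r •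
        pairing D N W m n) (smul_pushforward_restrict N W r (pairing D N W m n))
      simp only [pairing, res_smul]
      rw [smul_comm])

/-- The map `m ⊗ n ↦ D(m) n` on the presheaf tensor product. -/
def contractionPresheaf (D : M.restrict V.ι ⟶ (𝒪 X).restrict V.ι) (N : X.Modules) :
    PresheafOfModules.Monoidal.tensorObj (R := X.presheaf) M.val N.val ⟶
      ((Scheme.Modules.pushforward V.ι).obj (N.restrict V.ι)).val :=
  PresheafOfModules.homMk
    { app := fun W => AddCommGrpCat.ofHom (TensorProduct.lift (pairingLinear D N W.unop)).toAddMonoidHom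
      naturality := by
        intro W W' i
        ext t
        induction t using TensorProduct.induction_on with
        | zero => exact (map_zero _).trans (map_zero _).symm
        | add a b ha hb => exact (map_add _ _ _).trans ((congrArg₂ _ ha hb).trans (map_add _ _ _).symm)
        | tmul m n => exact pairing_res D N W.unop W'.unop i.unop.le m n }
    (fun W r t => (TensorProduct.lift (pairingLinear D N W.unop)).map_smul r t)

/-- The contraction `(M ⊗ N)|_V → N|_V`, `m ⊗ n ↦ D(m) n`, of a linear form `D : M|_V → O_V`. -/
def contraction (D : M.restrict V.ι ⟶ (𝒪 X).restrict V.ι) (N : X.Modules) :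
    (tensor M N).restrict V.ι ⟶ N.restrict V.ι :=
  ((Scheme.Modules.restrictAdjunction V.ι).homEquiv _ _).symm
    (sheafifyLift (contractionPresheaf D N))


lemma d_mul (f : X ⟶ Y) {V : X.Opens} (g h : Γ(X, V)) : d f (g * h) = g • d f h + h • d f g := by
  have h1 := ((toSheafify (differentialsPresheaf f)).app (op V)).hom.map_add
    (g • (CommRingCat.KaehlerDifferential.d h)) (h • CommRingCat.KaehlerDifferential.d g)
  have h2 := ((toSheafify (differentialsPresheaf f)).app (op V)).hom.map_smul
    g (CommRingCat.KaehlerDifferential.d h)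
  have h3 := ((toSheafify (differentialsPresheaf f)).app (op V)).hom.map_smul
    h (CommRingCat.KaehlerDifferential.d g)
  refine Eq.trans (congrArg ((toSheafify (differentialsPresheaf f)).app (op V))
    (ModuleCat.Derivation.d_mul _ _ _)) (h1.trans (congrArg₂ _ h2 h3))

lemma d_add (f : X ⟶ Y) {V : X.Opens} (g h : Γ(X, V)) : d f (g + h) = d f g + d f h := by
  refine Eq.trans (congrArg ((toSheafify (differentialsPresheaf f)).app (op V))
    (ModuleCat.Derivation.d_add _ _ _)) (map_add ((toSheafify (differentialsPresheaf f)).app (op V)).hom _ _)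

lemma d_res (f : X ⟶ Y) {V W : X.Opens} (h : W ≤ V) (g : Γ(X, V)) :
    res (Ω f) h (d f g) = d f (X.presheaf.map (homOfLE h).op g) := by
  unfold d
  have := PresheafOfModules.naturality_apply (toSheafify (differentialsPresheaf f))
    (homOfLE h).op (CommRingCat.KaehlerDifferential.d g)
  refine this.symm.trans ?_
  congr 1
  exact PresheafOfModules.DifferentialsConstruction.relativeDifferentials'_map_d _ _ _

lemma d_appLE (f : X ⟶ Y) {V : X.Opens} {W : Y.Opens} (h : V ≤ f ⁻¹ᵁ W) (c : Γ(Y, W)) :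
    d f (f.appLE W V h c) = 0 := by
  let φ := ((TopCat.Presheaf.pullbackPushforwardAdjunction CommRingCat f.base).homEquiv _ _).symm f.c
  have h1 : ∃ s, φ.app (op V) s = f.appLE W V h c := by
    have h2 : (TopCat.Presheaf.pullbackPushforwardAdjunction CommRingCat f.base).homEquiv _ _ φ = f.c :=
      Equiv.apply_symm_apply _ _
    rw [Adjunction.homEquiv_unit] at h2
    have h3 := ConcreteCategory.congr_hom (NatTrans.congr_app h2 (op W)) c
    refine ⟨((TopCat.Presheaf.pullback CommRingCat f.base).obj Y.presheaf).map (homOfLE h).op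
      (((TopCat.Presheaf.pullbackPushforwardAdjunction CommRingCat f.base).unit.app Y.presheaf).app (op W) c), ?_⟩
    refine (ConcreteCategory.congr_hom (φ.naturality (homOfLE h).op) _).trans ?_
    exact congrArg (X.presheaf.map (homOfLE h).op) h3
  obtain ⟨s, hs⟩ := h1
  rw [← hs]
  refine Eq.trans (congrArg ((toSheafify (differentialsPresheaf f)).app (op V))
    (ModuleCat.Derivation.d_map _ s)) (map_zero ((toSheafify (differentialsPresheaf f)).app (op V)).hom)

lemma d_one (f : X ⟶ Y) {V : X.Opens} : d f (1 : Γ(X, V)) = 0 := by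
  simpa using d_mul f (1 : Γ(X, V)) 1

/-- The subring of functions `g` with `dg = 0`. -/
def constants (f : X ⟶ Y) (V : X.Opens) : Subring Γ(X, V) where
  carrier := {g | d f g = 0}
  mul_mem' := by
    intro a b ha hb
    have ha' : d f a = 0 := ha
    have hb' : d f b = 0 := hb
    show d f (a * b) = 0
    rw [d_mul, ha', hb', smul_zero, smul_zero, add_zero]
  one_mem' := d_one f
  add_mem' := by
    intro a b ha hb
    have ha' : d f a = 0 := ha
    have hb' : d f b = 0 := hb
    show d f (a + b) = 0
    rw [d_add, ha', hb', add_zero]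
  zero_mem' := by
    show d f (0 : Γ(X, V)) = 0
    simpa using d_add f (0 : Γ(X, V)) 0
  neg_mem' := by
    intro a ha
    have ha' : d f a = 0 := ha
    have h0 : d f (0 : Γ(X, V)) = 0 := by simpa using d_add f (0 : Γ(X, V)) 0
    show d f (-a) = 0
    have := d_add f a (-a)
    rw [add_neg_cancel, h0, ha', zero_add] at this
    exact this.symm

lemma mem_constants (f : X ⟶ Y) {V : X.Opens} (g : Γ(X, V)) : g ∈ constants f V ↔ d f g = 0 :=
  Iff.rfl

lemma d_pow (f : X ⟶ Y) {V : X.Opens} (g : Γ(X, V)) (n : ℕ) :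
    d f (g ^ (n + 1)) = ((n + 1 : ℕ) : Γ(X, V)) • g ^ n • d f g := by
  induction n with
  | zero => simp
  | succ n ih =>
    rw [pow_succ, d_mul, ih, smul_smul, smul_smul, smul_smul, ← add_smul]
    congr 1
    push_cast
    ring

lemma pow_mem_constants (p : ℕ) [hp : Fact p.Prime] (f : X ⟶ Y) [IsOfChar X p] {V : X.Opens}
    (g : Γ(X, V)) : g ^ p ∈ constants f V := by
  obtain ⟨n, hn⟩ := Nat.exists_eq_succ_of_ne_zero hp.out.ne_zero
  have h := d_pow f g n
  rw [mem_constants]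
  have h0 := IsOfChar.section_eq_zero X p V
  rw [hn] at h0 ⊢
  rw [h, h0, zero_smul]

lemma absoluteFrobenius_app (p : ℕ) [hp : Fact p.Prime] (X : Scheme.{u}) [IsOfChar X p]
    (V : X.Opens) (g : Γ(X, V)) : (absoluteFrobenius p X).app V g = g ^ p := rfl

lemma absoluteFrobenius_appLE (p : ℕ) [Fact p.Prime] (X : Scheme.{u}) [IsOfChar X p]
    (V W : X.Opens) (h : W ≤ absoluteFrobenius p X ⁻¹ᵁ V) (g : Γ(X, V)) :
    (absoluteFrobenius p X).appLE V W h g = (X.presheaf.map (homOfLE (show W ≤ V from h)).op g) ^ p := by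
  exact map_pow (X.presheaf.map (homOfLE (show W ≤ V from h)).op).hom g p

lemma absoluteFrobenius_comp (p : ℕ) [hp : Fact p.Prime] [IsOfChar X p] [IsOfChar Y p] (f : X ⟶ Y) :
    absoluteFrobenius p X ≫ f = f ≫ absoluteFrobenius p Y := by
  refine Scheme.Hom.ext ?_ ?_
  · simp [absoluteFrobenius]
  · intro V
    ext g
    show X.presheaf.map (eqToHom _).op ((f.app V g) ^ p) = f.app V (g ^ p)
    rw [map_pow (f.app V).hom]
    exact ConcreteCategory.congr_hom (X.presheaf.map_id (op (f ⁻¹ᵁ V))) ((f.app V).hom g ^ p)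

/-- The Frobenius twist `X^(1) = X ×_{Y, F_Y} Y`, with `F_Y` the absolute Frobenius of `Y`. -/
def twist (p : ℕ) [Fact p.Prime] (f : X ⟶ Y) [IsOfChar Y p] : Scheme.{u} :=
  pullback f (absoluteFrobenius p Y)

/-- The projection `X^(1) → X`. -/
def twistFst (p : ℕ) [Fact p.Prime] (f : X ⟶ Y) [IsOfChar Y p] : twist p f ⟶ X :=
  pullback.fst f (absoluteFrobenius p Y)

/-- The structure morphism `X^(1) → Y`. -/
def twistHom (p : ℕ) [Fact p.Prime] (f : X ⟶ Y) [IsOfChar Y p] : twist p f ⟶ Y :=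
  pullback.snd f (absoluteFrobenius p Y)

/-- The relative Frobenius `F_{X/Y} : X → X^(1)`. -/
def relativeFrobenius (p : ℕ) [Fact p.Prime] (f : X ⟶ Y) [IsOfChar Y p] : X ⟶ twist p f :=
  haveI := IsOfChar.of_hom f p
  pullback.lift (absoluteFrobenius p X) f (absoluteFrobenius_comp p f)

lemma relativeFrobenius_fst (p : ℕ) [Fact p.Prime] (f : X ⟶ Y) [IsOfChar X p] [IsOfChar Y p] :
    relativeFrobenius p f ≫ twistFst p f = absoluteFrobenius p X := pullback.lift_fst _ _ _

lemma relativeFrobenius_snd (p : ℕ) [Fact p.Prime] (f : X ⟶ Y) [IsOfChar Y p] :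
    relativeFrobenius p f ≫ twistHom p f = f := pullback.lift_snd _ _ _

lemma eq_zero_of_local (M : X.Modules) {V : X.Opens} (m : Γ(M, V))
    (h : ∀ x ∈ V, ∃ (W : X.Opens) (hW : W ≤ V), x ∈ W ∧ res M hW m = 0) : m = 0 := by
  apply TopCat.Presheaf.IsSheaf.section_ext M.isSheaf
  intro x hx
  obtain ⟨W, hW, hxW, h0⟩ := h x hx
  exact ⟨W, hW, hxW, h0.trans (map_zero (res M hW)).symm⟩

lemma relativeFrobenius_const_affine (p : ℕ) [Fact p.Prime] (f : X ⟶ Y) [IsOfChar Y p]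
    {S : Y.Opens} (hS : IsAffineOpen S) {V : X.Opens} (hV : IsAffineOpen V) (h : V ≤ f ⁻¹ᵁ S)
    (a : Γ(twist p f, twistFst p f ⁻¹ᵁ V ⊓ twistHom p f ⁻¹ᵁ S)) :
    d f ((relativeFrobenius p f).app _ a) = 0 := by
  have := IsOfChar.of_hom f p
  let R : Subring Γ(twist p f, twistFst p f ⁻¹ᵁ V ⊓ twistHom p f ⁻¹ᵁ S) :=
    (constants f _).comap ((relativeFrobenius p f).app _).hom
  let H : IsPullback (twistFst p f) (twistHom p f) f (absoluteFrobenius p Y) :=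
    IsPullback.of_hasPullback f (absoluteFrobenius p Y)
  have hiso := isIso_pushoutSection_of_isAffineOpen H (US := S) (UT := S) (UX := V) le_rfl h rfl
    hS hS hV
  have hpo := (isIso_pushoutSection_iff H (US := S) (UT := S) (UX := V) le_rfl h rfl).mp hiso
  suffices hR : a ∈ R from hR
  let i : CommRingCat.of R ⟶ Γ(twist p f, twistFst p f ⁻¹ᵁ V ⊓ twistHom p f ⁻¹ᵁ S) :=
    CommRingCat.ofHom R.subtype
  have h0 : ∀ (g : X ⟶ X) (_ : g = absoluteFrobenius p X) (V W : X.Opens) (e : W ≤ g ⁻¹ᵁ V)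
      (b : Γ(X, V)), g.appLE V W e b ∈ constants f W := by
    rintro g rfl V W e b
    rw [absoluteFrobenius_appLE]
    exact pow_mem_constants p f _
  have h0' : ∀ (g : X ⟶ Y) (_ : g = f) (V : Y.Opens) (W : X.Opens) (e : W ≤ g ⁻¹ᵁ V)
      (b : Γ(Y, V)), g.appLE V W e b ∈ constants f W := by
    rintro g rfl V W e b
    exact d_appLE _ _ _
  have h1 : ∀ b, (twistFst p f).appLE V (twistFst p f ⁻¹ᵁ V ⊓ twistHom p f ⁻¹ᵁ S) inf_le_left b ∈ R := by
    intro b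
    show (relativeFrobenius p f).app _ _ ∈ constants f _
    rw [← Scheme.Hom.appLE_eq_app]
    have h2 := Scheme.Hom.appLE_comp_appLE (relativeFrobenius p f) (twistFst p f) V
      (twistFst p f ⁻¹ᵁ V ⊓ twistHom p f ⁻¹ᵁ S) _ inf_le_left le_rfl
    have h3 := ConcreteCategory.congr_hom h2 b
    refine (congrArg (· ∈ constants f _) h3).mpr ?_
    exact h0 _ (relativeFrobenius_fst p f) _ _ _ _
  have h2 : ∀ b, (twistHom p f).appLE S (twistFst p f ⁻¹ᵁ V ⊓ twistHom p f ⁻¹ᵁ S) inf_le_right b ∈ R := by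
    intro b
    show (relativeFrobenius p f).app _ _ ∈ constants f _
    rw [← Scheme.Hom.appLE_eq_app]
    have h2 := Scheme.Hom.appLE_comp_appLE (relativeFrobenius p f) (twistHom p f) S
      (twistFst p f ⁻¹ᵁ V ⊓ twistHom p f ⁻¹ᵁ S) _ inf_le_right le_rfl
    have h3 := ConcreteCategory.congr_hom h2 b
    refine (congrArg (· ∈ constants f _) h3).mpr ?_
    exact h0' _ (relativeFrobenius_snd p f) _ _ _ _
  let l : Γ(X, V) ⟶ CommRingCat.of R := CommRingCat.ofHom
    (((twistFst p f).appLE V (twistFst p f ⁻¹ᵁ V ⊓ twistHom p f ⁻¹ᵁ S) inf_le_left).hom.codRestrict R h1)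
  let r : Γ(Y, S) ⟶ CommRingCat.of R := CommRingCat.ofHom
    (((twistHom p f).appLE S (twistFst p f ⁻¹ᵁ V ⊓ twistHom p f ⁻¹ᵁ S) inf_le_right).hom.codRestrict R h2)
  have hlr : f.appLE S V h ≫ l = (absoluteFrobenius p Y).appLE S S le_rfl ≫ r := by
    ext c
    exact ConcreteCategory.congr_hom hpo.w c
  have hid : hpo.desc l r hlr ≫ i = 𝟙 _ := by
    apply hpo.hom_ext
    · rw [← Category.assoc, hpo.inl_desc]; rfl
    · rw [← Category.assoc, hpo.inr_desc]; rfl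
  have := ConcreteCategory.congr_hom hid a
  rw [← show i (hpo.desc l r hlr a) = a from this]
  exact (hpo.desc l r hlr a).2

lemma relativeFrobenius_const (p : ℕ) [Fact p.Prime] (f : X ⟶ Y) [IsOfChar Y p] 
    (W : (twist p f).Opens) (a : Γ(twist p f, W)) : d f ((relativeFrobenius p f).app W a) = 0 := by
  apply eq_zero_of_local
  intro x hx
  obtain ⟨S, hS, hxS, -⟩ := exists_isAffineOpen_mem_and_subset (x := f x) (U := ⊤) trivial
  obtain ⟨V, hV, hxV, hVS⟩ := exists_isAffineOpen_mem_and_subset (x := x) (U := f ⁻¹ᵁ S) hxS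
  let H : IsPullback (twistFst p f) (twistHom p f) f (absoluteFrobenius p Y) :=
    IsPullback.of_hasPullback f (absoluteFrobenius p Y)
  let A := twistFst p f ⁻¹ᵁ V ⊓ twistHom p f ⁻¹ᵁ S
  have hA : IsAffineOpen A := by
    have : IsAffine _ := hS
    have : IsAffine _ := hV
    exact .of_isIso (Scheme.Hom.isPullback_resLE H (US := S) (UT := S) (UX := V) le_rfl hVS rfl).isoPullback.hom
  have hxA : relativeFrobenius p f x ∈ A := by
    have := IsOfChar.of_hom f p
    refine ⟨?_, ?_⟩
    · show (twistFst p f) (relativeFrobenius p f x) ∈ V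
      rw [← Scheme.Hom.comp_apply, relativeFrobenius_fst]
      exact hxV
    · show (twistHom p f) (relativeFrobenius p f x) ∈ S
      rw [← Scheme.Hom.comp_apply, relativeFrobenius_snd]
      exact hxS
  obtain ⟨h, hW, hxh⟩ := hA.exists_basicOpen_le (V := W) ⟨relativeFrobenius p f x, hx⟩ hxA
  refine ⟨relativeFrobenius p f ⁻¹ᵁ (twist p f).basicOpen h, (relativeFrobenius p f).preimage_mono hW, hxh, ?_⟩
  have hD := (twist p f).basicOpen_le h
  have key : ∀ c : Γ(twist p f, A), (relativeFrobenius p f).app _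
      ((twist p f).presheaf.map (homOfLE hD).op c) ∈ constants f _ := by
    intro c
    have h1 := relativeFrobenius_const_affine p f hS hV hVS c
    have h2 := d_res f ((relativeFrobenius p f).preimage_mono hD) ((relativeFrobenius p f).app A c)
    rw [h1, map_zero] at h2
    have h3 := ConcreteCategory.congr_hom ((relativeFrobenius p f).naturality (homOfLE hD).op) c
    exact (congrArg (· ∈ constants f _) h3).mpr h2.symm
  rw [d_res]
  have h3 := ConcreteCategory.congr_hom ((relativeFrobenius p f).naturality (homOfLE hW).op) a
  refine (congrArg (d f) h3).symm.trans ?_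
  show d f ((relativeFrobenius p f).app _ ((twist p f).presheaf.map (homOfLE hW).op a)) = 0
  generalize (twist p f).presheaf.map (homOfLE hW).op a = b
  have hloc := hA.isLocalization_basicOpen h
  obtain ⟨n, c, hc⟩ := IsLocalization.Away.surj h b
  have hc' := congrArg ((relativeFrobenius p f).app ((twist p f).basicOpen h)).hom hc
  rw [map_mul, map_pow] at hc'
  set u := ((relativeFrobenius p f).app ((twist p f).basicOpen h)).hom
    (algebraMap Γ(twist p f, A) Γ(twist p f, (twist p f).basicOpen h) h) with hu
  have hunit : IsUnit u := (IsLocalization.Away.algebraMap_isUnit h).map _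
  have hun : u ^ n ∈ constants f _ := Subring.pow_mem _ (key h) n
  have hd : d f (((relativeFrobenius p f).app ((twist p f).basicOpen h)).hom b * u ^ n) = 0 := by
    rw [hc']
    exact key c
  rw [d_mul, (mem_constants f _).mp hun, smul_zero, zero_add] at hd
  exact (hunit.pow n).smul_eq_zero.mp hd


/-- A map of sheaves of abelian groups `φ : M → N` that is linear over the functions of `Z`
induces an `O_Z`-linear map `F_* M → F_* N`. -/
def pushforwardHom {Z : Scheme.{u}} (F : X ⟶ Z) (φ : M.presheaf ⟶ N.presheaf)
    (hφ : ∀ (W : Z.Opens) (a : Γ(Z, W)) (m : Γ(M, F ⁻¹ᵁ W)),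
      φ.app (op (F ⁻¹ᵁ W)) (F.app W a • m) = F.app W a • φ.app (op (F ⁻¹ᵁ W)) m) :
    (Scheme.Modules.pushforward F).obj M ⟶ (Scheme.Modules.pushforward F).obj N :=
  ⟨PresheafOfModules.homMk (Functor.whiskerLeft (Opens.map F.base).op φ)
    (fun W a m => hφ W.unop a m)⟩

/-- The universal derivation as a map of sheaves of abelian groups. -/
def dHom (f : X ⟶ Y) : (𝒪 X).presheaf ⟶ (Ω f).presheaf where
  app V := AddCommGrpCat.ofHom (AddMonoidHom.mk' (fun g : Γ(X, V.unop) => d f g) (d_add f))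
  naturality V W i := by
    ext g
    exact (d_res f i.unop.le g).symm

/-- The `O_{X^(1)}`-linear map `F_*(d) : F_* O_X → F_* Ω_{X/Y}`. -/
def frobeniusD (p : ℕ) [Fact p.Prime] (f : X ⟶ Y) [IsOfChar Y p] :
    (Scheme.Modules.pushforward (relativeFrobenius p f)).obj (𝒪 X) ⟶
      (Scheme.Modules.pushforward (relativeFrobenius p f)).obj (Ω f) :=
  pushforwardHom (relativeFrobenius p f) (dHom f) (fun W a (g : Γ(X, _)) => by
    refine (d_mul f ((relativeFrobenius p f).app W a) g).trans ?_
    rw [relativeFrobenius_const, smul_zero, add_zero]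
    rfl)

/-- The `O_{X^(1)}`-linear map `F_*(∇) : F_* M → F_* (Ω_{X/Y} ⊗ M)`. -/
def frobeniusConnection (p : ℕ) [Fact p.Prime] {f : X ⟶ Y} [IsOfChar Y p] (nabla : Connection f M) :
    (Scheme.Modules.pushforward (relativeFrobenius p f)).obj M ⟶
      (Scheme.Modules.pushforward (relativeFrobenius p f)).obj (tensor (Ω f) M) :=
  pushforwardHom (relativeFrobenius p f) nabla.toHom (fun W a m => by
    rw [nabla.leibniz, relativeFrobenius_const, zero_tmul, zero_add])

/-- The covariant derivative `∇_D`: the composite of `∇` with contraction by `D`. -/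
def Connection.covariantDerivative {f : X ⟶ Y} (nabla : Connection f M) (D : VectorField f V)
    (W : (V : Scheme.{u}).Opens) (m : Γ(M, V.ι ''ᵁ W)) : Γ(M, V.ι ''ᵁ W) :=
  onImage (contraction D M) W (nabla.toHom.app (op (V.ι ''ᵁ W)) m)

/-- `E` is the vector field `D^{[p]}`, whose derivation is the `p`-fold iterate of that of `D`. -/
def VectorField.IsPower (p : ℕ) {f : X ⟶ Y} (D E : VectorField f V) : Prop :=
  ∀ W, E.derivation W = (D.derivation W)^[p]

/-- The `p`-curvature `D ↦ (∇_D)^p - ∇_{D^{[p]}}` vanishes, for all local vector fields `D`. -/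
def Connection.HasVanishingPCurvature (p : ℕ) {f : X ⟶ Y} (nabla : Connection f M) : Prop :=
  ∀ (V : X.Opens) (D E : VectorField f V), VectorField.IsPower p D E →
    ∀ (W : (V : Scheme.{u}).Opens) (m : Γ(M, V.ι ''ᵁ W)),
      (nabla.covariantDerivative D W)^[p] m - nabla.covariantDerivative E W m = 0

lemma le_preimage (p : ℕ) [Fact p.Prime] (f : X ⟶ Y) [IsOfChar Y p] (V : X.Opens) :
    relativeFrobenius p f ⁻¹ᵁ twistFst p f ⁻¹ᵁ V ≤ V := by
  have := IsOfChar.of_hom f p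
  rw [← Scheme.Hom.comp_preimage, relativeFrobenius_fst]
  exact le_rfl

/-- The Cartier operator `C : F_* Ω_{X/Y} → Ω_{X^(1)/Y}`: the `O_{X^(1)}`-linear map that kills
exact forms and sends `g ^ (p - 1) dg` to `d(g ⊗ 1)`, with `g ⊗ 1` the pull-back of `g` to `X^(1)`. -/
structure IsCartierOperator (p : ℕ) [Fact p.Prime] (f : X ⟶ Y) [IsOfChar Y p]
    (C : (Scheme.Modules.pushforward (relativeFrobenius p f)).obj (Ω f) ⟶ Ω (twistHom p f)) :
    Prop where
  map_exact : ∀ (W : (twist p f).Opens) (g : Γ(X, relativeFrobenius p f ⁻¹ᵁ W)),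
    C.app W (d f g) = 0
  map_pow_smul : ∀ (V : X.Opens) (g : Γ(X, V)),
    C.app (twistFst p f ⁻¹ᵁ V)
      (X.presheaf.map (homOfLE (le_preimage p f V)).op g ^ (p - 1) •
        d f (X.presheaf.map (homOfLE (le_preimage p f V)).op g)) =
      d (twistHom p f) ((twistFst p f).app V g)

/-- The subsheaf `F_*(Ker ∇)` of `F_* M`; as `F_*` is left exact, it is the kernel of `F_*(∇)`. -/
def horizontal (p : ℕ) [Fact p.Prime] {f : X ⟶ Y} [IsOfChar Y p] (nabla : Connection f M) :
    Subobject ((Scheme.Modules.pushforward (relativeFrobenius p f)).obj M) :=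
  kernelSubobject (frobeniusConnection p nabla)

/-- A pre-Tango structure: a connection on `Ω_{X/Y}` with vanishing `p`-curvature and
`F_*(Ker ∇) ⊆ Ker C`, with `C` the Cartier operator. -/
structure IsPreTango (p : ℕ) [Fact p.Prime] {f : X ⟶ Y} [IsOfChar Y p]
    (C : (Scheme.Modules.pushforward (relativeFrobenius p f)).obj (Ω f) ⟶ Ω (twistHom p f))
    (nabla : Connection f (Ω f)) : Prop where
  pCurvature : nabla.HasVanishingPCurvature p
  horizontal_le : horizontal p nabla ≤ kernelSubobject C

/-- The subsheaf `F_*(B_{X/Y})` of `F_* Ω_{X/Y}`, with `B_{X/Y}` the sheaf of locally exact forms,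
that is, the image of `d` in the category of sheaves; `F` is a homeomorphism, so that `F_*` commutes
with images and `F_*(B_{X/Y})` is the image of `F_*(d)`. -/
def locallyExact (p : ℕ) [Fact p.Prime] (f : X ⟶ Y) [IsOfChar Y p] :
    Subobject ((Scheme.Modules.pushforward (relativeFrobenius p f)).obj (Ω f)) :=
  imageSubobject (frobeniusD p f)

/-- Locally free of rank one. -/
def IsLineBundle (M : X.Modules) : Prop :=
  ∀ x : X, ∃ V : X.Opens, x ∈ V ∧ Nonempty (M.restrict V.ι ≅ 𝒪 (V : Scheme.{u}))

/-- Locally free of finite (locally constant) rank. -/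
def IsVectorBundle (M : X.Modules) : Prop :=
  ∀ x : X, ∃ V : X.Opens, x ∈ V ∧ ∃ n : ℕ,
    Nonempty (M.restrict V.ι ≅ SheafOfModules.free (R := (V : Scheme.{u}).ringCatSheaf) (ULift.{u} (Fin n)))

/-- The morphism `ξ_L : F^* L → Ω_{X/Y}` adjoint to the inclusion `L → F_* Ω_{X/Y}`. -/
def xi (p : ℕ) [Fact p.Prime] {f : X ⟶ Y} [IsOfChar Y p]
    (L : Subobject ((Scheme.Modules.pushforward (relativeFrobenius p f)).obj (Ω f))) :
    (Scheme.Modules.pullback (relativeFrobenius p f)).obj (L : (twist p f).Modules) ⟶ Ω f :=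
  ((Scheme.Modules.pullbackPushforwardAdjunction (relativeFrobenius p f)).homEquiv _ _).symm L.arrow

/-- A Tango structure: a line subbundle `L` of `F_*(B_{X/Y})` (a line bundle contained in
`F_*(B_{X/Y})` with locally free quotient) such that `ξ_L : F^* L → Ω_{X/Y}` is an isomorphism. -/
structure IsTango (p : ℕ) [Fact p.Prime] (f : X ⟶ Y) [IsOfChar Y p]
    (L : Subobject ((Scheme.Modules.pushforward (relativeFrobenius p f)).obj (Ω f))) : Prop where
  isLineBundle : IsLineBundle (L : (twist p f).Modules)
  le : L ≤ locallyExact p f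
  quotient : IsVectorBundle (cokernel (Subobject.ofLE L (locallyExact p f) le))
  isIso : IsIso (xi p L)

end TangoCurve

end Defs

open TangoCurve

/-!
Everything is reduced to explicit algebra in one coordinate. The relative Frobenius
`F : X → X^(1)` is a homeomorphism, so every open subset of `X` is `F⁻¹ W` for a unique `W`. Locally
`X` is étale over an affine line, with coordinate `x`, and then `O_X` is free over `O_{X^(1)}` with
basis `1, x, …, x ^ (p - 1)` (`IsRelativeFrobenius.existsUnique_sum`,
`IsEtaleCoordinate.isCoordinate`). Hence there is a vector field `d/dx`, its kernel is `O_{X^(1)}`,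
its `p`-th power is zero, and `dx` is a frame of `Ω` (`IsCoordinate.isFrame`).

*The Cartier operator.* In a chart it has to be
`∑ c_n x ^ n dx ↦ c_{p - 1} d(x ⊗ 1)` (`IsChart.eq_cartier`). This formula does define a Cartier
operator: `g ^ (p - 1) dg` is additive in `g` up to exact forms (`exists_add_pow_smul_eq`), so that
the rule for it need only be checked on monomials. By uniqueness the local operators glue
(`existsUnique_isCartierOperator`), and since every `x ^ n dx` with `n < p - 1` is exact, the kernel
of the operator is `F_* B` (`IsCartierOperator.locallyExact_eq`). The condition `F_* Ker ∇ ⊆ Ker C`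
therefore says `F_* Ker ∇ ⊆ F_* B`.

*The bijection.* Both sides are matched with the subsheaves `L ⊆ F_* B` that have local generators:
locally there is a frame `e` of `Ω` over `O_X` such that `L = O_{X^(1)} e` (`HasLocalGenerators`).

* If `∇` has vanishing `p`-curvature, then `N = ∇_{d/dx}` satisfies `N ^ p = 0`, and the operators
  `∑ (-x) ^ i / i! N ^ i` show that horizontal sections span (`mem_span_horizontal`). As `Ω` has
  rank one, one of them is a frame near a given point, and it generates the horizontal sections
  (`Connection.hasLocalGenerators_horizontal`). Conversely, `b e ↦ db ⊗ e` is a connection that does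
  not depend on the generator `e`, since two of them differ by a factor from `O_{X^(1)}`, whose
  differential is zero (`HasLocalGenerators.exists_connection`). These constructions are inverse to
  each other (`Connection.eq_of_horizontal_eq`, `HasLocalGenerators.horizontal_eq`).
* If `L` has local generators, then `O_X`-linear maps `Ω → N` are the same as `O_{X^(1)}`-linear
  maps `L → F_* N`, so that `ξ_L` is an isomorphism by the Yoneda lemma
  (`HasLocalGenerators.isIso_xi`). Near a given point some coordinate of `e` in the basis `x ^ n dx`
  of `F_* Ω` is invertible, and the other `x ^ n dx` with `n < p - 1` form a basis of `F_* B / L`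
  (`IsGenerator.nonempty_quotient_iso`). Hence `L` is a Tango structure.
* If `L` is a Tango structure with frame `l`, write `l = b dx`. If `b` vanished at a point `u`, then
  the value at `u` of the coefficient of `dx` would be a nonzero map from `Ω` to a skyscraper sheaf
  that is zero on the image of `ξ_L` (`IsFrame.exists_value`). So `b` is invertible and `l` is a
  generator (`IsTango.hasLocalGenerators`).
-/

namespace TangoCurve

/-! ### Étale algebras in characteristic `p` and the relative Frobenius -/

section EtaleAlgebra

open Polynomial

/-- Two maps out of an unramified algebra that agree modulo a nilpotent ideal are equal. -/
lemma ringHom_ext_of_formallyUnramified {P B Q : Type*} [CommRing P] [CommRing B] [CommRing Q]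
    [Algebra P B] [Algebra.FormallyUnramified P B] {h₁ h₂ : B →+* Q}
    (h : h₁.comp (algebraMap P B) = h₂.comp (algebraMap P B)) (J : Ideal Q) (hJ : IsNilpotent J)
    (hJ' : ∀ b, h₁ b - h₂ b ∈ J) : h₁ = h₂ := by
  let : Algebra P Q := (h₁.comp (algebraMap P B)).toAlgebra
  let g₁ : B →ₐ[P] Q := { h₁ with commutes' := fun r => rfl }
  let g₂ : B →ₐ[P] Q := { h₂ with commutes' := fun r => (RingHom.congr_fun h r).symm }
  have : g₁ = g₂ := Algebra.FormallyUnramified.ext J hJ fun b =>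
    (Ideal.Quotient.mk_eq_mk_iff_sub_mem _ _).mpr (hJ' b)
  ext b
  exact congrArg (fun g : B →ₐ[P] Q => g b) this

lemma isNilpotent_of_fg_of_pow_eq_zero {Q : Type*} [CommRing Q] {J : Ideal Q} (hJ : J.FG) (n : ℕ)
    (h : ∀ z ∈ J, z ^ n = 0) : IsNilpotent J :=
  (Ideal.FG.isNilpotent_iff_le_nilradical hJ).mpr fun z hz => ⟨n, h z hz⟩

/-- An unramified algebra `B` of finite type over `Q` in which every `p`-th power comes from `Q`
is a quotient of `Q`. -/
lemma algebraMap_surjective_of_unramified (p : ℕ) [hp : Fact p.Prime] {Q B : Type*} [CommRing Q]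
    [CommRing B] [Algebra Q B] [Algebra.FormallyUnramified Q B] [Algebra.FiniteType Q B]
    (hB : (p : B) = 0) (hpow : ∀ b : B, ∃ q : Q, algebraMap Q B q = b ^ p) :
    Function.Surjective (algebraMap Q B) := by
  open TensorProduct in
  -- `B` is finite over `Q`, and `1 ⊗ b - b ⊗ 1` has vanishing `p`-th power, so that the kernel of
  -- `B ⊗ B → B` is nilpotent; unramifiedness turns this into `1 ⊗ b = b ⊗ 1`
  have hint : Algebra.IsIntegral Q B := ⟨fun b => by
    obtain ⟨q, hq⟩ := hpow b
    exact IsIntegral.of_pow hp.out.pos (hq ▸ isIntegral_algebraMap)⟩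
  have hfin : Module.Finite Q B := Algebra.IsIntegral.finite
  have hBB : (p : B ⊗[Q] B) = 0 := by
    have h := congrArg (Algebra.TensorProduct.includeLeft : B →ₐ[Q] B ⊗[Q] B) hB
    simpa using h
  have hgen : ∀ b : B, ((1 : B) ⊗ₜ[Q] b - b ⊗ₜ[Q] (1 : B)) ^ p = 0 := by
    intro b
    obtain ⟨q, hq⟩ := hpow b
    have h1 := map_sub (frobeniusHom p (B ⊗[Q] B) hBB) ((1 : B) ⊗ₜ[Q] b) (b ⊗ₜ[Q] (1 : B))
    refine h1.trans ?_
    show ((1 : B) ⊗ₜ[Q] b) ^ p - (b ⊗ₜ[Q] (1 : B)) ^ p = 0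
    rw [Algebra.TensorProduct.tmul_pow, Algebra.TensorProduct.tmul_pow, one_pow, ← hq,
      Algebra.algebraMap_eq_smul_one, TensorProduct.tmul_smul, TensorProduct.smul_tmul',
      sub_self]
  have hnil : KaehlerDifferential.ideal Q B ≤ nilradical (B ⊗[Q] B) := by
    rw [← KaehlerDifferential.span_range_eq_ideal, Ideal.span_le]
    rintro _ ⟨b, rfl⟩
    exact ⟨p, hgen b⟩
  have hN : IsNilpotent (KaehlerDifferential.ideal Q B) :=
    (Ideal.FG.isNilpotent_iff_le_nilradical (KaehlerDifferential.ideal_fg Q B)).mpr hnil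
  have hepi : Algebra.IsEpi Q B := by
    rw [Algebra.isEpi_iff_forall_one_tmul_eq]
    intro b
    have := ringHom_ext_of_formallyUnramified (P := Q)
      (h₁ := (Algebra.TensorProduct.includeRight : B →ₐ[Q] B ⊗[Q] B).toRingHom)
      (h₂ := (Algebra.TensorProduct.includeLeft : B →ₐ[Q] B ⊗[Q] B).toRingHom)
      (by ext q; simp) _ hN (fun b => KaehlerDifferential.one_smul_sub_smul_one_mem_ideal Q b)
    exact congrArg (fun h : B →+* B ⊗[Q] B => h b) this
  exact (Algebra.isEpi_iff_surjective_algebraMap_of_finite).mp hepi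

end EtaleAlgebra

section EtaleAlgebra

open Polynomial

lemma ker_fg_of_finiteType {P Q B : Type*} [CommRing P] [CommRing Q] [CommRing B] [Algebra P Q]
    [Algebra P B] [Algebra.FiniteType P Q] [Algebra.FinitePresentation P B] (φ : Q →ₐ[P] B)
    (hφ : Function.Surjective φ) : (RingHom.ker φ.toRingHom).FG := by
  obtain ⟨n, g, hg⟩ := Algebra.FiniteType.iff_quotient_mvPolynomial''.mp
    (inferInstance : Algebra.FiniteType P Q)
  convert! (Algebra.FinitePresentation.ker_fg_of_mvPolynomial (φ.comp g)
    (hφ.comp hg)).map g.toRingHom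
  simp_rw [RingHom.ker_eq_comap_bot, AlgHom.toRingHom_eq_coe, AlgHom.comp_toRingHom]
  rw [← Ideal.comap_comap, Ideal.map_comap_of_surjective (g : MvPolynomial (Fin n) P →+* Q) hg]

variable {A B B₁ : Type*} [CommRing A] [CommRing B] [CommRing B₁]

/-- The data of the relative Frobenius `F : B₁ → B` of an `A`-algebra `B` of characteristic `p`:
`B₁` is generated by the images of `j : A → B₁` and of `w : B → B₁`, `b ↦ b ⊗ 1`. -/
structure IsRelativeFrobenius (p : ℕ) (i : A →+* B) (j : A →+* B₁) (w : B →+* B₁) (F : B₁ →+* B) :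
    Prop where
  w_i : ∀ a, w (i a) = j a ^ p
  F_w : ∀ b, F (w b) = b ^ p
  F_j : ∀ a, F (j a) = i a
  generated : ∀ S : Subring B₁, (∀ a, j a ∈ S) → (∀ b, w b ∈ S) → S = ⊤

variable {p : ℕ} {i : A →+* B} {j : A →+* B₁} {w : B →+* B₁} {F : B₁ →+* B}

lemma IsRelativeFrobenius.ringHom_ext (h : IsRelativeFrobenius p i j w F) {C : Type*} [CommRing C]
    {u v : B₁ →+* C} (hj : ∀ a, u (j a) = v (j a)) (hw : ∀ b, u (w b) = v (w b)) : u = v := by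
  have h1 := h.generated (u.eqLocus v) hj hw
  ext b
  have h2 : b ∈ u.eqLocus v := h1 ▸ Subring.mem_top b
  exact h2

lemma IsRelativeFrobenius.w_F (h : IsRelativeFrobenius p i j w F) [hp : Fact p.Prime]
    (hB₁ : (p : B₁) = 0) (b : B₁) : w (F b) = b ^ p := by
  have h1 : w.comp F = frobeniusHom p B₁ hB₁ := by
    refine h.ringHom_ext (fun a => ?_) (fun b => ?_)
    · show w (F (j a)) = j a ^ p
      rw [h.F_j, h.w_i]
    · show w (F (w b)) = w b ^ p
      rw [h.F_w, map_pow]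
  exact RingHom.congr_fun h1 b

/-- If `B` is étale over the affine line over `A`, with coordinate `x`, then the relative Frobenius
identifies `B` with `B₁[Y] / (Y ^ p - x ⊗ 1)`. -/
theorem IsRelativeFrobenius.bijective_lift (h : IsRelativeFrobenius p i j w F) [hp : Fact p.Prime]
    (hB₁ : (p : B₁) = 0) (g : MvPolynomial (Fin 1) A →+* B) (hg : g.Etale)
    (hgi : g.comp MvPolynomial.C = i) :
    Function.Bijective (AdjoinRoot.lift F (g (MvPolynomial.X 0))
      (f := X ^ p - C (w (g (MvPolynomial.X 0)))) (by simp [h.F_w])) := by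
  set x := g (MvPolynomial.X 0) with hx
  set q : B₁[X] := X ^ p - C (w x) with hq
  set φ : AdjoinRoot q →+* B := AdjoinRoot.lift F x (by simp [hq, h.F_w]) with hφ
  let y := AdjoinRoot.root q
  let o := AdjoinRoot.of q
  have hφo : ∀ b, φ (o b) = F b := fun b => AdjoinRoot.lift_of _
  have hφy : φ y = x := AdjoinRoot.lift_root _
  have hy : y ^ p = o (w x) := by
    have := AdjoinRoot.eval₂_root q
    rw [hq, eval₂_sub, eval₂_pow, eval₂_X, eval₂_C, sub_eq_zero] at this
    exact this
  have hgC : ∀ a, g (MvPolynomial.C a) = i a := fun a => RingHom.congr_fun hgi a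
  have hB : (p : B) = 0 := by simpa using congrArg F hB₁
  have hQ : (p : AdjoinRoot q) = 0 := by simpa using congrArg o hB₁
  -- the `p`-th power map of the source factors through `φ`, so that `ker φ` is nil
  have hψφ : ∀ z, o (w (φ z)) = z ^ p := by
    have : (o.comp w).comp φ = frobeniusHom p _ hQ := by
      refine AdjoinRoot.ringHom_ext ?_ ?_
      · ext b
        show o (w (φ (o b))) = (o b) ^ p
        rw [hφo, h.w_F hB₁, map_pow]
      · show o (w (φ y)) = y ^ p
        rw [hφy, hy]
    exact fun z => RingHom.congr_fun this z
  let : Algebra (MvPolynomial (Fin 1) A) B := g.toAlgebra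
  have : Algebra.Etale (MvPolynomial (Fin 1) A) B := hg
  let γ : MvPolynomial (Fin 1) A →+* AdjoinRoot q :=
    MvPolynomial.eval₂Hom (o.comp j) (fun _ => y)
  let : Algebra (MvPolynomial (Fin 1) A) (AdjoinRoot q) := γ.toAlgebra
  have hγC : ∀ a, γ (MvPolynomial.C a) = o (j a) := fun a => MvPolynomial.eval₂_C _ _ _
  have hγX : γ (MvPolynomial.X 0) = y := MvPolynomial.eval₂_X _ _ _
  have hφγ : φ.comp γ = g := by
    refine MvPolynomial.ringHom_ext (fun a => ?_) (fun n => ?_)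
    · show φ (γ _) = _
      rw [hγC, hφo, h.F_j, hgC]
    · obtain rfl : n = 0 := Subsingleton.elim _ _
      show φ (γ _) = _
      rw [hγX, hφy]
  let φA : AdjoinRoot q →ₐ[MvPolynomial (Fin 1) A] B :=
    { φ with commutes' := fun r => RingHom.congr_fun hφγ r }
  -- `φ` is surjective: `B` is unramified over `B₁[Y] / (Y ^ p - x ⊗ 1)`, and `b ^ p = φ(b ⊗ 1)`
  have hsurj : Function.Surjective φ := by
    let : Algebra (AdjoinRoot q) B := φ.toAlgebra
    have : IsScalarTower (MvPolynomial (Fin 1) A) (AdjoinRoot q) B :=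
      IsScalarTower.of_algebraMap_eq' hφγ.symm
    have : Algebra.FormallyUnramified (AdjoinRoot q) B :=
      Algebra.FormallyUnramified.of_restrictScalars (MvPolynomial (Fin 1) A) _ _
    have : Algebra.FiniteType (AdjoinRoot q) B :=
      Algebra.FiniteType.of_restrictScalars_finiteType (MvPolynomial (Fin 1) A) _ _
    exact algebraMap_surjective_of_unramified p hB fun b => ⟨o (w b), (hφo _).trans (h.F_w b)⟩
  -- the kernel of `φ` is finitely generated, hence nilpotent
  have hft : Algebra.FiniteType (MvPolynomial (Fin 1) A) (AdjoinRoot q) := by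
    obtain ⟨s, hs⟩ := (inferInstance : Algebra.FiniteType (MvPolynomial (Fin 1) A) B).out
    refine ⟨s.image (o.comp w), ?_⟩
    set T := Algebra.adjoin (MvPolynomial (Fin 1) A)
      ((s.image (o.comp w) : Finset (AdjoinRoot q)) : Set (AdjoinRoot q)) with hT
    have hTj : ∀ a, o (j a) ∈ T := fun a => hγC a ▸ T.algebraMap_mem (MvPolynomial.C a)
    have hTy : y ∈ T := hγX ▸ T.algebraMap_mem (MvPolynomial.X 0)
    have hTw : ∀ b, o (w b) ∈ T := by
      intro b
      have hb : b ∈ Algebra.adjoin (MvPolynomial (Fin 1) A) (s : Set B) := hs ▸ Algebra.mem_top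
      induction hb using Algebra.adjoin_induction with
      | mem b hb => exact Algebra.subset_adjoin (by simpa using ⟨b, hb, rfl⟩)
      | algebraMap r =>
        show o (w (g r)) ∈ T
        induction r using MvPolynomial.induction_on with
        | C a => rw [hgC, h.w_i, map_pow]; exact pow_mem (hTj a) p
        | add a b ha hb => simp only [map_add]; exact add_mem ha hb
        | mul_X a n ha =>
          obtain rfl : n = 0 := Subsingleton.elim _ _
          rw [map_mul, map_mul, map_mul, ← hx, ← hy]
          exact mul_mem ha (pow_mem hTy p)
      | add a b _ _ ha hb => simp only [map_add]; exact add_mem ha hb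
      | mul a b _ _ ha hb => simp only [map_mul]; exact mul_mem ha hb
    have hTo : ∀ b, o b ∈ T := by
      have := h.generated (T.toSubring.comap o) hTj hTw
      intro b
      have hb : b ∈ T.toSubring.comap o := this ▸ Subring.mem_top b
      exact hb
    rw [eq_top_iff]
    rintro z -
    induction z using AdjoinRoot.induction_on with
    | ih r =>
      induction r using Polynomial.induction_on with
      | C a => exact hTo a
      | add a b ha hb => rw [map_add]; exact add_mem ha hb
      | monomial n a _ =>
        rw [map_mul, map_pow]
        exact mul_mem (hTo a) (pow_mem hTy _)
  refine ⟨?_, hsurj⟩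
  have hJ : IsNilpotent (RingHom.ker φA.toRingHom) := by
    refine isNilpotent_of_fg_of_pow_eq_zero (ker_fg_of_finiteType φA hsurj) p fun z hz => ?_
    have hz' : φ z = 0 := hz
    rw [← hψφ, hz', map_zero, map_zero]
  -- étaleness of `B` lifts the identity to a section `σ` of `φ`; it is a two-sided inverse because
  -- both composites agree on `A`, on `Y` and, by unramifiedness, on the image of `b ↦ b ⊗ 1`
  let σ : B →ₐ[MvPolynomial (Fin 1) A] AdjoinRoot q :=
    Algebra.FormallySmooth.liftOfSurjective (AlgHom.id _ B) φA hsurj hJ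
  have hσ : ∀ b, φ (σ b) = b := fun b =>
    Algebra.FormallySmooth.liftOfSurjective_apply (AlgHom.id _ B) φA hsurj hJ b
  have hτγ : ∀ r, σ (φ (γ r)) = γ r := by
    intro r
    have h1 : φ (γ r) = algebraMap _ B r := RingHom.congr_fun hφγ r
    rw [h1, σ.commutes]
    rfl
  have hτ : σ.toRingHom.comp φ = RingHom.id _ := by
    refine AdjoinRoot.ringHom_ext (h.ringHom_ext (fun a => ?_) ?_) ?_
    · show σ (φ (o (j a))) = o (j a)
      rw [← hγC, hτγ]
    · refine RingHom.congr_fun (f := (σ.toRingHom.comp φ).comp (o.comp w)) (g := o.comp w) ?_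
      refine ringHom_ext_of_formallyUnramified (P := MvPolynomial (Fin 1) A) ?_ _ hJ ?_
      · refine MvPolynomial.ringHom_ext (fun a => ?_) (fun n => ?_)
        · show σ (φ (o (w (g (MvPolynomial.C a))))) = o (w (g (MvPolynomial.C a)))
          rw [hgC, h.w_i, map_pow, ← hγC, ← map_pow, hτγ]
        · obtain rfl : n = 0 := Subsingleton.elim _ _
          show σ (φ (o (w x))) = o (w x)
          rw [← hy, ← hγX, ← map_pow, hτγ]
      · intro b
        show φ (σ (φ (o (w b))) - o (w b)) = 0
        rw [map_sub, hσ, sub_self]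
    · show σ (φ y) = y
      rw [← hγX, hτγ]
  exact Function.LeftInverse.injective (g := σ) fun z => RingHom.congr_fun hτ z

/-- If `B` is étale over the affine line over `A`, with coordinate `x`, then `B` is free over `B₁`
with basis `1, x, …, x ^ (p - 1)`. -/
theorem IsRelativeFrobenius.existsUnique_sum (h : IsRelativeFrobenius p i j w F)
    [hp : Fact p.Prime] (hB₁ : (p : B₁) = 0) (g : MvPolynomial (Fin 1) A →+* B) (hg : g.Etale)
    (hgi : g.comp MvPolynomial.C = i) (b : B) :
    ∃! c : Fin p → B₁, b = ∑ n, F (c n) * g (MvPolynomial.X 0) ^ (n : ℕ) := by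
  rcases subsingleton_or_nontrivial B₁ with hs | hn
  · have : Subsingleton B := by
      refine subsingleton_of_zero_eq_one ?_
      rw [← map_zero F, ← map_one F, Subsingleton.elim (0 : B₁) 1]
    exact ⟨0, Subsingleton.elim _ _, fun _ _ => Subsingleton.elim _ _⟩
  have hbij := h.bijective_lift hB₁ g hg hgi
  set x := g (MvPolynomial.X 0) with hx
  set q : B₁[X] := X ^ p - C (w x) with hq
  set φ : AdjoinRoot q →+* B := AdjoinRoot.lift F x (by simp [hq, h.F_w]) with hφ
  have hmonic : q.Monic := monic_X_pow_sub_C _ hp.out.ne_zero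
  have hdeg : q.natDegree = p := natDegree_X_pow_sub_C
  let bas := (AdjoinRoot.powerBasis' hmonic).basis.reindex (finCongr hdeg)
  have hbas : ∀ n, bas n = AdjoinRoot.root q ^ (n : ℕ) := by
    intro n
    simp [bas]
    rfl
  have key : ∀ c : Fin p → B₁, φ (∑ n, c n • bas n) = ∑ n, F (c n) * x ^ (n : ℕ) := by
    intro c
    rw [map_sum]
    refine Finset.sum_congr rfl fun n _ => ?_
    rw [hbas, Algebra.smul_def, map_mul, map_pow]
    congr 1
    · exact AdjoinRoot.lift_of _
    · rw [hφ, AdjoinRoot.lift_root]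
  obtain ⟨z, rfl⟩ := hbij.2 b
  refine ⟨bas.equivFun z, ?_, fun c hc => ?_⟩
  · show φ z = _
    rw [← key]
    congr 1
    exact (bas.sum_equivFun z).symm
  · have hc' : φ z = ∑ n, F (c n) * x ^ (n : ℕ) := hc
    rw [← key] at hc'
    rw [hbij.1 hc', ← bas.equivFun_symm_apply, LinearEquiv.apply_symm_apply]

end EtaleAlgebra

/-! ### `p`-bases and partial derivatives -/

section PBasis

variable {R₁ R : Type*} [CommRing R₁] [CommRing R] {p : ℕ} {F : R₁ →+* R} {x : R}

/-- `R` is free over `R₁`, via `F`, with basis `1, x, …, x ^ (p - 1)`. -/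
def IsPBasis (p : ℕ) (F : R₁ →+* R) (x : R) : Prop :=
  ∀ b : R, ∃! c : Fin p → R₁, b = ∑ n, F (c n) * x ^ (n : ℕ)

/-- The coefficients of `b` in the basis `1, x, …, x ^ (p - 1)`. -/
noncomputable def IsPBasis.coeff (h : IsPBasis p F x) (b : R) : Fin p → R₁ := (h b).choose

lemma IsPBasis.sum_coeff (h : IsPBasis p F x) (b : R) :
    ∑ n, F (h.coeff b n) * x ^ (n : ℕ) = b := (h b).choose_spec.1.symm

lemma IsPBasis.coeff_eq (h : IsPBasis p F x) {b : R} {c : Fin p → R₁}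
    (hc : b = ∑ n, F (c n) * x ^ (n : ℕ)) : h.coeff b = c :=
  ((h b).choose_spec.2 c hc).symm

lemma IsPBasis.coeff_add (h : IsPBasis p F x) (a b : R) :
    h.coeff (a + b) = h.coeff a + h.coeff b := by
  refine h.coeff_eq ?_
  simp only [Pi.add_apply, map_add, add_mul, Finset.sum_add_distrib, h.sum_coeff]

lemma IsPBasis.coeff_mul (h : IsPBasis p F x) (r : R₁) (b : R) :
    h.coeff (F r * b) = r • h.coeff b := by
  refine h.coeff_eq ?_
  simp only [Pi.smul_apply, smul_eq_mul, map_mul, mul_assoc, ← Finset.mul_sum, h.sum_coeff]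

lemma IsPBasis.coeff_zero (h : IsPBasis p F x) : h.coeff 0 = 0 :=
  h.coeff_eq (by simp)

lemma IsPBasis.coeff_mul_pow (h : IsPBasis p F x) (r : R₁) (n : Fin p) :
    h.coeff (F r * x ^ (n : ℕ)) = Pi.single n r := by
  classical
  refine h.coeff_eq ?_
  rw [Finset.sum_eq_single n]
  · simp
  · intro m _ hm
    rw [Pi.single_eq_of_ne hm, map_zero, zero_mul]
  · simp

lemma IsPBasis.injective (h : IsPBasis p F x) [hp : Fact p.Prime] : Function.Injective F := by
  intro a b hab
  have h1 := h.coeff_mul_pow a ⟨0, hp.out.pos⟩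
  have h2 := h.coeff_mul_pow b ⟨0, hp.out.pos⟩
  rw [hab, h2] at h1
  have := congrFun h1 ⟨0, hp.out.pos⟩
  simpa using this.symm

@[elab_as_elim]
lemma IsPBasis.induction_on (h : IsPBasis p F x) {P : R → Prop} (b : R)
    (mul_pow : ∀ (c : R₁) (n : ℕ), P (F c * x ^ n)) (add : ∀ a b, P a → P b → P (a + b)) : P b := by
  rw [← h.sum_coeff b]
  have h0 : P 0 := by simpa using mul_pow 0 0
  exact Finset.sum_induction _ P (fun a b => add a b) h0 fun n _ => mul_pow _ _

/-- The derivation `d/dx` of `R` over `R₁`, relative to a `p`-basis `x`. -/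
structure IsPartialDerivative (F : R₁ →+* R) (x : R) (D : Derivation ℤ R R) : Prop where
  map_F : ∀ c, D (F c) = 0
  map_x : D x = 1

lemma IsPartialDerivative.map_F_mul {D : Derivation ℤ R R} (hD : IsPartialDerivative F x D)
    (c : R₁) (b : R) : D (F c * b) = F c * D b := by
  rw [D.leibniz, hD.map_F, smul_zero, add_zero, smul_eq_mul]

lemma IsPartialDerivative.map_pow {D : Derivation ℤ R R} (hD : IsPartialDerivative F x D) (n : ℕ) :
    D (x ^ n) = n * x ^ (n - 1) := by
  rw [D.leibniz_pow, hD.map_x, smul_eq_mul, mul_one, nsmul_eq_mul]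

lemma IsPartialDerivative.map_sum {D : Derivation ℤ R R} (hD : IsPartialDerivative F x D)
    (c : Fin p → R₁) : D (∑ n, F (c n) * x ^ (n : ℕ)) =
      ∑ n : Fin p, F (c n) * ((n : ℕ) * x ^ ((n : ℕ) - 1)) := by
  rw [_root_.map_sum]
  exact Finset.sum_congr rfl fun n _ => by rw [hD.map_F_mul, hD.map_pow]

open Classical in
/-- The derivation `d/dx` exists: the formula `x ^ n ↦ n x ^ (n - 1)` for `n < p` holds for all `n`,
because `x ^ p` is a constant and `p = 0`. -/
theorem IsPBasis.exists_isPartialDerivative (h : IsPBasis p F x) [hp : Fact p.Prime]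
    (h0 : (p : R₁) = 0) {t : R₁} (ht : x ^ p = F t) :
    ∃ D : Derivation ℤ R R, IsPartialDerivative F x D := by
  have h0' : (p : R) = 0 := by simpa using congrArg F h0
  let D₀ : R →+ R := AddMonoidHom.mk'
    (fun b => ∑ n : Fin p, F (h.coeff b n) * ((n : ℕ) * x ^ ((n : ℕ) - 1)))
    (fun a b => by
      simp only [h.coeff_add, Pi.add_apply, map_add, add_mul, Finset.sum_add_distrib])
  have hF : ∀ r b, D₀ (F r * b) = F r * D₀ b := by
    intro r b
    show ∑ n : Fin p, _ = F r * ∑ n : Fin p, _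
    simp only [h.coeff_mul, Pi.smul_apply, smul_eq_mul, map_mul, mul_assoc, ← Finset.mul_sum]
  have hlt : ∀ n < p, D₀ (x ^ n) = n * x ^ (n - 1) := by
    intro n hn
    have h1 := h.coeff_mul_pow 1 ⟨n, hn⟩
    rw [map_one, one_mul] at h1
    show ∑ m : Fin p, F (h.coeff (x ^ n) m) * _ = _
    rw [show h.coeff (x ^ n) = Pi.single ⟨n, hn⟩ 1 from h1,
      Finset.sum_eq_single ⟨n, hn⟩]
    · simp
    · intro m _ hm
      rw [Pi.single_eq_of_ne hm, map_zero, zero_mul]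
    · simp
  have hpow : ∀ n : ℕ, D₀ (x ^ n) = n * x ^ (n - 1) := by
    intro n
    have hdm := Nat.div_add_mod n p
    have hx : x ^ n = F (t ^ (n / p)) * x ^ (n % p) := by
      conv_lhs => rw [← hdm]
      rw [pow_add, pow_mul, ht, map_pow]
    rw [hx, hF, hlt _ (Nat.mod_lt _ hp.out.pos)]
    have hcast : (n : R) = ((n % p : ℕ) : R) := by
      conv_lhs => rw [← hdm]
      push_cast
      rw [h0', zero_mul, zero_add]
    rcases Nat.eq_zero_or_pos (n % p) with h2 | h2
    · rw [hcast, h2]; simp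
    · have h3 : x ^ (n - 1) = F (t ^ (n / p)) * x ^ (n % p - 1) := by
        have : n - 1 = p * (n / p) + (n % p - 1) := by omega
        rw [this, pow_add, pow_mul, ht, map_pow]
      rw [h3, hcast]; ring
  have hone : ∀ c, D₀ (F c) = 0 := by
    intro c
    have := hpow 0
    rw [pow_zero, Nat.cast_zero, zero_mul] at this
    rw [← mul_one (F c), hF, this, mul_zero]
  have hmul : ∀ a b, D₀ (a * b) = a • D₀ b + b • D₀ a := by
    intro a b
    induction a using h.induction_on with
    | add a a' ha ha' => rw [add_mul, map_add, ha, ha', map_add, smul_add, add_smul]; abel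
    | mul_pow c n =>
      induction b using h.induction_on with
      | add b b' hb hb' => rw [mul_add, map_add, hb, hb', map_add, smul_add, add_smul]; abel
      | mul_pow c' m =>
        rw [show F c * x ^ n * (F c' * x ^ m) = F (c * c') * x ^ (n + m) by rw [map_mul]; ring,
          hF, hF, hF, hpow, hpow, hpow, map_mul]
        rcases n with _ | n
        · simp; ring
        · rcases m with _ | m
          · simp; ring
          · simp only [smul_eq_mul, Nat.add_sub_cancel,
              show n + 1 + (m + 1) - 1 = n + m + 1 by omega]
            push_cast
            ring
  refine ⟨Derivation.mk' D₀.toIntLinearMap hmul, hone, ?_⟩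
  have := hpow 1
  simp only [pow_one, Nat.cast_one, Nat.sub_self, pow_zero, mul_one] at this
  exact this

lemma isUnit_natCast {S : Type*} [CommRing S] {p : ℕ} [hp : Fact p.Prime] (h0 : (p : S) = 0)
    {n : ℕ} (hn : 0 < n) (hnp : n < p) : IsUnit (n : S) := by
  have h1 : IsCoprime (n : ℤ) p := by
    rw [Nat.isCoprime_iff_coprime]
    exact (Nat.coprime_of_lt_prime hn.ne' hnp hp.out).symm
  obtain ⟨a, b, hab⟩ := h1
  have := congrArg (Int.cast : ℤ → S) hab
  push_cast at this
  rw [h0, mul_zero, add_zero] at this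
  exact IsUnit.of_mul_eq_one_right _ this

section

variable {D : Derivation ℤ R R}

/-- The functions killed by `d/dx` are the constants. -/
theorem IsPartialDerivative.exists_eq_of_eq_zero (hD : IsPartialDerivative F x D)
    (h : IsPBasis p F x) [hp : Fact p.Prime] (h0 : (p : R₁) = 0) {b : R} (hb : D b = 0) :
    ∃ c, b = F c := by
  obtain ⟨q, rfl⟩ : ∃ q, p = q + 1 := ⟨p - 1, (Nat.succ_pred_eq_of_pos hp.out.pos).symm⟩
  have h1 : (0 : R) = ∑ n : Fin (q + 1),
      F ((Fin.lastCases 0 (fun m : Fin q => ((m + 1 : ℕ) : R₁) * h.coeff b m.succ) n : R₁)) *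
        x ^ (n : ℕ) := by
    rw [← hb]
    conv_lhs => rw [← h.sum_coeff b]
    rw [hD.map_sum, Fin.sum_univ_succ, Fin.sum_univ_castSucc]
    simp only [Fin.val_zero, Nat.cast_zero, zero_mul, mul_zero, zero_add, Fin.lastCases_last,
      map_zero, add_zero, Fin.lastCases_castSucc, Fin.val_castSucc, Fin.val_succ,
      Nat.add_sub_cancel, map_mul, map_natCast]
    exact Finset.sum_congr rfl fun n _ => by ring
  have h2 := h.coeff_eq h1
  rw [h.coeff_zero] at h2
  refine ⟨h.coeff b 0, ?_⟩
  conv_lhs => rw [← h.sum_coeff b]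
  rw [Fin.sum_univ_succ, Finset.sum_eq_zero, add_zero, Fin.val_zero, pow_zero, mul_one]
  intro m _
  have h3 := congrFun h2 m.castSucc
  rw [Fin.lastCases_castSucc] at h3
  have h4 : h.coeff b m.succ = 0 :=
    (isUnit_natCast h0 (Nat.succ_pos _) (Nat.succ_lt_succ m.2)).mul_right_eq_zero.mp h3.symm
  rw [h4, map_zero, zero_mul]

lemma IsPartialDerivative.iterate_mul_pow (hD : IsPartialDerivative F x D) (c : R₁) (n k : ℕ)
    (hk : n < k) : D^[k] (F c * x ^ n) = 0 := by
  induction n generalizing c k with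
  | zero =>
    obtain ⟨k, rfl⟩ := Nat.exists_eq_succ_of_ne_zero hk.ne'
    rw [Function.iterate_succ_apply, pow_zero, mul_one, hD.map_F]
    exact iterate_map_zero D k
  | succ n ih =>
    obtain ⟨k, rfl⟩ := Nat.exists_eq_succ_of_ne_zero (Nat.ne_zero_of_lt hk)
    rw [Function.iterate_succ_apply, hD.map_F_mul, hD.map_pow, Nat.add_sub_cancel]
    have := ih (((n + 1 : ℕ) : R₁) * c) k (by omega)
    rw [map_mul, map_natCast] at this
    rw [← this]
    congr 1
    ring

/-- The `p`-th power of `d/dx` vanishes. -/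
theorem IsPartialDerivative.iterate_eq_zero (hD : IsPartialDerivative F x D)
    (h : IsPBasis p F x) (b : R) : D^[p] b = 0 := by
  have h0 : D^[p] 0 = 0 := iterate_map_zero D p
  rw [← h.sum_coeff b]
  refine Finset.sum_induction _ (fun b => D^[p] b = 0) (fun a b ha hb => ?_) h0
    fun n _ => hD.iterate_mul_pow _ _ _ n.2
  rw [iterate_map_add, ha, hb, add_zero]

/-- A function whose coefficient at `x ^ (p - 1)` vanishes is a derivative. -/
theorem IsPartialDerivative.exists_map_eq (hD : IsPartialDerivative F x D)
    [hp : Fact p.Prime] (h0 : (p : R) = 0) (c : Fin p → R₁)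
    (hc : ∀ n : Fin p, (n : ℕ) = p - 1 → c n = 0) : ∃ g, D g = ∑ n, F (c n) * x ^ (n : ℕ) := by
  have h1 : ∀ n : Fin p, ∃ g, D g = F (c n) * x ^ (n : ℕ) := by
    intro n
    by_cases hn : (n : ℕ) = p - 1
    · exact ⟨0, by rw [hc n hn, map_zero, map_zero, zero_mul]⟩
    · have hp0 := hp.out.pos
      obtain ⟨w, hw⟩ := (isUnit_natCast h0 (Nat.succ_pos n) (by omega)).exists_left_inv
      have hDw : D w = 0 := by
        have h2 := congrArg D hw
        rw [D.leibniz, D.map_natCast, smul_zero, zero_add, D.map_one_eq_zero, smul_eq_mul] at h2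
        have h3 := congrArg (w * ·) h2
        simp only [mul_zero, ← mul_assoc, hw, one_mul] at h3
        exact h3
      refine ⟨F (c n) * (w * x ^ ((n : ℕ) + 1)), ?_⟩
      rw [hD.map_F_mul, D.leibniz, hDw, smul_zero, add_zero, hD.map_pow, Nat.add_sub_cancel,
        smul_eq_mul, ← mul_assoc w, hw, one_mul]
  choose g hg using h1
  exact ⟨∑ n, g n, by rw [_root_.map_sum]; exact Finset.sum_congr rfl fun n _ => hg n⟩

end

end PBasis

/-! ### Cartier's theorem in one variable and `p`-th powers of sums -/

section HorizontalSpan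

variable {R M : Type*} [CommRing R] [AddCommGroup M] [Module R M] {p : ℕ}

/-- The sequence `(-x) ^ n / n!`, for `n < p`. -/
lemma exists_dividedPowers [hp : Fact p.Prime] (h0 : (p : R) = 0) (D : Derivation ℤ R R) {x : R}
    (hx : D x = 1) : ∃ a : ℕ → R, a 0 = 1 ∧ D (a 0) = 0 ∧
      ∀ n, n + 1 < p → D (a (n + 1)) = -a n := by
  have hinv : ∀ n : ℕ, ∃ v : R, D v = 0 ∧ (n + 1 < p → v * (n + 1 : ℕ) = 1) := by
    intro n
    by_cases hn : n + 1 < p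
    · obtain ⟨w, hw⟩ := (isUnit_natCast h0 (Nat.succ_pos n) hn).exists_left_inv
      refine ⟨w, ?_, fun _ => hw⟩
      have h2 := congrArg D hw
      rw [D.leibniz, D.map_natCast, smul_zero, zero_add, D.map_one_eq_zero, smul_eq_mul] at h2
      have h3 := congrArg (w * ·) h2
      simp only [mul_zero, ← mul_assoc, hw, one_mul] at h3
      exact h3
    · exact ⟨0, map_zero D, fun h => absurd h hn⟩
  choose v hDv hv using hinv
  let c : ℕ → R := fun n => ∏ i ∈ Finset.range n, -v i
  have hc : ∀ n, D (c n) = 0 := by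
    intro n
    induction n with
    | zero => simp [c]
    | succ n ih =>
      show D (∏ i ∈ Finset.range (n + 1), -v i) = 0
      rw [Finset.prod_range_succ, D.leibniz, map_neg, hDv, neg_zero, smul_zero, zero_add]
      have : D (∏ i ∈ Finset.range n, -v i) = 0 := ih
      rw [this, smul_zero]
  refine ⟨fun n => c n * x ^ n, by simp [c], by simp [c], fun n hn => ?_⟩
  have h1 : c (n + 1) = c n * -v n := Finset.prod_range_succ _ _
  rw [D.leibniz, hc, smul_zero, add_zero, D.leibniz_pow, hx, Nat.add_sub_cancel, h1, smul_eq_mul,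
    nsmul_eq_mul, smul_eq_mul, mul_one]
  linear_combination -c n * x ^ n * hv n hn

/-- Cartier's theorem in one variable: if `N` is a connection along `D = d/dx` with `N ^ p = 0`,
then the module is generated by its horizontal elements. -/
theorem mem_span_horizontal [hp : Fact p.Prime] (h0 : (p : R) = 0) (D : Derivation ℤ R R) {x : R}
    (hx : D x = 1) (N : M →+ M) (hN : ∀ (a : R) (m : M), N (a • m) = D a • m + a • N m)
    (n : ℕ) (hn : n ≤ p) (m : M) (hm : N^[n] m = 0) :
    m ∈ Submodule.span R {k : M | N k = 0} := by
  obtain ⟨a, ha0, hDa0, hDa⟩ := exists_dividedPowers h0 D hx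
  induction n using Nat.strong_induction_on generalizing m with
  | h n ih =>
  rcases n with _ | n
  · rw [Function.iterate_zero, id] at hm
    rw [hm]
    exact zero_mem _
  -- `∑ i < n + 1, (-x) ^ i / i! • N ^ i m` is horizontal, since its image under `N` telescopes, and
  -- it differs from `m` by a combination of elements that are killed by a lower power of `N`
  · have htel : ∀ k, k < p → N (∑ i ∈ Finset.range (k + 1), a i • N^[i] m) = a k • N^[k + 1] m := by
      intro k
      induction k with
      | zero =>
        intro _
        rw [Finset.sum_range_one, hN, hDa0, zero_smul, zero_add]
        rfl
      | succ k ihk =>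
        intro hk
        rw [Finset.sum_range_succ, map_add, ihk (by omega), hN, hDa k hk,
          ← Function.iterate_succ_apply' N (k + 1)]
        module
    have hP := htel n hn
    rw [hm, smul_zero] at hP
    have h1 : m = (∑ i ∈ Finset.range (n + 1), a i • N^[i] m) -
        ∑ i ∈ Finset.range n, a (i + 1) • N^[i + 1] m := by
      rw [Finset.sum_range_succ', ha0, one_smul, add_sub_cancel_left]
      rfl
    rw [h1]
    refine sub_mem (Submodule.subset_span hP) (sum_mem fun i hi => Submodule.smul_mem _ _ ?_)
    have hi' := Finset.mem_range.mp hi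
    refine ih (n - i) (by omega) (by omega) _ ?_
    rw [← Function.iterate_add_apply]
    rw [show n - i + (i + 1) = n + 1 by omega]
    exact hm

end HorizontalSpan

section PowerDifferential

/-- `(a + b) ^ (p - 1) d(a + b) = a ^ (p - 1) da + b ^ (p - 1) db + dz`, with `z` the value at
`(a, b)` of the polynomial `((X + Y) ^ p - X ^ p - Y ^ p) / p`. -/
theorem exists_add_pow_smul_eq {R M : Type*} [CommRing R] [AddCommGroup M] [Module R M] (p : ℕ)
    [hp : Fact p.Prime] (δ : R → M) (hadd : ∀ a b, δ (a + b) = δ a + δ b)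
    (hmul : ∀ a b, δ (a * b) = a • δ b + b • δ a) (a b : R) :
    ∃ z, (a + b) ^ (p - 1) • δ (a + b) = a ^ (p - 1) • δ a + b ^ (p - 1) • δ b + δ z := by
  let D : Derivation ℤ R M := Derivation.mk' (AddMonoidHom.mk' δ hadd).toIntLinearMap hmul
  have hD : ∀ r, D r = δ r := fun _ => rfl
  let X : MvPolynomial (Fin 2) ℤ := MvPolynomial.X 0
  let Y : MvPolynomial (Fin 2) ℤ := MvPolynomial.X 1
  obtain ⟨z, hz⟩ := exists_add_pow_prime_eq hp.out X Y
  -- over `ℤ[X, Y]`, where `p` may be cancelled, the identity is the differential of the formula for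
  -- `(X + Y) ^ p`; it is then specialized at `(a, b)`
  have hp0 : (p : MvPolynomial (Fin 2) ℤ) ≠ 0 := by
    exact_mod_cast hp.out.ne_zero
  let d := KaehlerDifferential.D ℤ (MvPolynomial (Fin 2) ℤ)
  have hinj : ∀ η η' : Ω[MvPolynomial (Fin 2) ℤ⁄ℤ], (p : MvPolynomial (Fin 2) ℤ) • η =
      (p : MvPolynomial (Fin 2) ℤ) • η' → η = η' := by
    intro η η' h
    let e := KaehlerDifferential.mvPolynomialEquiv ℤ (Fin 2)
    apply e.injective
    have h' := congrArg e h
    rw [map_smul, map_smul] at h'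
    ext1 i
    have h2 := DFunLike.congr_fun h' i
    rw [Finsupp.smul_apply, Finsupp.smul_apply, smul_eq_mul, smul_eq_mul] at h2
    exact mul_left_cancel₀ hp0 h2
  have key : (X + Y) ^ (p - 1) • d (X + Y) =
      X ^ (p - 1) • d X + Y ^ (p - 1) • d Y + d (X * Y * z) := by
    apply hinj
    have h := congrArg d hz
    rw [mul_assoc, mul_assoc, ← mul_assoc X, map_add, map_add, d.leibniz_pow, d.leibniz_pow,
      d.leibniz_pow, d.leibniz (p : MvPolynomial (Fin 2) ℤ), d.map_natCast, smul_zero,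
      add_zero] at h
    rw [smul_add, smul_add, Nat.cast_smul_eq_nsmul, Nat.cast_smul_eq_nsmul,
      Nat.cast_smul_eq_nsmul, h]
  let φ : MvPolynomial (Fin 2) ℤ →ₐ[ℤ] R := MvPolynomial.aeval ![a, b]
  let : Algebra (MvPolynomial (Fin 2) ℤ) R := φ.toAlgebra
  let : Module (MvPolynomial (Fin 2) ℤ) M := Module.compHom M φ.toRingHom
  have : IsScalarTower (MvPolynomial (Fin 2) ℤ) R M := ⟨fun r s m => by
    show (φ r * s) • m = φ r • s • m
    rw [mul_smul]⟩
  let E := (D.compAlgebraMap (MvPolynomial (Fin 2) ℤ)).liftKaehlerDifferential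
  have hE : ∀ r, E (d r) = δ (φ r) := fun r =>
    Derivation.liftKaehlerDifferential_comp_D (D.compAlgebraMap (MvPolynomial (Fin 2) ℤ)) r
  have hs : ∀ (r : MvPolynomial (Fin 2) ℤ) (m : M), r • m = φ r • m := fun _ _ => rfl
  have hX : φ X = a := by simp [φ, X]
  have hY : φ Y = b := by simp [φ, Y]
  refine ⟨φ (X * Y * z), ?_⟩
  have h : E _ = E _ := congrArg E key
  rw [E.map_smul, E.map_add, E.map_add, E.map_smul, E.map_smul, hE, hE, hE, hE, hs, hs, hs,
    map_pow, map_pow, map_pow, map_add, hX, hY] at h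
  exact h

end PowerDifferential

/-! ### Gluing sections and morphisms -/

section Gluing

variable {X : Scheme.{u}}

lemma res_self (M : X.Modules) {V : X.Opens} (m : Γ(M, V)) : res M le_rfl m = m :=
  ConcreteCategory.congr_hom (M.presheaf.map_id (op V)) m

lemma eq_of_local (M : X.Modules) {V : X.Opens} {m m' : Γ(M, V)}
    (h : ∀ x ∈ V, ∃ (W : X.Opens) (hW : W ≤ V), x ∈ W ∧ res M hW m = res M hW m') : m = m' := by
  rw [← sub_eq_zero]
  refine eq_zero_of_local M _ fun x hx => ?_
  obtain ⟨W, hW, hxW, h0⟩ := h x hx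
  exact ⟨W, hW, hxW, by rw [map_sub, h0, sub_self]⟩

/-- Sections that are given locally, and determined there by a property `P`, glue. -/
theorem exists_section_of_local (N : X.Modules) {V : X.Opens}
    (P : ∀ W : X.Opens, W ≤ V → Γ(N, W) → Prop)
    (hres : ∀ (W W' : X.Opens) (hW : W ≤ V) (h : W' ≤ W) (s : Γ(N, W)), P W hW s →
      P W' (h.trans hW) (res N h s))
    (huniq : ∀ (W : X.Opens) (hW : W ≤ V) (s s' : Γ(N, W)), P W hW s → P W hW s' → s = s')
    (hloc : ∀ x ∈ V, ∃ (W : X.Opens) (hW : W ≤ V), x ∈ W ∧ ∃ s, P W hW s) :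
    ∃ s : Γ(N, V), ∀ (W : X.Opens) (hW : W ≤ V) (t : Γ(N, W)), P W hW t → res N hW s = t := by
  choose W hW hxW t ht using hloc
  obtain ⟨s, hs, -⟩ := TopCat.Sheaf.existsUnique_gluing'
    (⟨N.presheaf, N.isSheaf⟩ : TopCat.Sheaf Ab X)
    (fun x : V => W x.1 x.2) V (fun x => homOfLE (hW x.1 x.2))
    (fun x hx => Opens.mem_iSup.mpr ⟨⟨x, hx⟩, hxW x hx⟩) (fun x => t x.1 x.2) (by
      intro x y
      exact huniq _ (inf_le_left.trans (hW x.1 x.2)) _ _ (hres _ _ _ inf_le_left _ (ht x.1 x.2))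
        (hres _ _ _ inf_le_right _ (ht y.1 y.2)))
  refine ⟨s, fun W' hW' t' ht' => eq_of_local N fun x hx => ?_⟩
  refine ⟨W' ⊓ W x (hW' hx), inf_le_left, ⟨hx, hxW _ _⟩, ?_⟩
  have h1 : res N (hW x (hW' hx)) s = t x (hW' hx) := hs ⟨x, hW' hx⟩
  have h2 := congrArg (res N (inf_le_right : W' ⊓ W x (hW' hx) ≤ _)) h1
  rw [res_res] at h2 ⊢
  exact h2.trans (huniq _ (inf_le_left.trans hW') _ _ (hres _ _ _ inf_le_right _ (ht _ _))
    (hres _ _ _ inf_le_left _ ht'))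

/-- An additive relation between sections of `M` and of `N` that is single valued and locally
defined everywhere is the graph of a morphism of sheaves. -/
theorem exists_presheafHom_of_relation (M N : X.Modules)
    (R : ∀ W : X.Opens, Γ(M, W) → Γ(N, W) → Prop)
    (hres : ∀ (W W' : X.Opens) (h : W' ≤ W) (m : Γ(M, W)) (n : Γ(N, W)), R W m n →
      R W' (res M h m) (res N h n))
    (hadd : ∀ (W : X.Opens) (m m' : Γ(M, W)) (n n' : Γ(N, W)), R W m n → R W m' n' →
      ∀ x ∈ W, ∃ (W' : X.Opens) (h : W' ≤ W), x ∈ W' ∧ R W' (res M h (m + m')) (res N h (n + n')))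
    (huniq : ∀ (W : X.Opens) (m : Γ(M, W)) (n n' : Γ(N, W)), R W m n → R W m n' → n = n')
    (hloc : ∀ (W : X.Opens) (m : Γ(M, W)), ∀ x ∈ W, ∃ (W' : X.Opens) (h : W' ≤ W), x ∈ W' ∧
      ∃ n, R W' (res M h m) n) :
    ∃ φ : M.presheaf ⟶ N.presheaf, ∀ (W : X.Opens) (m : Γ(M, W)) (n : Γ(N, W)), R W m n →
      φ.app (op W) m = n := by
  have key : ∀ (W : X.Opens) (m : Γ(M, W)), ∃ n : Γ(N, W), ∀ (W' : X.Opens) (h : W' ≤ W)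
      (n' : Γ(N, W')), R W' (res M h m) n' → res N h n = n' := by
    intro W m
    refine exists_section_of_local N (fun W' h n' => R W' (res M h m) n') ?_ ?_ (hloc W m)
    · intro W' W'' hW h s hs
      have := hres _ _ h _ _ hs
      rwa [res_res] at this
    · intro W' hW s s' hs hs'
      exact huniq _ _ _ _ hs hs'
  choose φ hφ using key
  have hφ' : ∀ (W : X.Opens) (m : Γ(M, W)) (n : Γ(N, W)), R W m n → φ W m = n := by
    intro W m n h
    rw [← res_self N (φ W m)]
    exact hφ W m W le_rfl n (by rwa [res_self])
  have hφadd : ∀ (W : X.Opens) (m m' : Γ(M, W)), φ W (m + m') = φ W m + φ W m' := by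
    intro W m m'
    refine eq_of_local N fun x hx => ?_
    obtain ⟨W₁, h₁, hx₁, n₁, hn₁⟩ := hloc _ m x hx
    obtain ⟨W₂, h₂, hx₂, n₂, hn₂⟩ := hloc _ m' x hx
    have e₁ := hres _ (W₁ ⊓ W₂) inf_le_left _ _ hn₁
    have e₂ := hres _ (W₁ ⊓ W₂) inf_le_right _ _ hn₂
    rw [res_res] at e₁ e₂
    obtain ⟨W₃, h₃, hx₃, e₃⟩ := hadd _ _ _ _ _ e₁ e₂ x ⟨hx₁, hx₂⟩
    refine ⟨W₃, h₃.trans (inf_le_left.trans h₁), hx₃, ?_⟩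
    rw [← map_add, res_res] at e₃
    rw [hφ _ _ _ _ _ e₃, map_add, map_add]
    have e₁' := hres _ _ h₃ _ _ e₁
    have e₂' := hres _ _ h₃ _ _ e₂
    rw [res_res] at e₁' e₂'
    rw [hφ _ _ _ _ _ e₁', hφ _ _ _ _ _ e₂']
  refine ⟨{ app := fun W => AddCommGrpCat.ofHom (AddMonoidHom.mk' (φ W.unop) (hφadd W.unop)),
            naturality := ?_ }, hφ'⟩
  · intro W W' i
    ext m
    show φ W'.unop (res M i.unop.le m) = res N i.unop.le (φ W.unop m)
    refine eq_of_local N fun x hx => ?_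
    obtain ⟨W₁, h₁, hx₁, n₁, hn₁⟩ := hloc _ m x (i.unop.le hx)
    have e₁ := hres _ (W₁ ⊓ W'.unop) inf_le_left _ _ hn₁
    rw [res_res] at e₁
    refine ⟨W₁ ⊓ W'.unop, inf_le_right, ⟨hx₁, hx⟩, ?_⟩
    rw [res_res, hφ _ _ _ _ _ e₁]
    refine hφ _ _ _ _ _ ?_
    rwa [res_res]

/-- A linear map of sheaves of abelian groups, as a morphism of modules. -/
noncomputable def homOfLinear {M N : X.Modules} (φ : M.presheaf ⟶ N.presheaf)
    (hφ : ∀ (W : X.Opens) (a : Γ(X, W)) (m : Γ(M, W)),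
      φ.app (op W) (a • m) = a • φ.app (op W) m) : M ⟶ N :=
  ⟨PresheafOfModules.homMk φ (fun W a m => hφ W.unop a m)⟩

/-- A family of linear maps on sections that commutes with restriction. -/
noncomputable def homOfSections {M N : X.Modules} (φ : ∀ W : X.Opens, Γ(M, W) → Γ(N, W))
    (hadd : ∀ W m m', φ W (m + m') = φ W m + φ W m')
    (hsmul : ∀ (W : X.Opens) (a : Γ(X, W)) (m : Γ(M, W)), φ W (a • m) = a • φ W m)
    (hres : ∀ (W W' : X.Opens) (h : W' ≤ W) (m : Γ(M, W)), φ W' (res M h m) = res N h (φ W m)) :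
    M ⟶ N :=
  homOfLinear
    { app := fun W => AddCommGrpCat.ofHom (AddMonoidHom.mk' (φ W.unop) (hadd W.unop))
      naturality := fun W W' i => by
        ext m
        exact hres _ _ i.unop.le m } hsmul

lemma app_res {M N : X.Modules} (φ : M ⟶ N) {W W' : X.Opens} (h : W' ≤ W) (m : Γ(M, W)) :
    φ.app W' (res M h m) = res N h (φ.app W m) :=
  ConcreteCategory.congr_hom (φ.mapPresheaf.naturality (homOfLE h).op) m

lemma presheafHom_res {M N : X.Modules} (φ : M.presheaf ⟶ N.presheaf) {W W' : X.Opens} (h : W' ≤ W)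
    (m : Γ(M, W)) : φ.app (op W') (res M h m) = res N h (φ.app (op W) m) :=
  ConcreteCategory.congr_hom (φ.naturality (homOfLE h).op) m

lemma hom_ext_sections {M N : X.Modules} {φ ψ : M ⟶ N}
    (h : ∀ (W : X.Opens) (m : Γ(M, W)), φ.app W m = ψ.app W m) : φ = ψ := by
  ext W m
  exact h W m

/-- The linear version of `exists_presheafHom_of_relation`. -/
theorem exists_hom_of_relation (M N : X.Modules) (R : ∀ W : X.Opens, Γ(M, W) → Γ(N, W) → Prop)
    (hres : ∀ (W W' : X.Opens) (h : W' ≤ W) (m : Γ(M, W)) (n : Γ(N, W)), R W m n →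
      R W' (res M h m) (res N h n))
    (hadd : ∀ (W : X.Opens) (m m' : Γ(M, W)) (n n' : Γ(N, W)), R W m n → R W m' n' →
      ∀ x ∈ W, ∃ (W' : X.Opens) (h : W' ≤ W), x ∈ W' ∧ R W' (res M h (m + m')) (res N h (n + n')))
    (hsmul : ∀ (W : X.Opens) (a : Γ(X, W)) (m : Γ(M, W)) (n : Γ(N, W)), R W m n →
      R W (a • m) (a • n))
    (huniq : ∀ (W : X.Opens) (m : Γ(M, W)) (n n' : Γ(N, W)), R W m n → R W m n' → n = n')
    (hloc : ∀ (W : X.Opens) (m : Γ(M, W)), ∀ x ∈ W, ∃ (W' : X.Opens) (h : W' ≤ W), x ∈ W' ∧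
      ∃ n, R W' (res M h m) n) :
    ∃ φ : M ⟶ N, ∀ (W : X.Opens) (m : Γ(M, W)) (n : Γ(N, W)), R W m n → φ.app W m = n := by
  obtain ⟨φ, hφ⟩ := exists_presheafHom_of_relation M N R hres hadd huniq hloc
  refine ⟨homOfLinear φ fun W a m => eq_of_local N fun x hx => ?_, hφ⟩
  obtain ⟨W₁, h₁, hx₁, n₁, hn₁⟩ := hloc _ m x hx
  refine ⟨W₁, h₁, hx₁, ?_⟩
  rw [← presheafHom_res, res_smul, res_smul, ← presheafHom_res, hφ _ _ _ hn₁,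
    hφ _ _ _ (hsmul _ _ _ _ hn₁)]

end Gluing

section Sheafification

variable {X : Scheme.{u}}

lemma toSheafify_locally_surjective (M : X.PresheafOfModules) (V : X.Opens)
    (m : Γ(sheafify M, V)) : ∀ x ∈ V, ∃ (W : X.Opens) (hW : W ≤ V), x ∈ W ∧
      ∃ n : M.obj (op W), (toSheafify M).app (op W) n = res (sheafify M) hW m := by
  have h : Presheaf.IsLocallySurjective (Opens.grothendieckTopology X)
    (CategoryTheory.toSheafify (Opens.grothendieckTopology X) M.presheaf) := inferInstance
  intro x hx
  obtain ⟨W, i, ⟨n, hn⟩, hxW⟩ := h.imageSieve_mem (U := V) m x hx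
  exact ⟨W, i.le, hxW, n, hn⟩

lemma sheafifyLift_toSheafify {M : X.PresheafOfModules} {N : X.Modules} (φ : M ⟶ N.val)
    (V : X.Opens) (m : M.obj (op V)) :
    (sheafifyLift φ).app V ((toSheafify M).app (op V) m) = φ.app (op V) m := by
  let N' : SheafOfModules X.ringCatSheaf := N
  let adj := PresheafOfModules.sheafificationAdjunction (𝟙 X.ringCatSheaf.obj)
  have h := (adj.homEquiv_unit (X := M) (Y := N') (f := (adj.homEquiv M N').symm φ)).symm.trans
    ((adj.homEquiv M N').apply_symm_apply φ)
  exact ConcreteCategory.congr_hom (congrArg (fun ψ => PresheafOfModules.Hom.app ψ (op V)) h) m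

end Sheafification

/-! ### The universal properties of `Ω` and of tensor products -/

section Differentials

variable {X Y : Scheme.{u}}

lemma d_zero (f : X ⟶ Y) {V : X.Opens} : d f (0 : Γ(X, V)) = 0 := by
  simpa using d_add f (0 : Γ(X, V)) 0

/-- Every differential form is locally a combination of exact forms. -/
theorem exists_mem_span_d (f : X ⟶ Y) {V : X.Opens} (ω : Γ(Ω f, V)) : ∀ x ∈ V,
    ∃ (W : X.Opens) (hW : W ≤ V), x ∈ W ∧
      res (Ω f) hW ω ∈ Submodule.span Γ(X, W) (Set.range fun g : Γ(X, W) => d f g) := by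
  intro x hx
  obtain ⟨W, hW, hxW, n, hn⟩ := toSheafify_locally_surjective _ V ω x hx
  refine ⟨W, hW, hxW, ?_⟩
  rw [← hn]
  let φ := ((TopCat.Presheaf.pullbackPushforwardAdjunction CommRingCat f.base).homEquiv
    _ _).symm f.c
  let ψ : CommRingCat.KaehlerDifferential (φ.app (op W)) →ₗ[Γ(X, W)] Γ(Ω f, W) :=
    ((toSheafify (differentialsPresheaf f)).app (op W)).hom
  have key : ∀ k : CommRingCat.KaehlerDifferential (φ.app (op W)),
      k ∈ Submodule.span Γ(X, W) (Set.range fun g : Γ(X, W) =>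
        CommRingCat.KaehlerDifferential.d (f := φ.app (op W)) g) := by
    intro k
    let : Algebra _ Γ(X, W) := (φ.app (op W)).hom.toAlgebra
    have := KaehlerDifferential.span_range_derivation
      (((TopCat.Presheaf.pullback CommRingCat f.base).obj Y.presheaf).obj (op W)) Γ(X, W)
    exact this.symm ▸ Submodule.mem_top (x := k)
  have h2 := Submodule.mem_map_of_mem (f := ψ) (key n)
  rw [Submodule.map_span, ← Set.range_comp] at h2
  exact h2

/-- The subpresheaf of rings of the functions killed by a derivation. -/
noncomputable def kernelPresheaf (N : X.Modules) (δ : ∀ V : X.Opens, Γ(X, V) →+ Γ(N, V))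
    (hmul : ∀ V g h, δ V (g * h) = g • δ V h + h • δ V g)
    (hres : ∀ (V W : X.Opens) (h : W ≤ V) (g : Γ(X, V)),
      δ W (X.presheaf.map (homOfLE h).op g) = res N h (δ V g)) : TopCat.Presheaf CommRingCat X where
  obj V := CommRingCat.of
    ({ (δ V.unop).ker with
       carrier := {g | δ V.unop g = 0}
       mul_mem' := by
        intro a b ha hb
        have ha' : δ V.unop a = 0 := ha
        have hb' : δ V.unop b = 0 := hb
        show δ V.unop (a * b) = 0
        rw [hmul, ha', hb', smul_zero, smul_zero, add_zero]
       one_mem' := by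
        show δ V.unop 1 = 0
        simpa using hmul V.unop 1 1 } : Subring Γ(X, V.unop))
  map {V W} i := CommRingCat.ofHom (((X.presheaf.map i).hom.comp (Subring.subtype _)).codRestrict _
    (fun a => by
      refine (hres V.unop W.unop i.unop.le a.1).trans ?_
      rw [show δ V.unop a.1 = 0 from a.2, map_zero]))
  map_id V := by
    ext a
    exact ConcreteCategory.congr_hom (X.presheaf.map_id V) a.1
  map_comp i j := by
    ext a
    exact ConcreteCategory.congr_hom (X.presheaf.map_comp i j) a.1

/-- The universal property of `Ω_{X/Y}`. -/
theorem exists_hom_of_derivation (f : X ⟶ Y) (N : X.Modules)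
    (δ : ∀ V : X.Opens, Γ(X, V) →+ Γ(N, V))
    (hmul : ∀ V g h, δ V (g * h) = g • δ V h + h • δ V g)
    (hres : ∀ (V W : X.Opens) (h : W ≤ V) (g : Γ(X, V)),
      δ W (X.presheaf.map (homOfLE h).op g) = res N h (δ V g))
    (hconst : ∀ (W : Y.Opens) (c : Γ(Y, W)), δ (f ⁻¹ᵁ W) (f.app W c) = 0) :
    ∃ φ : Ω f ⟶ N, ∀ (V : X.Opens) (g : Γ(X, V)), φ.app V (d f g) = δ V g := by
  let K := kernelPresheaf N δ hmul hres
  let ι : K ⟶ X.presheaf :=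
    { app := fun V => CommRingCat.ofHom (Subring.subtype _), naturality := fun V W i => rfl }
  -- `δ` vanishes on the image of `f⁻¹O_Y`, because `f⁻¹O_Y → O_X` factors through the kernel of `δ`
  let γ : Y.presheaf ⟶ (TopCat.Presheaf.pushforward CommRingCat f.base).obj K :=
    { app := fun W => CommRingCat.ofHom ((f.app W.unop).hom.codRestrict _ (hconst W.unop))
      naturality := fun V W i => by
        ext c
        exact Subtype.ext (ConcreteCategory.congr_hom (f.c.naturality i) c) }
  let adj := TopCat.Presheaf.pullbackPushforwardAdjunction CommRingCat f.base
  let φ := (adj.homEquiv _ _).symm f.c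
  have hφ : φ = (adj.homEquiv _ _).symm γ ≫ ι := by
    have h := adj.homEquiv_naturality_right_symm γ ι
    rw [← h]
    rfl
  have hker : ∀ (V : X.Opens) s, δ V (φ.app (op V) s) = 0 := by
    intro V s
    rw [hφ]
    exact (((adj.homEquiv _ _).symm γ).app (op V) s).2
  let D : PresheafOfModules.Derivation' N.val φ :=
    { d := fun {V} => δ V.unop
      d_mul := fun {V} a b => hmul V.unop a b
      d_map := fun {V W} i g => hres V.unop W.unop i.unop.le g
      d_app := fun {V} s => hker V.unop s }
  let U := PresheafOfModules.DifferentialsConstruction.isUniversal' φ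
  refine ⟨sheafifyLift (U.desc D), fun V g => ?_⟩
  refine (sheafifyLift_toSheafify (U.desc D) V _).trans ?_
  exact PresheafOfModules.Derivation.congr_d (U.fac D) (X := op V) g

end Differentials

section Tensor

variable {X Y : Scheme.{u}} {M N : X.Modules} {V : X.Opens}

lemma add_tmul (m m' : Γ(M, V)) (n : Γ(N, V)) : tmul (m + m') n = tmul m n + tmul m' n :=
  Eq.trans (congrArg ((toSheafify (PresheafOfModules.Monoidal.tensorObj
    (R := X.presheaf) M.val N.val)).app (op V)) (TensorProduct.add_tmul _ _ _)) (map_add _ _ _)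

lemma tmul_add (m : Γ(M, V)) (n n' : Γ(N, V)) : tmul m (n + n') = tmul m n + tmul m n' :=
  Eq.trans (congrArg ((toSheafify (PresheafOfModules.Monoidal.tensorObj
    (R := X.presheaf) M.val N.val)).app (op V)) (TensorProduct.tmul_add _ _ _)) (map_add _ _ _)

lemma smul_tmul_eq (a : Γ(X, V)) (m : Γ(M, V)) (n : Γ(N, V)) : tmul (a • m) n = a • tmul m n :=
  Eq.trans (congrArg ((toSheafify (PresheafOfModules.Monoidal.tensorObj
    (R := X.presheaf) M.val N.val)).app (op V)) (TensorProduct.smul_tmul' a m n).symm)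
    (((toSheafify (PresheafOfModules.Monoidal.tensorObj
    (R := X.presheaf) M.val N.val)).app (op V)).hom.map_smul a _)

lemma tmul_smul_eq (a : Γ(X, V)) (m : Γ(M, V)) (n : Γ(N, V)) : tmul m (a • n) = a • tmul m n :=
  Eq.trans (congrArg ((toSheafify (PresheafOfModules.Monoidal.tensorObj
    (R := X.presheaf) M.val N.val)).app (op V)) 
      ((TensorProduct.mk Γ(X, V) Γ(M, V) Γ(N, V) m).map_smul a n))
    (((toSheafify (PresheafOfModules.Monoidal.tensorObj
    (R := X.presheaf) M.val N.val)).app (op V)).hom.map_smul a _)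

lemma res_tmul {W : X.Opens} (h : W ≤ V) (m : Γ(M, V)) (n : Γ(N, V)) :
    res (tensor M N) h (tmul m n) = tmul (res M h m) (res N h n) :=
  (PresheafOfModules.naturality_apply (toSheafify (PresheafOfModules.Monoidal.tensorObj
    (R := X.presheaf) M.val N.val)) (homOfLE h).op _).symm

/-- Every section of `M ⊗ N` is locally a sum of pure tensors. -/
theorem exists_mem_span_tmul (t : Γ(tensor M N, V)) : ∀ x ∈ V,
    ∃ (W : X.Opens) (hW : W ≤ V), x ∈ W ∧ res (tensor M N) hW t ∈
      AddSubgroup.closure (Set.range fun q : Γ(M, W) × Γ(N, W) => tmul q.1 q.2) := by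
  intro x hx
  obtain ⟨W, hW, hxW, n, hn⟩ := toSheafify_locally_surjective _ V t x hx
  refine ⟨W, hW, hxW, ?_⟩
  have hn' : _ = res (tensor M N) hW t := hn
  rw [← hn']
  clear hn hn'
  let ψ := (toSheafify (PresheafOfModules.Monoidal.tensorObj (R := X.presheaf)
    M.val N.val)).app (op W)
  show ψ n ∈ _
  induction n using TensorProduct.induction_on with
  | zero => exact (map_zero ψ.hom).symm ▸ zero_mem _
  | add a b ha hb => exact (map_add ψ.hom a b).symm ▸ add_mem ha hb
  | tmul m n => exact AddSubgroup.subset_closure ⟨(m, n), rfl⟩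

end Tensor

/-! ### Contraction with a vector field -/

section Contraction

variable {X Y : Scheme.{u}} {M : X.Modules} {V : X.Opens}

lemma res_onImage {M N : X.Modules} (φ : M.restrict V.ι ⟶ N.restrict V.ι)
    {W W' : (V : Scheme.{u}).Opens} (h : W' ≤ W) (m : Γ(M, V.ι ''ᵁ W)) :
    onImage φ W' (res M (V.ι.image_mono h) m) = res N (V.ι.image_mono h) (onImage φ W m) :=
  onImage_map φ (homOfLE h) m

lemma onImage_sectionOfUnit_res (D : M.restrict V.ι ⟶ (𝒪 X).restrict V.ι)
    {W W' : (V : Scheme.{u}).Opens} (h : W' ≤ W) (m : Γ(M, V.ι ''ᵁ W)) :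
    sectionOfUnit (onImage D W' (res M (V.ι.image_mono h) m)) =
      X.presheaf.map (homOfLE (V.ι.image_mono h)).op (sectionOfUnit (onImage D W m)) :=
  res_onImage D h m

/-- The contraction of `m ⊗ n` by `D` is `D(m) n`. -/
theorem onImage_contraction_tmul (D : M.restrict V.ι ⟶ (𝒪 X).restrict V.ι) (N : X.Modules)
    (W : (V : Scheme.{u}).Opens) (m : Γ(M, V.ι ''ᵁ W)) (n : Γ(N, V.ι ''ᵁ W)) :
    onImage (contraction D N) W (tmul m n) = sectionOfUnit (onImage D W m) • n := by
  have h1 : ∀ (W : X.Opens) (t : Γ(tensor M N, W)),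
      onImage (contraction D N) (V.ι ⁻¹ᵁ W) (res (tensor M N) (V.ι.image_preimage_le W) t) =
        (sheafifyLift (contractionPresheaf D N)).app W t := by
    intro W t
    have h := ((Scheme.Modules.restrictAdjunction V.ι).homEquiv _ _).apply_symm_apply
      (sheafifyLift (contractionPresheaf D N))
    rw [Adjunction.homEquiv_unit] at h
    exact ConcreteCategory.congr_hom (congrArg (fun ψ => Scheme.Modules.Hom.app ψ W) h) t
  have h2 := h1 (V.ι ''ᵁ W) (tmul m n)
  have h3 : (sheafifyLift (contractionPresheaf D N)).app (V.ι ''ᵁ W) (tmul m n) =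
      pairing D N (V.ι ''ᵁ W) m n :=
    sheafifyLift_toSheafify (contractionPresheaf D N) (V.ι ''ᵁ W) _
  rw [h3] at h2
  have h4 : V.ι ⁻¹ᵁ V.ι ''ᵁ W = W := V.ι.preimage_image_eq W
  have h5 : W ≤ V.ι ⁻¹ᵁ V.ι ''ᵁ W := h4.ge
  have h6 := congrArg (res N (V.ι.image_mono h5)) h2
  rw [← res_onImage _ h5, res_res, res_self, pairing, res_smul, res_res, res_self] at h6
  rw [h6]
  congr 1
  refine (onImage_sectionOfUnit_res D h5 _).symm.trans ?_
  rw [res_res, res_self]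

end Contraction

/-! ### The Frobenius twist -/

section EtaleBaseChange

lemma isPushout_mvPolynomial {A A' : CommRingCat.{u}} (φ : A ⟶ A') (σ : Type) :
    IsPushout (CommRingCat.ofHom (MvPolynomial.C : A →+* MvPolynomial σ A)) φ
      (CommRingCat.ofHom (MvPolynomial.map φ.hom))
      (CommRingCat.ofHom (MvPolynomial.C : A' →+* MvPolynomial σ A')) := by
  refine ⟨⟨?_⟩, ⟨PushoutCocone.IsColimit.mk _
    (fun s => CommRingCat.ofHom (MvPolynomial.eval₂Hom s.inr.hom fun n => s.inl (MvPolynomial.X n)))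
    (fun s => ?_) (fun s => ?_) (fun s m h₁ h₂ => ?_)⟩⟩
  · ext1
    exact RingHom.ext fun a => MvPolynomial.map_C φ.hom a
  · ext : 1
    refine MvPolynomial.ringHom_ext (fun a => ?_) (fun n => ?_)
    · have := ConcreteCategory.congr_hom s.condition a
      simpa using this.symm
    · simp
  · ext a
    simp
  · ext : 1
    refine MvPolynomial.ringHom_ext (fun a => ?_) (fun n => ?_)
    · have := ConcreteCategory.congr_hom h₂ a
      simpa using this
    · have := ConcreteCategory.congr_hom h₁ (MvPolynomial.X n)
      simpa using this

/-- Étale coordinates are stable under base change. -/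
lemma etale_of_isPushout {A A' B B' : CommRingCat.{u}} {i : A ⟶ B} {φ : A ⟶ A'} {w : B ⟶ B'}
    {j : A' ⟶ B'} (H : IsPushout i φ w j) {σ : Type} (g : MvPolynomial σ A →+* B) (hg : g.Etale)
    (hgi : g.comp MvPolynomial.C = i.hom) :
    (MvPolynomial.eval₂Hom j.hom (fun n => w (g (MvPolynomial.X n)))).Etale := by
  have h1 := isPushout_mvPolynomial φ σ
  have h2 : IsPushout (CommRingCat.ofHom MvPolynomial.C ≫ CommRingCat.ofHom g) φ w
      (CommRingCat.ofHom MvPolynomial.C ≫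
        CommRingCat.ofHom (MvPolynomial.eval₂Hom j.hom (fun n => w (g (MvPolynomial.X n))))) := by
    convert! H
    · ext a
      exact RingHom.congr_fun hgi a
    · ext a
      simp
  have h3 : CommRingCat.ofHom g ≫ w = CommRingCat.ofHom (MvPolynomial.map φ.hom) ≫
      CommRingCat.ofHom (MvPolynomial.eval₂Hom j.hom (fun n => w (g (MvPolynomial.X n)))) := by
    ext : 1
    refine MvPolynomial.ringHom_ext (fun a => ?_) (fun n => ?_)
    · have := ConcreteCategory.congr_hom H.w a
      have h4 := RingHom.congr_fun hgi a
      simp only [RingHom.comp_apply] at h4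
      simpa [h4] using this
    · simp
  have h5 := h2.of_left h3 h1
  have : (RingHom.toMorphismProperty RingHom.Etale).IsStableUnderCobaseChange :=
    RingHom.isStableUnderCobaseChange_toMorphismProperty_iff.mpr
      RingHom.Etale.isStableUnderBaseChange
  exact MorphismProperty.of_isPushout (P := RingHom.toMorphismProperty RingHom.Etale) h5.flip hg

end EtaleBaseChange

section Twist

variable {X Y : Scheme.{u}} (p : ℕ) [hp : Fact p.Prime] (f : X ⟶ Y) [hY : IsOfChar Y p]

instance : IsOfChar (twist p f) p := IsOfChar.of_hom (twistHom p f) p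

lemma twist_isPullback :
    IsPullback (twistFst p f) (twistHom p f) f (absoluteFrobenius p Y) :=
  IsPullback.of_hasPullback f (absoluteFrobenius p Y)

lemma twistFst_comp_relativeFrobenius :
    twistFst p f ≫ relativeFrobenius p f = absoluteFrobenius p (twist p f) := by
  have := IsOfChar.of_hom f p
  apply (twist_isPullback p f).hom_ext
  · rw [Category.assoc, relativeFrobenius_fst, absoluteFrobenius_comp]
  · rw [Category.assoc, relativeFrobenius_snd, absoluteFrobenius_comp]
    exact (twist_isPullback p f).w

/-- The relative Frobenius is a homeomorphism, with inverse the projection `X^(1) → X`. -/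
lemma preimage_twistFst (V : X.Opens) : relativeFrobenius p f ⁻¹ᵁ twistFst p f ⁻¹ᵁ V = V := by
  have := IsOfChar.of_hom f p
  rw [← Scheme.Hom.comp_preimage, relativeFrobenius_fst]
  rfl

lemma twistFst_preimage (W : (twist p f).Opens) :
    twistFst p f ⁻¹ᵁ relativeFrobenius p f ⁻¹ᵁ W = W := by
  rw [← Scheme.Hom.comp_preimage, twistFst_comp_relativeFrobenius]
  rfl

lemma exists_eq_preimage (V : X.Opens) :
    ∃ W : (twist p f).Opens, V = relativeFrobenius p f ⁻¹ᵁ W :=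
  ⟨_, (preimage_twistFst p f V).symm⟩

lemma preimage_le_preimage_iff {W W' : (twist p f).Opens} :
    relativeFrobenius p f ⁻¹ᵁ W ≤ relativeFrobenius p f ⁻¹ᵁ W' ↔ W ≤ W' := by
  refine ⟨fun h => ?_, fun h => (relativeFrobenius p f).preimage_mono h⟩
  have := (twistFst p f).preimage_mono h
  rwa [twistFst_preimage, twistFst_preimage] at this

lemma relativeFrobenius_surjective (y : twist p f) : ∃ x : X, relativeFrobenius p f x = y := by
  refine ⟨twistFst p f y, ?_⟩
  rw [← Scheme.Hom.comp_apply, twistFst_comp_relativeFrobenius]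
  rfl

/-- Restriction of functions. -/
noncomputable def rs {Z : Scheme.{u}} {V W : Z.Opens} (h : W ≤ V) : Γ(Z, V) →+* Γ(Z, W) :=
  (Z.presheaf.map (homOfLE h).op).hom

lemma rs_rs {Z : Scheme.{u}} {V W W' : Z.Opens} (h : W ≤ V) (h' : W' ≤ W) (g : Γ(Z, V)) :
    rs h' (rs h g) = rs (h'.trans h) g :=
  res_res (𝒪 Z) h h' g

lemma rs_self {Z : Scheme.{u}} {V : Z.Opens} (g : Γ(Z, V)) : rs le_rfl g = g :=
  res_self (𝒪 Z) g

lemma d_rs {V W : X.Opens} (h : W ≤ V) (g : Γ(X, V)) : d f (rs h g) = res (Ω f) h (d f g) :=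
  (d_res f h g).symm

lemma res_smul_rs (M : X.Modules) {W W' : X.Opens} (h : W' ≤ W) (r : Γ(X, W)) (m : Γ(M, W)) :
    res M h (r • m) = rs h r • res M h m := res_smul M h r m

/-- The relative Frobenius on functions. -/
noncomputable def fr (W : (twist p f).Opens) :
    Γ(twist p f, W) →+* Γ(X, relativeFrobenius p f ⁻¹ᵁ W) :=
  ((relativeFrobenius p f).app W).hom

lemma fr_rs {W W' : (twist p f).Opens} (h : W' ≤ W) (a : Γ(twist p f, W)) :
    fr p f W' (rs h a) = rs ((relativeFrobenius p f).preimage_mono h) (fr p f W a) :=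
  ConcreteCategory.congr_hom ((relativeFrobenius p f).naturality (homOfLE h).op) a

lemma d_fr (W : (twist p f).Opens) (a : Γ(twist p f, W)) : d f (fr p f W a) = 0 :=
  relativeFrobenius_const p f W a

/-- The pull-back `g ↦ g ⊗ 1` of functions to the Frobenius twist. -/
noncomputable def tw (W : (twist p f).Opens) :
    Γ(X, relativeFrobenius p f ⁻¹ᵁ W) →+* Γ(twist p f, W) :=
  ((twistFst p f).appLE (relativeFrobenius p f ⁻¹ᵁ W) W (twistFst_preimage p f W).ge).hom

lemma tw_rs {W W' : (twist p f).Opens} (h : W' ≤ W) (g : Γ(X, relativeFrobenius p f ⁻¹ᵁ W)) :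
    tw p f W' (rs ((relativeFrobenius p f).preimage_mono h) g) = rs h (tw p f W g) := by
  refine (ConcreteCategory.congr_hom (Scheme.Hom.map_appLE (twistFst p f) _ _) g).trans ?_
  exact (ConcreteCategory.congr_hom (Scheme.Hom.appLE_map (twistFst p f) _ _) g).symm

lemma appLE_eq_of_eq {Z Z' : Scheme.{u}} {g g' : Z ⟶ Z'} (h : g = g') (V : Z'.Opens) (W : Z.Opens)
    (e : W ≤ g ⁻¹ᵁ V) (a : Γ(Z', V)) : g.appLE V W e a = g'.appLE V W (h ▸ e) a := by
  subst h; rfl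

lemma fr_eq_appLE (W : (twist p f).Opens) (a : Γ(twist p f, W)) :
    fr p f W a = (relativeFrobenius p f).appLE W (relativeFrobenius p f ⁻¹ᵁ W) le_rfl a := by
  rw [Scheme.Hom.appLE_eq_app]
  rfl

lemma fr_tw (W : (twist p f).Opens) (g : Γ(X, relativeFrobenius p f ⁻¹ᵁ W)) :
    fr p f W (tw p f W g) = g ^ p := by
  have := IsOfChar.of_hom f p
  have h := ConcreteCategory.congr_hom (Scheme.Hom.appLE_comp_appLE (relativeFrobenius p f)
    (twistFst p f) (relativeFrobenius p f ⁻¹ᵁ W) W (relativeFrobenius p f ⁻¹ᵁ W)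
    (twistFst_preimage p f W).ge le_rfl) g
  rw [appLE_eq_of_eq (relativeFrobenius_fst p f), absoluteFrobenius_appLE] at h
  have h2 : (rs le_rfl g) ^ p = g ^ p := by rw [rs_self]
  exact (fr_eq_appLE p f W _).trans (h.trans h2)

lemma tw_fr (W : (twist p f).Opens) (a : Γ(twist p f, W)) : tw p f W (fr p f W a) = a ^ p := by
  have h := ConcreteCategory.congr_hom (Scheme.Hom.appLE_comp_appLE (twistFst p f)
    (relativeFrobenius p f) W (relativeFrobenius p f ⁻¹ᵁ W) W le_rfl
    (twistFst_preimage p f W).ge) a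
  rw [appLE_eq_of_eq (twistFst_comp_relativeFrobenius p f), absoluteFrobenius_appLE] at h
  have h2 : (rs le_rfl a) ^ p = a ^ p := by rw [rs_self]
  exact (congrArg (tw p f W) (fr_eq_appLE p f W a)).trans (h.trans h2)

/-- On affine open sets `B = Γ(V)` over `A = Γ(S)`, the twist is `B ⊗_{A, F} A`. -/
lemma isPushout_twist {S : Y.Opens} (hS : IsAffineOpen S) {W : (twist p f).Opens}
    (hW : IsAffineOpen (relativeFrobenius p f ⁻¹ᵁ W))
    (h : relativeFrobenius p f ⁻¹ᵁ W ≤ f ⁻¹ᵁ S) (h' : W ≤ twistHom p f ⁻¹ᵁ S) :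
    IsPushout (f.appLE S _ h) ((absoluteFrobenius p Y).appLE S S le_rfl)
      (CommRingCat.ofHom (tw p f W)) ((twistHom p f).appLE S W h') := by
  have e : W = twistFst p f ⁻¹ᵁ (relativeFrobenius p f ⁻¹ᵁ W) ⊓ twistHom p f ⁻¹ᵁ S := by
    rw [twistFst_preimage, inf_eq_left.mpr h']
  have := isIso_pushoutSection_of_isAffineOpen (twist_isPullback p f) (US := S) (UT := S) le_rfl h e
    hS hS hW
  exact (isIso_pushoutSection_iff (twist_isPullback p f) (US := S) (UT := S) le_rfl h e).mp this

lemma le_twistHom_preimage {S : Y.Opens} {W : (twist p f).Opens}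
    (h : relativeFrobenius p f ⁻¹ᵁ W ≤ f ⁻¹ᵁ S) : W ≤ twistHom p f ⁻¹ᵁ S := by
  rw [← preimage_le_preimage_iff p f, ← Scheme.Hom.comp_preimage, relativeFrobenius_snd]
  exact h

lemma isAffineOpen_of_preimage {S : Y.Opens} (hS : IsAffineOpen S) {W : (twist p f).Opens}
    (hW : IsAffineOpen (relativeFrobenius p f ⁻¹ᵁ W))
    (h : relativeFrobenius p f ⁻¹ᵁ W ≤ f ⁻¹ᵁ S) : IsAffineOpen W := by
  have e : W = twistFst p f ⁻¹ᵁ (relativeFrobenius p f ⁻¹ᵁ W) ⊓ twistHom p f ⁻¹ᵁ S := by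
    rw [twistFst_preimage, inf_eq_left.mpr (le_twistHom_preimage p f h)]
  rw [e]
  have : IsAffine _ := hS
  have : IsAffine _ := hW
  exact .of_isIso (Scheme.Hom.isPullback_resLE (twist_isPullback p f) (US := S) (UT := S)
    le_rfl h rfl).isoPullback.hom

/-- On affine open sets, the relative Frobenius is that of the algebra `Γ(V)` over `Γ(S)`. -/
lemma isRelativeFrobenius {S : Y.Opens} (hS : IsAffineOpen S) {W : (twist p f).Opens}
    (hW : IsAffineOpen (relativeFrobenius p f ⁻¹ᵁ W))
    (h : relativeFrobenius p f ⁻¹ᵁ W ≤ f ⁻¹ᵁ S) (h' : W ≤ twistHom p f ⁻¹ᵁ S) :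
    IsRelativeFrobenius p (f.appLE S _ h).hom ((twistHom p f).appLE S W h').hom (tw p f W)
      (fr p f W) where
  w_i a := by
    have := ConcreteCategory.congr_hom (isPushout_twist p f hS hW h h').w a
    refine this.trans ?_
    show ((twistHom p f).appLE S W h').hom (((absoluteFrobenius p Y).appLE S S le_rfl).hom a) = _
    rw [← map_pow]
    congr 1
    refine (absoluteFrobenius_appLE p Y S S le_rfl a).trans ?_
    exact congrArg (· ^ p) (rs_self a)
  F_w b := fr_tw p f W b
  F_j a := by
    have h := ConcreteCategory.congr_hom (Scheme.Hom.appLE_comp_appLE (relativeFrobenius p f)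
      (twistHom p f) S W (relativeFrobenius p f ⁻¹ᵁ W) h' le_rfl) a
    rw [appLE_eq_of_eq (relativeFrobenius_snd p f)] at h
    exact (fr_eq_appLE p f W _).trans h
  generated R hj hw := by
    have hpo := isPushout_twist p f hS hW h h'
    let i : CommRingCat.of R ⟶ Γ(twist p f, W) := CommRingCat.ofHom R.subtype
    let l : Γ(X, relativeFrobenius p f ⁻¹ᵁ W) ⟶ CommRingCat.of R :=
      CommRingCat.ofHom ((tw p f W).codRestrict R hw)
    let r : Γ(Y, S) ⟶ CommRingCat.of R :=
      CommRingCat.ofHom (((twistHom p f).appLE S W h').hom.codRestrict R hj)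
    have hlr : f.appLE S _ h ≫ l = (absoluteFrobenius p Y).appLE S S le_rfl ≫ r := by
      ext c
      exact ConcreteCategory.congr_hom hpo.w c
    have hid : hpo.desc l r hlr ≫ i = 𝟙 _ := by
      apply hpo.hom_ext
      · rw [← Category.assoc, hpo.inl_desc]; rfl
      · rw [← Category.assoc, hpo.inr_desc]; rfl
    rw [eq_top_iff]
    rintro a -
    have := ConcreteCategory.congr_hom hid a
    rw [← show i (hpo.desc l r hlr a) = a from this]
    exact (hpo.desc l r hlr a).2

end Twist

/-! ### Coordinates -/

section Coordinates

variable {X Y : Scheme.{u}} (p : ℕ) [hp : Fact p.Prime] (f : X ⟶ Y)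

/-- The function `x` on the affine open set `V` is an étale coordinate: it defines an étale morphism
from `V` to the affine line over an affine open subset of `Y`. -/
def IsEtaleCoordinate (V : X.Opens) (x : Γ(X, V)) : Prop :=
  IsAffineOpen V ∧ ∃ (S : Y.Opens) (_ : IsAffineOpen S) (h : V ≤ f ⁻¹ᵁ S)
    (g : MvPolynomial (Fin 1) Γ(Y, S) →+* Γ(X, V)),
    g.comp MvPolynomial.C = (f.appLE S V h).hom ∧ g.Etale ∧ g (MvPolynomial.X 0) = x

/-- A smooth curve is locally étale over an affine line. -/
theorem exists_isEtaleCoordinate [SmoothOfRelativeDimension 1 f] (u : X) :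
    ∃ (V : X.Opens) (_ : u ∈ V) (x : Γ(X, V)), IsEtaleCoordinate f V x := by
  obtain ⟨S, hS, V, hV, hu, h, hf⟩ :=
    SmoothOfRelativeDimension.exists_isStandardSmoothOfRelativeDimension (n := 1) (f := f) u
  obtain ⟨g, hg, hg'⟩ := hf.exists_etale_mvPolynomial
  exact ⟨V, hu, g (MvPolynomial.X 0), hV, S, hS, h, g, hg, hg', rfl⟩

variable {f}

lemma IsEtaleCoordinate.basicOpen {V : X.Opens} {x : Γ(X, V)} (hx : IsEtaleCoordinate f V x)
    (r : Γ(X, V)) : IsEtaleCoordinate f (X.basicOpen r) (rs (X.basicOpen_le r) x) := by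
  obtain ⟨hV, S, hS, h, g, hgi, hg, rfl⟩ := hx
  refine ⟨hV.basicOpen r, S, hS, (X.basicOpen_le r).trans h, (rs (X.basicOpen_le r)).comp g, ?_, ?_,
    rfl⟩
  · rw [RingHom.comp_assoc, hgi]
    have := Scheme.Hom.appLE_map f (U := S) (V := V) (V' := X.basicOpen r) h
      (homOfLE (X.basicOpen_le r)).op
    exact congrArg CommRingCat.Hom.hom this
  · refine RingHom.Etale.stableUnderComposition _ _ hg ?_
    have := hV.isLocalization_basicOpen r
    exact RingHom.etale_algebraMap.mpr (Algebra.Etale.of_isLocalizationAway r)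

lemma IsEtaleCoordinate.of_eq_basicOpen {V V' : X.Opens} {x : Γ(X, V)}
    (hx : IsEtaleCoordinate f V x) {r : Γ(X, V)} (h : V' = X.basicOpen r) (h' : V' ≤ V) :
    IsEtaleCoordinate f V' (rs h' x) := by
  subst h
  exact hx.basicOpen r

variable [hY : IsOfChar Y p]

lemma IsEtaleCoordinate.twist {W : (twist p f).Opens} {x : Γ(X, relativeFrobenius p f ⁻¹ᵁ W)}
    (hx : IsEtaleCoordinate f _ x) : IsEtaleCoordinate (twistHom p f) W (tw p f W x) := by
  obtain ⟨hV, S, hS, h, g, hgi, hg, rfl⟩ := hx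
  have h' := le_twistHom_preimage p f h
  refine ⟨isAffineOpen_of_preimage p f hS hV h, S, hS, h', _, ?_,
    etale_of_isPushout (isPushout_twist p f hS hV h h') g hg hgi, ?_⟩
  · ext a
    simp
  · simp

lemma IsEtaleCoordinate.isPBasis {W : (TangoCurve.twist p f).Opens}
    {x : Γ(X, relativeFrobenius p f ⁻¹ᵁ W)} (hx : IsEtaleCoordinate f _ x) :
    IsPBasis p (fr p f W) x := by
  obtain ⟨hV, S, hS, h, g, hgi, hg, rfl⟩ := hx
  exact fun b => (isRelativeFrobenius p f hS hV h
    (le_twistHom_preimage p f h)).existsUnique_sum (IsOfChar.section_eq_zero _ p W) g hg hgi b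

variable (f) in
/-- The function `x` on (the homeomorphic image of) `W₀` is a coordinate: over every open subset,
`O_X` is free over `O_{X^(1)}` with basis `1, x, …, x ^ (p - 1)`. -/
def IsCoordinate (W₀ : (TangoCurve.twist p f).Opens) (x : Γ(X, relativeFrobenius p f ⁻¹ᵁ W₀)) :
    Prop :=
  ∀ (W : (TangoCurve.twist p f).Opens) (h : W ≤ W₀),
    IsPBasis p (fr p f W) (rs ((relativeFrobenius p f).preimage_mono h) x)

lemma IsCoordinate.mono {W₀ W₁ : (TangoCurve.twist p f).Opens}
    {x : Γ(X, relativeFrobenius p f ⁻¹ᵁ W₀)} (hx : IsCoordinate p f W₀ x) (h : W₁ ≤ W₀) :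
    IsCoordinate p f W₁ (rs ((relativeFrobenius p f).preimage_mono h) x) := by
  intro W hW
  rw [rs_rs]
  exact hx W (hW.trans h)

lemma rs_sum_fr {W W' : (TangoCurve.twist p f).Opens} (h : W' ≤ W)
    (x : Γ(X, relativeFrobenius p f ⁻¹ᵁ W)) (c : Fin p → Γ(TangoCurve.twist p f, W)) :
    rs ((relativeFrobenius p f).preimage_mono h) (∑ n, fr p f W (c n) * x ^ (n : ℕ)) =
      ∑ n, fr p f W' (rs h (c n)) * (rs ((relativeFrobenius p f).preimage_mono h) x) ^ (n : ℕ) := by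
  rw [map_sum]
  exact Finset.sum_congr rfl fun n _ => by rw [map_mul, map_pow, fr_rs]

/-- An étale coordinate is a coordinate: the coefficients exist and are unique over the affine basic
open subsets, hence they glue over any open subset. -/
theorem IsEtaleCoordinate.isCoordinate {W₀ : (TangoCurve.twist p f).Opens}
    {x : Γ(X, relativeFrobenius p f ⁻¹ᵁ W₀)} (hx : IsEtaleCoordinate f _ x) :
    IsCoordinate p f W₀ x := by
  have hloc : ∀ W ≤ W₀, ∀ y ∈ W, ∃ (W' : (TangoCurve.twist p f).Opens) (hW' : W' ≤ W)
      (h : W' ≤ W₀), y ∈ W' ∧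
        IsPBasis p (fr p f W') (rs ((relativeFrobenius p f).preimage_mono h) x) := by
    intro W hW y hy
    obtain ⟨u, rfl⟩ := relativeFrobenius_surjective p f y
    have hV := hx.1
    obtain ⟨r, hr, hur⟩ := hV.exists_basicOpen_le
      (V := relativeFrobenius p f ⁻¹ᵁ W) ⟨u, hy⟩ (hW hy)
    obtain ⟨W', hW'⟩ := exists_eq_preimage p f (X.basicOpen r)
    have h1 : W' ≤ W := by
      rw [← preimage_le_preimage_iff p f, ← hW']
      exact hr
    refine ⟨W', h1, h1.trans hW, ?_, (hx.of_eq_basicOpen hW'.symm _).isPBasis p⟩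
    have : u ∈ relativeFrobenius p f ⁻¹ᵁ W' := hW' ▸ hur
    exact this
  have huniq : ∀ (W : (TangoCurve.twist p f).Opens) (h : W ≤ W₀)
      (c c' : Fin p → Γ(TangoCurve.twist p f, W)),
      ∑ n, fr p f W (c n) * (rs ((relativeFrobenius p f).preimage_mono h) x) ^ (n : ℕ) =
        ∑ n, fr p f W (c' n) * (rs ((relativeFrobenius p f).preimage_mono h) x) ^ (n : ℕ) →
      c = c' := by
    intro W h c c' hcc'
    ext n
    refine eq_of_local (𝒪 (TangoCurve.twist p f)) fun y hy => ?_
    obtain ⟨W', hW', h', hyW', hb⟩ := hloc W h y hy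
    refine ⟨W', hW', hyW', ?_⟩
    have h1 := congrArg (rs ((relativeFrobenius p f).preimage_mono hW')) hcc'
    rw [rs_sum_fr, rs_sum_fr, rs_rs] at h1
    have h2 := (hb.coeff_eq rfl).symm.trans ((congrArg hb.coeff h1).trans (hb.coeff_eq rfl))
    exact congrFun h2 n
  intro W h b
  have hex : ∀ n : Fin p, ∃ s : Γ(TangoCurve.twist p f, W),
      ∀ (W' : (TangoCurve.twist p f).Opens) (hW' : W' ≤ W)
        (c : Fin p → Γ(TangoCurve.twist p f, W')),
        rs ((relativeFrobenius p f).preimage_mono hW') b = ∑ n, fr p f W' (c n) *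
          (rs ((relativeFrobenius p f).preimage_mono (hW'.trans h)) x) ^ (n : ℕ) →
        rs hW' s = c n := by
    intro n
    obtain ⟨s, hs⟩ := exists_section_of_local (𝒪 (TangoCurve.twist p f)) (V := W)
      (fun W' hW' s => ∃ c : Fin p → Γ(TangoCurve.twist p f, W'),
        rs ((relativeFrobenius p f).preimage_mono hW') b = ∑ n, fr p f W' (c n) *
          (rs ((relativeFrobenius p f).preimage_mono (hW'.trans h)) x) ^ (n : ℕ) ∧ c n = s)
      (by
        rintro W₁ W₂ h₁ h₂ s ⟨c, hc, rfl⟩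
        refine ⟨fun m => rs h₂ (c m), ?_, rfl⟩
        have h3 := congrArg (rs ((relativeFrobenius p f).preimage_mono h₂)) hc
        rwa [rs_sum_fr, rs_rs, rs_rs] at h3)
      (by
        rintro W₁ h₁ s s' ⟨c, hc, rfl⟩ ⟨c', hc', rfl⟩
        rw [huniq W₁ (h₁.trans h) c c' (hc.symm.trans hc')])
      (by
        intro y hy
        obtain ⟨W', hW', h', hyW', hb⟩ := hloc W h y hy
        exact ⟨W', hW', hyW', _, hb.coeff (rs ((relativeFrobenius p f).preimage_mono hW') b),
          (hb.sum_coeff _).symm, rfl⟩)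
    exact ⟨s, fun W' hW' c hc => hs W' hW' (c n) ⟨c, hc, rfl⟩⟩
  choose s hs using hex
  refine ⟨s, ?_, fun c hc => huniq W h _ _ (hc.symm.trans ?_)⟩
  all_goals
    refine eq_of_local (𝒪 X) fun u hu => ?_
    obtain ⟨W', hW', h', hyW', hb⟩ := hloc W h (relativeFrobenius p f u) hu
    refine ⟨_, (relativeFrobenius p f).preimage_mono hW', hyW', ?_⟩
    have h1 := fun n => hs n W' hW' _ (hb.sum_coeff _).symm
    refine Eq.trans (hb.sum_coeff _).symm ?_
    refine Eq.trans ?_ (rs_sum_fr p hW' _ s).symm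
    rw [rs_rs]
    exact Finset.sum_congr rfl fun n _ => by rw [h1]; rfl

end Coordinates

/-! ### Morphisms over an open subset, and frames -/

section RestrictHom

variable {X Y : Scheme.{u}} {M N : X.Modules} {V : X.Opens}

lemma le_image_preimage {W : X.Opens} (h : W ≤ V) : W ≤ V.ι ''ᵁ V.ι ⁻¹ᵁ W := by
  rw [Scheme.Hom.image_preimage_eq_opensRange_inf, Scheme.Opens.opensRange_ι]
  exact le_inf h le_rfl

lemma image_ι_le (W : (V : Scheme.{u}).Opens) : V.ι ''ᵁ W ≤ V := by
  have := V.ι.image_le_opensRange W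
  rwa [Scheme.Opens.opensRange_ι] at this

/-- A morphism `M|_V → N|_V` on the sections over an open set `W ⊆ V`. -/
noncomputable def restrictApp (φ : M.restrict V.ι ⟶ N.restrict V.ι) {W : X.Opens} (h : W ≤ V) :
    Γ(M, W) →ₗ[Γ(X, W)] Γ(N, W) where
  toFun m := res N (le_image_preimage h) (onImage φ (V.ι ⁻¹ᵁ W) (res M (V.ι.image_preimage_le W) m))
  map_add' m m' := by rw [map_add, map_add, map_add]
  map_smul' r m := by
    rw [res_smul_rs, map_smul, res_smul_rs, rs_rs, rs_self]
    rfl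

lemma restrictApp_image (φ : M.restrict V.ι ⟶ N.restrict V.ι) (W : (V : Scheme.{u}).Opens)
    (m : Γ(M, V.ι ''ᵁ W)) : restrictApp φ (image_ι_le W) m = onImage φ W m := by
  have h4 : V.ι ⁻¹ᵁ V.ι ''ᵁ W = W := V.ι.preimage_image_eq W
  have h5 : V.ι ⁻¹ᵁ V.ι ''ᵁ W ≤ W := h4.le
  show res N _ (onImage φ _ (res M (V.ι.image_mono h5) m)) = _
  rw [res_onImage φ h5, res_res, res_self]

lemma restrictApp_res (φ : M.restrict V.ι ⟶ N.restrict V.ι) {W W' : X.Opens} (h : W ≤ V)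
    (h' : W' ≤ W) (m : Γ(M, W)) :
    restrictApp φ (h'.trans h) (res M h' m) = res N h' (restrictApp φ h m) := by
  show res N _ (onImage φ _ (res M _ (res M _ m))) = res N _ (res N _ (onImage φ _ (res M _ m)))
  have e : V.ι ⁻¹ᵁ W' ≤ V.ι ⁻¹ᵁ W := V.ι.preimage_mono h'
  have := res_onImage φ e (res M (V.ι.image_preimage_le W) m)
  rw [res_res] at this ⊢
  rw [this, res_res, res_res]

/-- The functions on `W ⊆ V` obtained from a linear form on `M|_V`. -/
noncomputable def formApp (D : M.restrict V.ι ⟶ (𝒪 X).restrict V.ι) {W : X.Opens} (h : W ≤ V) :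
    Γ(M, W) →ₗ[Γ(X, W)] Γ(X, W) :=
  sectionOfUnit.comp (restrictApp D h)

lemma formApp_res (D : M.restrict V.ι ⟶ (𝒪 X).restrict V.ι) {W W' : X.Opens} (h : W ≤ V)
    (h' : W' ≤ W) (m : Γ(M, W)) :
    formApp D (h'.trans h) (res M h' m) = rs h' (formApp D h m) :=
  restrictApp_res D h h' m

lemma restrictApp_contraction_tmul (D : M.restrict V.ι ⟶ (𝒪 X).restrict V.ι) (N : X.Modules)
    {W : X.Opens} (h : W ≤ V) (m : Γ(M, W)) (n : Γ(N, W)) :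
    restrictApp (contraction D N) h (tmul m n) = formApp D h m • n := by
  show res N _ (onImage _ _ (res (tensor M N) _ (tmul m n))) = _
  rw [res_tmul, onImage_contraction_tmul, res_smul_rs, res_res, res_self]
  rfl

/-- A family of linear maps on the sections over the open subsets of `V`, as a morphism
`M|_V → N|_V`. -/
noncomputable def restrictHomOfSections (φ : ∀ W : X.Opens, W ≤ V → Γ(M, W) →ₗ[Γ(X, W)] Γ(N, W))
    (hφ : ∀ (W W' : X.Opens) (h : W ≤ V) (h' : W' ≤ W) (m : Γ(M, W)),
      φ W' (h'.trans h) (res M h' m) = res N h' (φ W h m)) :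
    M.restrict V.ι ⟶ N.restrict V.ι :=
  homOfSections (fun W => φ (V.ι ''ᵁ W) (image_ι_le W))
    (fun W m m' => map_add (φ (V.ι ''ᵁ W) (image_ι_le W)) m m')
    (fun W a m => by
      obtain ⟨r, rfl⟩ : ∃ r, (V.ι.appIso W).hom r = a :=
        ⟨(V.ι.appIso W).inv a, ConcreteCategory.congr_hom (V.ι.appIso W).inv_hom_id a⟩
      have h1 : ∀ (P : X.Modules) (n : Γ(P, V.ι ''ᵁ W)),
          (V.ι.appIso W).hom r • (show Γ(P.restrict V.ι, W) from n) =
            (show Γ(P.restrict V.ι, W) from (r • n : Γ(P, V.ι ''ᵁ W))) :=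
        fun P n => (P.smul_restrictAppIso_inv_apply V.ι W r n).symm
      refine Eq.trans (congrArg (φ (V.ι ''ᵁ W) (image_ι_le W)) (h1 M m)) ?_
      exact (map_smul (φ (V.ι ''ᵁ W) (image_ι_le W)) r
        (show Γ(M, V.ι ''ᵁ W) from m)).trans (h1 N _).symm)
    (fun W W' h m => hφ (V.ι ''ᵁ W) (V.ι ''ᵁ W') (image_ι_le W) (V.ι.image_mono h) m)

lemma restrictApp_restrictHomOfSections
    (φ : ∀ W : X.Opens, W ≤ V → Γ(M, W) →ₗ[Γ(X, W)] Γ(N, W))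
    (hφ : ∀ (W W' : X.Opens) (h : W ≤ V) (h' : W' ≤ W) (m : Γ(M, W)),
      φ W' (h'.trans h) (res M h' m) = res N h' (φ W h m)) {W : X.Opens} (h : W ≤ V)
    (m : Γ(M, W)) : restrictApp (restrictHomOfSections φ hφ) h m = φ W h m := by
  show res N _ (φ _ _ (res M _ m)) = _
  rw [← hφ, res_res, res_self]

end RestrictHom

section Frame

variable {X : Scheme.{u}} {M : X.Modules} {V : X.Opens}

/-- The section `e` of `M` over `V` is a frame: `M|_V` is free on `e`. -/
def IsFrame (M : X.Modules) {V : X.Opens} (e : Γ(M, V)) : Prop :=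
  ∀ (W : X.Opens) (h : W ≤ V) (m : Γ(M, W)), ∃! b : Γ(X, W), m = b • res M h e

lemma IsFrame.mono {e : Γ(M, V)} (he : IsFrame M e) {V' : X.Opens} (h : V' ≤ V) :
    IsFrame M (res M h e) := by
  intro W h' m
  rw [res_res]
  exact he W (h'.trans h) m

lemma IsFrame.eq_of_smul_eq {e : Γ(M, V)} (he : IsFrame M e) {a b : Γ(X, V)} (h : a • e = b • e) :
    a = b := by
  have h1 := he V le_rfl (a • e)
  rw [res_self] at h1
  exact h1.unique rfl h

lemma IsFrame.exists_eq_smul {e : Γ(M, V)} (he : IsFrame M e) (m : Γ(M, V)) :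
    ∃ b : Γ(X, V), m = b • e := by
  have h1 := (he V le_rfl m).exists
  rwa [res_self] at h1

/-- Functions that are given locally, and determined there by a property `P`, glue. -/
theorem exists_function_of_local (P : ∀ W : X.Opens, W ≤ V → Γ(X, W) → Prop)
    (hres : ∀ (W W' : X.Opens) (hW : W ≤ V) (h : W' ≤ W) (s : Γ(X, W)), P W hW s →
      P W' (h.trans hW) (rs h s))
    (huniq : ∀ (W : X.Opens) (hW : W ≤ V) (s s' : Γ(X, W)), P W hW s → P W hW s' → s = s')
    (hloc : ∀ x ∈ V, ∃ (W : X.Opens) (hW : W ≤ V), x ∈ W ∧ ∃ s, P W hW s) :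
    ∃ s : Γ(X, V), ∀ (W : X.Opens) (hW : W ≤ V) (t : Γ(X, W)), P W hW t → rs hW s = t :=
  exists_section_of_local (𝒪 X) P hres huniq hloc

/-- Existence of coefficients is local, given their uniqueness. -/
lemma isFrame_of_local {e : Γ(M, V)}
    (huniq : ∀ (W : X.Opens) (h : W ≤ V) (b b' : Γ(X, W)), b • res M h e = b' • res M h e → b = b')
    (hloc : ∀ (W : X.Opens) (h : W ≤ V) (m : Γ(M, W)), ∀ x ∈ W, ∃ (W' : X.Opens) (h' : W' ≤ W),
      x ∈ W' ∧ ∃ b : Γ(X, W'), res M h' m = b • res M (h'.trans h) e) : IsFrame M e := by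
  intro W h m
  obtain ⟨b, hb⟩ := exists_function_of_local (V := W)
    (fun W' h' (b : Γ(X, W')) => res M h' m = b • res M (h'.trans h) e)
    (fun W₁ W₂ h₁ h₂ s hs => by
      have := congrArg (res M h₂) hs
      rw [res_smul_rs, res_res, res_res] at this
      exact this)
    (fun W₁ h₁ s s' hs hs' => huniq W₁ _ _ _ (hs.symm.trans hs'))
    (hloc W h m)
  refine ⟨b, eq_of_local M fun x hx => ?_, fun b' hb' => huniq W h _ _ ?_⟩
  · obtain ⟨W', h', hx', b', hb'⟩ := hloc W h m x hx
    refine ⟨W', h', hx', ?_⟩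
    rw [res_smul_rs, res_res, hb W' h' b' hb']
    exact hb'
  · refine Eq.trans hb'.symm (eq_of_local M fun x hx => ?_)
    obtain ⟨W', h', hx', b', hb'⟩ := hloc W h m x hx
    refine ⟨W', h', hx', ?_⟩
    rw [res_smul_rs, res_res, hb W' h' b' hb']
    exact hb'

end Frame

/-! ### Vector fields and charts -/

section VectorFields

variable {X Y : Scheme.{u}} (p : ℕ) [hp : Fact p.Prime] {f : X ⟶ Y} [hY : IsOfChar Y p]

/-- The derivation `g ↦ D(dg)` of the functions on an open subset. -/
noncomputable def VectorField.toDerivation {V₀ : X.Opens} (D : VectorField f V₀) {V : X.Opens}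
    (h : V ≤ V₀) : Derivation ℤ Γ(X, V) Γ(X, V) :=
  Derivation.mk' (AddMonoidHom.mk' (fun g => formApp D h (d f g))
    (fun a b => by rw [d_add, map_add])).toIntLinearMap
    (fun a b => by
      show formApp D h (d f (a * b)) = a • formApp D h (d f b) + b • formApp D h (d f a)
      rw [d_mul, map_add, map_smul, map_smul])

lemma VectorField.toDerivation_apply {V₀ : X.Opens} (D : VectorField f V₀) {V : X.Opens}
    (h : V ≤ V₀) (g : Γ(X, V)) : D.toDerivation h g = formApp D h (d f g) := rfl

lemma VectorField.toDerivation_rs {V₀ : X.Opens} (D : VectorField f V₀) {V V' : X.Opens}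
    (h : V ≤ V₀) (h' : V' ≤ V) (g : Γ(X, V)) :
    D.toDerivation (h'.trans h) (rs h' g) = rs h' (D.toDerivation h g) := by
  rw [toDerivation_apply, toDerivation_apply, d_rs, formApp_res]

lemma VectorField.isPartialDerivative {W₀ : (twist p f).Opens}
    {D : VectorField f (relativeFrobenius p f ⁻¹ᵁ W₀)} {x : Γ(X, relativeFrobenius p f ⁻¹ᵁ W₀)}
    (hD : D.toDerivation le_rfl x = 1) {W : (twist p f).Opens} (h : W ≤ W₀) :
    IsPartialDerivative (fr p f W) (rs ((relativeFrobenius p f).preimage_mono h) x)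
      (D.toDerivation ((relativeFrobenius p f).preimage_mono h)) where
  map_F c := by rw [D.toDerivation_apply, d_fr, map_zero]
  map_x := by
    have := D.toDerivation_rs le_rfl ((relativeFrobenius p f).preimage_mono h) x
    rw [hD, map_one] at this
    exact this

/-- Compatible derivations of the functions on the open subsets of `V₀` define a vector field on
`V₀`. -/
theorem exists_hom_restrict_of_derivation {V₀ : X.Opens}
    (D : ∀ V : X.Opens, V ≤ V₀ → Derivation ℤ Γ(X, V) Γ(X, V))
    (hD : ∀ (V V' : X.Opens) (h : V ≤ V₀) (h' : V' ≤ V) (g : Γ(X, V)),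
      D V' (h'.trans h) (rs h' g) = rs h' (D V h g))
    (hconst : ∀ (S : Y.Opens) (V : X.Opens) (hV : V ≤ V₀) (h : V ≤ f ⁻¹ᵁ S) (c : Γ(Y, S)),
      D V hV (f.appLE S V h c) = 0) :
    ∃ E : VectorField f V₀, ∀ (V : X.Opens) (h : V ≤ V₀) (g : Γ(X, V)),
      E.toDerivation h g = D V h g := by
  let N := (Scheme.Modules.pushforward V₀.ι).obj ((𝒪 X).restrict V₀.ι)
  have e : ∀ V : X.Opens, V₀.ι ''ᵁ V₀.ι ⁻¹ᵁ V ≤ V₀ := fun V => image_ι_le _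
  let i : ∀ V : X.Opens, V₀.ι ''ᵁ V₀.ι ⁻¹ᵁ V ≤ V := fun V => V₀.ι.image_preimage_le V
  let δ : ∀ V : X.Opens, Γ(X, V) →+ Γ(N, V) := fun V =>
    AddMonoidHom.mk' (fun g => (show Γ(N, V) from D _ (e V) (rs (i V) g)))
      (fun a b => by rw [map_add, map_add]; rfl)
  have hsm : ∀ (V : X.Opens) (r : Γ(X, V)) (n : Γ(X, V₀.ι ''ᵁ V₀.ι ⁻¹ᵁ V)),
      (show Γ(N, V) from rs (i V) r * n) = r • (show Γ(N, V) from n) :=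
    fun V r n => smul_pushforward_restrict (𝒪 X) V r n
  obtain ⟨φ, hφ⟩ := exists_hom_of_derivation f N δ
    (fun V g h => by
      show (show Γ(N, V) from D _ (e V) (rs (i V) (g * h))) = _
      rw [map_mul, Derivation.leibniz]
      exact congrArg₂ _ (hsm V g _) (hsm V h _))
    (fun V W h g => by
      have e' : V₀.ι ''ᵁ V₀.ι ⁻¹ᵁ W ≤ V₀.ι ''ᵁ V₀.ι ⁻¹ᵁ V := V₀.ι.image_mono (V₀.ι.preimage_mono h)
      show D _ (e W) (rs (i W) (rs h g)) = rs e' (D _ (e V) (rs (i V) g))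
      rw [← hD _ _ (e V) e', rs_rs, rs_rs])
    (fun W c => by
      show D _ _ (rs (i _) (f.app W c)) = 0
      rw [← hconst W _ (e _) (i _) c]
      rfl)
  let ψ : ∀ V : X.Opens, V ≤ V₀ → Γ(Ω f, V) →ₗ[Γ(X, V)] Γ(𝒪 X, V) := fun V h =>
    { toFun := fun ω => res (𝒪 X) (le_image_preimage h)
        (show Γ(𝒪 X, V₀.ι ''ᵁ V₀.ι ⁻¹ᵁ V) from φ.app V ω)
      map_add' := fun a b => by
        rw [map_add]
        exact map_add (res (𝒪 X) (le_image_preimage h)) _ _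
      map_smul' := fun r a => by
        rw [Scheme.Modules.Hom.app_smul]
        refine Eq.trans (congrArg (res (𝒪 X) (le_image_preimage h)) (hsm V r _).symm) ?_
        refine Eq.trans (map_mul (rs (le_image_preimage h)) _ _) ?_
        rw [rs_rs, rs_self]
        rfl }
  refine ⟨restrictHomOfSections (N := 𝒪 X) ψ ?_, ?_⟩
  · intro W W' h h' m
    have e' : V₀.ι ''ᵁ V₀.ι ⁻¹ᵁ W' ≤ V₀.ι ''ᵁ V₀.ι ⁻¹ᵁ W :=
      V₀.ι.image_mono (V₀.ι.preimage_mono h')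
    have h1 := app_res φ h' m
    have h2 : (show Γ(𝒪 X, V₀.ι ''ᵁ V₀.ι ⁻¹ᵁ W') from φ.app W' (res (Ω f) h' m)) =
      res (𝒪 X) e' (show Γ(𝒪 X, V₀.ι ''ᵁ V₀.ι ⁻¹ᵁ W) from φ.app W m) := h1
    show res (𝒪 X) _ (show Γ(𝒪 X, V₀.ι ''ᵁ V₀.ι ⁻¹ᵁ W') from φ.app W' (res (Ω f) h' m)) =
      res (𝒪 X) _ (res (𝒪 X) _ _)
    rw [h2, res_res, res_res]
  · intro V h g
    rw [VectorField.toDerivation_apply]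
    show restrictApp (N := 𝒪 X) _ h (d f g) = _
    rw [restrictApp_restrictHomOfSections]
    have e' := le_image_preimage h
    show rs e' (show Γ(X, V₀.ι ''ᵁ V₀.ι ⁻¹ᵁ V) from φ.app V (d f g)) = _
    rw [hφ]
    show rs e' (D _ (e V) (rs (i V) g)) = _
    rw [← hD _ _ (e V) e', rs_rs, rs_self]

variable {p}

/-- A coordinate `x` has a dual vector field `d/dx`. -/
theorem IsCoordinate.exists_vectorField {W₀ : (twist p f).Opens}
    {x : Γ(X, relativeFrobenius p f ⁻¹ᵁ W₀)} (hx : IsCoordinate p f W₀ x) :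
    ∃ D : VectorField f (relativeFrobenius p f ⁻¹ᵁ W₀), D.toDerivation le_rfl x = 1 := by
  have hex : ∀ (V : X.Opens) (hV : V ≤ relativeFrobenius p f ⁻¹ᵁ W₀),
      ∃ D : Derivation ℤ Γ(X, V) Γ(X, V), D (rs hV x) = 1 ∧
        ∀ (W : (twist p f).Opens) (e : relativeFrobenius p f ⁻¹ᵁ W = V) (a : Γ(twist p f, W)),
          D (rs e.ge (fr p f W a)) = 0 := by
    intro V hV
    obtain ⟨W, rfl⟩ := exists_eq_preimage p f V
    have h : W ≤ W₀ := (preimage_le_preimage_iff p f).mp hV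
    obtain ⟨D, hD⟩ := (hx W h).exists_isPartialDerivative (IsOfChar.section_eq_zero _ p W)
      (t := tw p f W (rs hV x)) (fr_tw p f W _).symm
    refine ⟨D, hD.map_x, fun W' e a => ?_⟩
    obtain rfl : W' = W := le_antisymm ((preimage_le_preimage_iff p f).mp e.le)
      ((preimage_le_preimage_iff p f).mp e.ge)
    rw [rs_self]
    exact hD.map_F a
  choose D hDx hDc using hex
  have hpd : ∀ (W : (twist p f).Opens) (h : W ≤ W₀), IsPartialDerivative (fr p f W)
      (rs ((relativeFrobenius p f).preimage_mono h) x)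
      (D _ ((relativeFrobenius p f).preimage_mono h)) :=
    fun W h => ⟨fun c => by simpa only [rs_self] using hDc _ _ W rfl c, hDx _ _⟩
  obtain ⟨E, hE⟩ := exists_hom_restrict_of_derivation (f := f) D
    (fun V V' h h' g => by
      obtain ⟨W, rfl⟩ := exists_eq_preimage p f V
      obtain ⟨W', rfl⟩ := exists_eq_preimage p f V'
      have e : W ≤ W₀ := (preimage_le_preimage_iff p f).mp h
      have e' : W' ≤ W := (preimage_le_preimage_iff p f).mp h'
      induction g using (hx W e).induction_on with
      | add a b ha hb => simp only [map_add, ha, hb]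
      | mul_pow c n =>
        rw [(hpd W e).map_F_mul, (hpd W e).map_pow]
        simp only [map_mul, map_pow, map_natCast]
        rw [← fr_rs p f e', rs_rs, (hpd W' (e'.trans e)).map_F_mul, (hpd W' (e'.trans e)).map_pow])
    (fun S V hV h c => by
      obtain ⟨W, rfl⟩ := exists_eq_preimage p f V
      have h2 := (hpd W ((preimage_le_preimage_iff p f).mp hV)).map_F
        ((twistHom p f).appLE S W (le_twistHom_preimage p f h) c)
      rw [← h2, fr_eq_appLE]
      congr 1
      refine Eq.symm ((ConcreteCategory.congr_hom
        (Scheme.Hom.appLE_comp_appLE (relativeFrobenius p f) (twistHom p f) S W _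
        (le_twistHom_preimage p f h) le_rfl) c).trans ?_)
      exact appLE_eq_of_eq (relativeFrobenius_snd p f) _ _ _ _)
  refine ⟨E, ?_⟩
  have h1 := hDx _ (le_refl (relativeFrobenius p f ⁻¹ᵁ W₀))
  rw [rs_self] at h1
  exact (hE _ _ _).trans h1

lemma IsPartialDerivative.d_eq {W : (twist p f).Opens} {x : Γ(X, relativeFrobenius p f ⁻¹ᵁ W)}
    {D : Derivation ℤ Γ(X, relativeFrobenius p f ⁻¹ᵁ W) Γ(X, relativeFrobenius p f ⁻¹ᵁ W)}
    (hD : IsPartialDerivative (fr p f W) x D) (hx : IsPBasis p (fr p f W) x)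
    (g : Γ(X, relativeFrobenius p f ⁻¹ᵁ W)) : d f g = D g • d f x := by
  induction g using hx.induction_on with
  | add a b ha hb => rw [d_add, map_add, add_smul, ha, hb]
  | mul_pow c n =>
    rw [d_mul, d_fr, smul_zero, add_zero, hD.map_F_mul, hD.map_pow]
    rcases n with _ | n
    · simp [d_one]
    · rw [d_pow, smul_smul, smul_smul, Nat.add_sub_cancel, mul_assoc]

/-- The differential of a coordinate is a frame of `Ω`. -/
theorem IsCoordinate.isFrame {W₀ : (twist p f).Opens}
    {x : Γ(X, relativeFrobenius p f ⁻¹ᵁ W₀)} (hx : IsCoordinate p f W₀ x) :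
    IsFrame (Ω f) (d f x) := by
  obtain ⟨D, hD⟩ := hx.exists_vectorField
  refine isFrame_of_local (fun V h b b' hb => ?_) (fun V h ω u hu => ?_)
  · have h1 := congrArg (formApp D h) hb
    rw [map_smul, map_smul, formApp_res D le_rfl h, ← VectorField.toDerivation_apply, hD,
      map_one, smul_eq_mul, smul_eq_mul, mul_one, mul_one] at h1
    exact h1
  · obtain ⟨V', h', hu', hω⟩ := exists_mem_span_d f ω u hu
    refine ⟨V', h', hu', ?_⟩
    obtain ⟨W, rfl⟩ := exists_eq_preimage p f V'
    have hW : W ≤ W₀ := (preimage_le_preimage_iff p f).mp (h'.trans h)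
    generalize res (Ω f) h' ω = η at hω
    induction hω using Submodule.span_induction with
    | mem _ hg =>
      obtain ⟨g, rfl⟩ := hg
      exact ⟨_, ((VectorField.isPartialDerivative p hD hW).d_eq (hx W hW) g).trans
        (congrArg _ (d_rs _ _ x))⟩
    | zero => exact ⟨0, by rw [zero_smul]⟩
    | add a b _ _ ha hb =>
      obtain ⟨a', ha'⟩ := ha
      obtain ⟨b', hb'⟩ := hb
      exact ⟨a' + b', by rw [add_smul, ← ha', ← hb']⟩
    | smul r a _ ha =>
      obtain ⟨a', ha'⟩ := ha
      exact ⟨r * a', by rw [mul_smul, ← ha']⟩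

variable (f) in
/-- A chart: a coordinate `x` such that `x ⊗ 1` has nonvanishing differential on the Frobenius
twist. -/
def IsChart (W₀ : (twist p f).Opens) (x : Γ(X, relativeFrobenius p f ⁻¹ᵁ W₀)) : Prop :=
  IsCoordinate p f W₀ x ∧ IsFrame (Ω (twistHom p f)) (d (twistHom p f) (tw p f W₀ x))

lemma IsChart.mono {W₀ W₁ : (TangoCurve.twist p f).Opens}
    {x : Γ(X, relativeFrobenius p f ⁻¹ᵁ W₀)} (hx : IsChart f W₀ x) (h : W₁ ≤ W₀) :
    IsChart f W₁ (rs ((relativeFrobenius p f).preimage_mono h) x) := by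
  refine ⟨hx.1.mono p h, ?_⟩
  rw [tw_rs, d_rs]
  exact hx.2.mono h

/-- Charts exist, because the twist is again a smooth curve, with coordinate `x ⊗ 1`. -/
theorem exists_isChart [SmoothOfRelativeDimension 1 f] (y : twist p f) :
    ∃ (W : (twist p f).Opens) (_ : y ∈ W) (x : Γ(X, relativeFrobenius p f ⁻¹ᵁ W)),
      IsChart f W x := by
  obtain ⟨u, rfl⟩ := relativeFrobenius_surjective p f y
  obtain ⟨V, hu, x, hx⟩ := exists_isEtaleCoordinate f u
  obtain ⟨W, rfl⟩ := exists_eq_preimage p f V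
  refine ⟨W, hu, x, hx.isCoordinate p, ?_⟩
  have h := hx.twist p
  -- the open subset of the twist has to be a preimage under its own relative Frobenius
  generalize tw p f W x = y at h
  obtain ⟨W', rfl⟩ := exists_eq_preimage p (twistHom p f) W
  exact (h.isCoordinate p).isFrame

/-- Charts exist inside any open set. -/
theorem exists_isChart_le [SmoothOfRelativeDimension 1 f] {W : (twist p f).Opens} {y : twist p f}
    (hy : y ∈ W) : ∃ (W' : (twist p f).Opens) (_ : W' ≤ W) (_ : y ∈ W')
      (x : Γ(X, relativeFrobenius p f ⁻¹ᵁ W')), IsChart f W' x := by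
  obtain ⟨W₁, hy₁, x, hx⟩ := exists_isChart (f := f) (p := p) y
  exact ⟨W ⊓ W₁, inf_le_left, ⟨hy, hy₁⟩, _, hx.mono inf_le_right⟩

end VectorFields

/-! ### The Cartier operator -/

section Cartier

variable {X Y : Scheme.{u}} {p : ℕ} [hp : Fact p.Prime] {f : X ⟶ Y} [hY : IsOfChar Y p]

lemma IsCoordinate.isPBasis {W : (twist p f).Opens} {x : Γ(X, relativeFrobenius p f ⁻¹ᵁ W)}
    (hx : IsCoordinate p f W x) : IsPBasis p (fr p f W) x := by
  have h := hx W le_rfl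
  rwa [rs_self] at h

/-- The index `p - 1` of the last element of a `p`-basis. -/
def lastIndex (p : ℕ) [hp : Fact p.Prime] : Fin p := ⟨p - 1, Nat.sub_lt hp.out.pos Nat.one_pos⟩

/-- The Cartier operator in terms of a chart `x`: the coefficient of `x ^ (p - 1) dx` times
`d(x ⊗ 1)`. -/
noncomputable def IsChart.cartier {W : (twist p f).Opens} {x : Γ(X, relativeFrobenius p f ⁻¹ᵁ W)}
    (hx : IsChart f W x) (ω : Γ(Ω f, relativeFrobenius p f ⁻¹ᵁ W)) : Γ(Ω (twistHom p f), W) :=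
  hx.1.isPBasis.coeff (hx.1.isFrame.exists_eq_smul ω).choose (lastIndex p) •
    d (twistHom p f) (tw p f W x)

variable {W : (twist p f).Opens} {x : Γ(X, relativeFrobenius p f ⁻¹ᵁ W)}

lemma IsChart.cartier_smul_d (hx : IsChart f W x) (b : Γ(X, relativeFrobenius p f ⁻¹ᵁ W)) :
    hx.cartier (b • d f x) =
      hx.1.isPBasis.coeff b (lastIndex p) • d (twistHom p f) (tw p f W x) := by
  have h := (hx.1.isFrame.exists_eq_smul (b • d f x)).choose_spec
  rw [IsChart.cartier, ← hx.1.isFrame.eq_of_smul_eq h]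

lemma IsChart.cartier_add (hx : IsChart f W x) (ω ω' : Γ(Ω f, relativeFrobenius p f ⁻¹ᵁ W)) :
    hx.cartier (ω + ω') = hx.cartier ω + hx.cartier ω' := by
  obtain ⟨b, rfl⟩ := hx.1.isFrame.exists_eq_smul ω
  obtain ⟨b', rfl⟩ := hx.1.isFrame.exists_eq_smul ω'
  rw [← add_smul, hx.cartier_smul_d, hx.cartier_smul_d, hx.cartier_smul_d, IsPBasis.coeff_add,
    Pi.add_apply, add_smul]

lemma IsChart.cartier_fr_smul (hx : IsChart f W x) (a : Γ(twist p f, W))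
    (ω : Γ(Ω f, relativeFrobenius p f ⁻¹ᵁ W)) :
    hx.cartier (fr p f W a • ω) = a • hx.cartier ω := by
  obtain ⟨b, rfl⟩ := hx.1.isFrame.exists_eq_smul ω
  rw [smul_smul, hx.cartier_smul_d, hx.cartier_smul_d, IsPBasis.coeff_mul, Pi.smul_apply,
    smul_eq_mul, mul_smul]

lemma IsChart.cartier_zero (hx : IsChart f W x) : hx.cartier 0 = 0 := by
  have := hx.cartier_add 0 0
  rwa [add_zero, left_eq_add] at this

lemma IsChart.cartier_fr_mul_pow (hx : IsChart f W x) (c : Γ(twist p f, W)) (n : Fin p) :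
    hx.cartier ((fr p f W c * x ^ (n : ℕ)) • d f x) =
      (Pi.single n c : Fin p → Γ(twist p f, W)) (lastIndex p) • d (twistHom p f) (tw p f W x) := by
  rw [hx.cartier_smul_d, IsPBasis.coeff_mul_pow]

lemma d_fr_mul_pow (c : Γ(twist p f, W)) (n : ℕ) : d f (fr p f W c * x ^ (n + 1)) =
    (fr p f W (((n + 1 : ℕ) : Γ(twist p f, W)) * c) * x ^ n) • d f x := by
  rw [d_mul, d_fr, smul_zero, add_zero, d_pow, smul_smul, smul_smul, map_mul, map_natCast]
  congr 1
  ring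

/-- Exact forms are killed. -/
lemma IsChart.cartier_d (hx : IsChart f W x) (g : Γ(X, relativeFrobenius p f ⁻¹ᵁ W)) :
    hx.cartier (d f g) = 0 := by
  rw [← hx.1.isPBasis.sum_coeff g]
  refine Finset.sum_induction _ (fun g => hx.cartier (d f g) = 0)
    (fun a b ha hb => by rw [d_add, hx.cartier_add, ha, hb, add_zero])
    (by rw [d_zero, hx.cartier_zero]) ?_
  rintro ⟨n, hn⟩ -
  rcases n with _ | n
  · rw [pow_zero, mul_one, d_fr, hx.cartier_zero]
  · have h1 := hx.cartier_fr_mul_pow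
      (((n + 1 : ℕ) : Γ(twist p f, W)) * hx.1.isPBasis.coeff g ⟨n + 1, hn⟩)
      ⟨n, (Nat.lt_succ_self n).trans hn⟩
    rw [d_fr_mul_pow]
    refine h1.trans ?_
    rw [Pi.single_eq_of_ne, zero_smul]
    intro h
    have h2 : p - 1 = n := congrArg Fin.val h
    omega

lemma d_pow_char (a : Γ(twist p f, W)) : d (twistHom p f) (a ^ p) = 0 :=
  pow_mem_constants p (twistHom p f) a

/-- `g ^ (p - 1) dg` is sent to `d(g ⊗ 1)`: both sides are additive in `g`, the left hand side
since `(a + b) ^ (p - 1) d(a + b) - a ^ (p - 1) da - b ^ (p - 1) db` is exact. -/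
theorem IsChart.cartier_pow_smul_d (hx : IsChart f W x)
    (g : Γ(X, relativeFrobenius p f ⁻¹ᵁ W)) :
    hx.cartier (g ^ (p - 1) • d f g) = d (twistHom p f) (tw p f W g) := by
  induction g using hx.1.isPBasis.induction_on with
  | add a b ha hb =>
    obtain ⟨z, hz⟩ := exists_add_pow_smul_eq p (fun g => d f g) (d_add f)
      (fun a b => d_mul f a b) a b
    rw [hz, hx.cartier_add, hx.cartier_add, ha, hb, hx.cartier_d, add_zero, map_add, d_add]
  | mul_pow c n =>
    rcases n with _ | n
    · rw [pow_zero, mul_one, d_fr, smul_zero, hx.cartier_zero, tw_fr, d_pow_char]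
    · have h1 : (fr p f W c * x ^ (n + 1)) ^ (p - 1) • d f (fr p f W c * x ^ (n + 1)) =
          fr p f W (((n + 1 : ℕ) : Γ(twist p f, W)) * c ^ p * tw p f W x ^ n) •
            ((fr p f W 1 * x ^ (lastIndex p : ℕ)) • d f x) := by
        rw [d_fr_mul_pow, smul_smul, smul_smul]
        simp only [map_mul, map_pow, fr_tw, map_one, map_natCast]
        congr 1
        show _ = _ * (1 * x ^ (p - 1))
        have h2 : ∀ a : Γ(X, relativeFrobenius p f ⁻¹ᵁ W), a ^ p = a ^ (p - 1) * a := fun a => by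
          rw [← pow_succ, Nat.sub_add_cancel hp.out.one_le]
        rw [h2, h2]
        ring
      rw [h1, hx.cartier_fr_smul, hx.cartier_fr_mul_pow, Pi.single_eq_same, one_smul, map_mul,
        map_pow, tw_fr, d_mul, d_pow_char, smul_zero, add_zero, d_pow, smul_smul, smul_smul]
      congr 1
      ring

/-- A form killed by the Cartier operator is exact on a chart. -/
theorem IsChart.exists_eq_d (hx : IsChart f W x) {ω : Γ(Ω f, relativeFrobenius p f ⁻¹ᵁ W)}
    (h : hx.cartier ω = 0) : ∃ g, ω = d f g := by
  obtain ⟨b, rfl⟩ := hx.1.isFrame.exists_eq_smul ω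
  rw [hx.cartier_smul_d, ← zero_smul Γ(twist p f, W)] at h
  have h0 := hx.2.eq_of_smul_eq h
  obtain ⟨D, hD⟩ := hx.1.exists_vectorField
  have hD' := VectorField.isPartialDerivative p hD le_rfl
  rw [rs_self] at hD'
  obtain ⟨g, hg⟩ := hD'.exists_map_eq
    (haveI := IsOfChar.of_hom f p; IsOfChar.section_eq_zero X p _) (hx.1.isPBasis.coeff b)
    (fun n hn => by rwa [show n = lastIndex p from Fin.ext hn])
  rw [hx.1.isPBasis.sum_coeff] at hg
  exact ⟨g, by rw [hD'.d_eq hx.1.isPBasis g, hg]⟩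

/-- A map with the formal properties of the Cartier operator is given by the chart formula. -/
lemma IsChart.eq_cartier (hx : IsChart f W x)
    (γ : Γ(Ω f, relativeFrobenius p f ⁻¹ᵁ W) → Γ(Ω (twistHom p f), W))
    (hadd : ∀ ω ω', γ (ω + ω') = γ ω + γ ω') (hsmul : ∀ a ω, γ (fr p f W a • ω) = a • γ ω)
    (hd : ∀ g, γ (d f g) = 0)
    (hpow : ∀ g, γ (g ^ (p - 1) • d f g) = d (twistHom p f) (tw p f W g)) (ω) :
    γ ω = hx.cartier ω := by
  have h0 : γ 0 = 0 := by
    have := hadd 0 0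
    rwa [add_zero, left_eq_add] at this
  obtain ⟨b, rfl⟩ := hx.1.isFrame.exists_eq_smul ω
  rw [← hx.1.isPBasis.sum_coeff b]
  refine Finset.sum_induction _ (fun b => γ (b • d f x) = hx.cartier (b • d f x))
    (fun a b ha hb => by rw [add_smul, hadd, hx.cartier_add, ha, hb])
    (by rw [zero_smul, h0, hx.cartier_zero]) fun n _ => ?_
  by_cases hn : n = lastIndex p
  · subst hn
    rw [mul_smul, hsmul, hx.cartier_fr_smul]
    exact congrArg _ ((hpow x).trans (hx.cartier_pow_smul_d x).symm)
  · have h1 : hx.cartier ((fr p f W (hx.1.isPBasis.coeff b n) * x ^ (n : ℕ)) • d f x) = 0 := by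
      rw [hx.cartier_fr_mul_pow, Pi.single_eq_of_ne (Ne.symm hn), zero_smul]
    obtain ⟨g, hg⟩ := hx.exists_eq_d h1
    rw [h1, hg, hd]

lemma IsChart.cartier_eq {x' : Γ(X, relativeFrobenius p f ⁻¹ᵁ W)} (hx : IsChart f W x)
    (hx' : IsChart f W x') (ω) : hx.cartier ω = hx'.cartier ω :=
  hx'.eq_cartier _ hx.cartier_add hx.cartier_fr_smul hx.cartier_d hx.cartier_pow_smul_d ω

lemma IsCoordinate.coeff_rs (hx : IsCoordinate p f W x) {W' : (twist p f).Opens} (h : W' ≤ W)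
    (b : Γ(X, relativeFrobenius p f ⁻¹ᵁ W)) (n : Fin p) :
    (hx W' h).coeff (rs ((relativeFrobenius p f).preimage_mono h) b) n =
      rs h (hx.isPBasis.coeff b n) := by
  refine congrFun ((hx W' h).coeff_eq (c := fun n => rs h (hx.isPBasis.coeff b n)) ?_) n
  rw [← rs_sum_fr, hx.isPBasis.sum_coeff]

lemma IsChart.cartier_res (hx : IsChart f W x) {W' : (twist p f).Opens} (h : W' ≤ W)
    (ω : Γ(Ω f, relativeFrobenius p f ⁻¹ᵁ W)) :
    (hx.mono h).cartier (res (Ω f) ((relativeFrobenius p f).preimage_mono h) ω) =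
      res (Ω (twistHom p f)) h (hx.cartier ω) := by
  obtain ⟨b, rfl⟩ := hx.1.isFrame.exists_eq_smul ω
  rw [res_smul_rs, ← d_rs, (hx.mono h).cartier_smul_d, hx.cartier_smul_d, res_smul_rs, ← d_rs,
    ← tw_rs, ← hx.1.coeff_rs h]

/-- A map out of `F_* M`, on sections. -/
noncomputable def fromPush {M : X.Modules} {N : (twist p f).Modules}
    (φ : (Scheme.Modules.pushforward (relativeFrobenius p f)).obj M ⟶ N) (W : (twist p f).Opens) :
    Γ(M, relativeFrobenius p f ⁻¹ᵁ W) →+ Γ(N, W) :=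
  (φ.app W).hom

lemma fromPush_smul {M : X.Modules} {N : (twist p f).Modules}
    (φ : (Scheme.Modules.pushforward (relativeFrobenius p f)).obj M ⟶ N) (W : (twist p f).Opens)
    (a : Γ(twist p f, W)) (m : Γ(M, relativeFrobenius p f ⁻¹ᵁ W)) :
    fromPush φ W (fr p f W a • m) = a • fromPush φ W m :=
  φ.app_smul a (U := W) m

lemma fromPush_res {M : X.Modules} {N : (twist p f).Modules}
    (φ : (Scheme.Modules.pushforward (relativeFrobenius p f)).obj M ⟶ N) {W W' : (twist p f).Opens}
    (h : W' ≤ W) (m : Γ(M, relativeFrobenius p f ⁻¹ᵁ W)) :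
    fromPush φ W' (res M ((relativeFrobenius p f).preimage_mono h) m) = res N h (fromPush φ W m) :=
  app_res φ h m

/-- A map into `F_* M`, on sections. -/
noncomputable def toPush {M : X.Modules} {N : (twist p f).Modules}
    (φ : N ⟶ (Scheme.Modules.pushforward (relativeFrobenius p f)).obj M) (W : (twist p f).Opens) :
    Γ(N, W) →+ Γ(M, relativeFrobenius p f ⁻¹ᵁ W) :=
  (φ.app W).hom

lemma toPush_smul {M : X.Modules} {N : (twist p f).Modules}
    (φ : N ⟶ (Scheme.Modules.pushforward (relativeFrobenius p f)).obj M) (W : (twist p f).Opens)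
    (a : Γ(twist p f, W)) (n : Γ(N, W)) :
    toPush φ W (a • n) = fr p f W a • toPush φ W n :=
  φ.app_smul a (U := W) n

lemma toPush_res {M : X.Modules} {N : (twist p f).Modules}
    (φ : N ⟶ (Scheme.Modules.pushforward (relativeFrobenius p f)).obj M) {W W' : (twist p f).Opens}
    (h : W' ≤ W) (n : Γ(N, W)) :
    toPush φ W' (res N h n) = res M ((relativeFrobenius p f).preimage_mono h) (toPush φ W n) :=
  app_res φ h n

/-- The defining properties of a Cartier operator, over the open subsets of `X^(1)`. -/
lemma isCartierOperator_iff
    (C : (Scheme.Modules.pushforward (relativeFrobenius p f)).obj (Ω f) ⟶ Ω (twistHom p f)) :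
    IsCartierOperator p f C ↔
      (∀ W (g : Γ(X, relativeFrobenius p f ⁻¹ᵁ W)), fromPush C W (d f g) = 0) ∧
      ∀ W (g : Γ(X, relativeFrobenius p f ⁻¹ᵁ W)),
        fromPush C W (g ^ (p - 1) • d f g) = d (twistHom p f) (tw p f W g) := by
  have key : ∀ (V : X.Opens) (W : (twist p f).Opens) (e : W = twistFst p f ⁻¹ᵁ V)
      (e' : relativeFrobenius p f ⁻¹ᵁ W ≤ V) (g : Γ(X, V)),
      tw p f W (rs e' g) = rs e.le ((twistFst p f).app V g) := by
    intro V W e e' g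
    refine (ConcreteCategory.congr_hom (Scheme.Hom.map_appLE (twistFst p f) _ _) g).trans ?_
    rfl
  constructor
  · rintro ⟨h1, h2⟩
    refine ⟨h1, fun W g => ?_⟩
    have e := (twistFst_preimage p f W).symm
    have e' := le_preimage p f (relativeFrobenius p f ⁻¹ᵁ W)
    have h3 : fromPush C _ ((rs e' g) ^ (p - 1) • d f (rs e' g)) =
      d _ ((twistFst p f).app _ g) := h2 _ g
    have h4 := congrArg (res (Ω (twistHom p f)) e.le) h3
    rw [← fromPush_res, ← d_rs, ← key _ W e (le_refl (relativeFrobenius p f ⁻¹ᵁ W)) g, rs_self,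
      res_smul_rs, map_pow, ← d_rs, rs_rs, rs_self] at h4
    exact h4
  · rintro ⟨h1, h2⟩
    refine ⟨h1, fun V g => ?_⟩
    refine (h2 (twistFst p f ⁻¹ᵁ V) (rs (le_preimage p f V) g)).trans ?_
    rw [key V _ rfl, rs_self]

lemma IsCartierOperator.fromPush_eq
    {C : (Scheme.Modules.pushforward (relativeFrobenius p f)).obj (Ω f) ⟶ Ω (twistHom p f)}
    (hC : IsCartierOperator p f C) (hx : IsChart f W x)
    (ω : Γ(Ω f, relativeFrobenius p f ⁻¹ᵁ W)) : fromPush C W ω = hx.cartier ω :=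
  hx.eq_cartier (fun ω => fromPush C W ω) (map_add _) (fromPush_smul C W)
    (((isCartierOperator_iff C).mp hC).1 W) (((isCartierOperator_iff C).mp hC).2 W) ω

variable (p f) in
/-- The chart formulas for the Cartier operator agree on overlaps, so that they glue. -/
theorem existsUnique_isCartierOperator [SmoothOfRelativeDimension 1 f] :
    ∃! C, IsCartierOperator p f C := by
  let M := (Scheme.Modules.pushforward (relativeFrobenius p f)).obj (Ω f)
  obtain ⟨C, hC⟩ : ∃ C : M ⟶ Ω (twistHom p f), ∀ (W : (twist p f).Opens)
      (x : Γ(X, relativeFrobenius p f ⁻¹ᵁ W)) (hx : IsChart f W x) (ω),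
      fromPush C W ω = hx.cartier ω := by
    obtain ⟨C, hC⟩ := exists_hom_of_relation M (Ω (twistHom p f))
      (fun W ω η => ∃ (x : _) (hx : IsChart f W x), η = hx.cartier ω)
      (by
        rintro W W' h m _ ⟨x, hx, rfl⟩
        exact ⟨_, hx.mono h, (hx.cartier_res h m).symm⟩)
      (by
        rintro W m m' _ _ ⟨x, hx, rfl⟩ ⟨x', hx', rfl⟩ y hy
        refine ⟨W, le_rfl, hy, x, hx, ?_⟩
        rw [res_self, res_self]
        exact (congrArg _ (hx'.cartier_eq hx m')).trans (hx.cartier_add m m').symm)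
      (by
        rintro W a m _ ⟨x, hx, rfl⟩
        exact ⟨x, hx, (hx.cartier_fr_smul a m).symm⟩)
      (by
        rintro W m _ _ ⟨x, hx, rfl⟩ ⟨x', hx', rfl⟩
        exact hx.cartier_eq hx' m)
      (by
        intro W m y hy
        obtain ⟨W', h, hy', x, hx⟩ := exists_isChart_le (f := f) hy
        exact ⟨W', h, hy', _, x, hx, rfl⟩)
    exact ⟨C, fun W x hx ω => hC W ω _ ⟨x, hx, rfl⟩⟩
  refine ⟨C, (isCartierOperator_iff C).mpr ⟨fun W g => ?_, fun W g => ?_⟩, fun C' hC' => ?_⟩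
  · refine eq_zero_of_local _ _ fun y hy => ?_
    obtain ⟨W', h, hy', x, hx⟩ := exists_isChart_le (f := f) hy
    exact ⟨W', h, hy', by rw [← fromPush_res, hC W' x hx, ← d_rs, hx.cartier_d]⟩
  · refine eq_of_local _ fun y hy => ?_
    obtain ⟨W', h, hy', x, hx⟩ := exists_isChart_le (f := f) hy
    refine ⟨W', h, hy', ?_⟩
    rw [← fromPush_res, hC W' x hx, res_smul_rs, map_pow, ← d_rs, hx.cartier_pow_smul_d, tw_rs,
      d_rs]
  · refine hom_ext_sections fun W ω => eq_of_local _ fun y hy => ?_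
    obtain ⟨W', h, hy', x, hx⟩ := exists_isChart_le (f := f) hy
    refine ⟨W', h, hy', ?_⟩
    refine (fromPush_res C' h ω).symm.trans (Eq.trans ?_ (fromPush_res C h ω))
    rw [hC W' x hx, hC'.fromPush_eq hx]

end Cartier

/-! ### Sections of subsheaves of `F_* M` -/

section Sections

variable {Z : Scheme.{u}}

/-- Sections over an open set, as a functor. -/
noncomputable def sectionsFunctor (W : Z.Opens) : Z.Modules ⥤ Ab.{u} :=
  Scheme.Modules.toPresheaf Z ⋙ (CategoryTheory.evaluation _ _).obj (op W)

instance (W : Z.Opens) : PreservesLimitsOfSize.{0, 0} (sectionsFunctor W) :=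
  have : PreservesLimitsOfSize.{0, 0} (Scheme.Modules.toPresheaf Z) :=
    preservesLimitsOfSize_shrink _
  have : PreservesLimitsOfSize.{0, 0} ((CategoryTheory.evaluation (Opens Z)ᵒᵖ Ab.{u}).obj (op W)) :=
    inferInstance
  comp_preservesLimits _ _

lemma app_injective {M N : Z.Modules} (φ : M ⟶ N) [Mono φ] (W : Z.Opens) :
    Function.Injective (φ.app W) := by
  have h : Mono ((sectionsFunctor W).map φ) := inferInstance
  exact (AddCommGrpCat.mono_iff_injective _).mp h

lemma exists_kernel_app_eq {M N : Z.Modules} (φ : M ⟶ N) (W : Z.Opens) (m : Γ(M, W))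
    (hm : φ.app W m = 0) : ∃ k : Γ(kernel φ, W), (kernel.ι φ).app W k = m := by
  have : (sectionsFunctor (Z := Z) W).PreservesZeroMorphisms := ⟨fun _ _ => rfl⟩
  let S := ShortComplex.mk (kernel.ι φ) φ (kernel.condition φ)
  have hS : S.Exact := ShortComplex.exact_kernel φ
  have : Mono S.f := inferInstanceAs (Mono (kernel.ι φ))
  have h := hS.map_of_mono_of_preservesKernel (sectionsFunctor W) inferInstance inferInstance
  rw [ShortComplex.ab_exact_iff] at h
  exact h m hm

end Sections

section Subobjects

variable {X Y : Scheme.{u}} {p : ℕ} [hp : Fact p.Prime] {f : X ⟶ Y} [hY : IsOfChar Y p]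
  {M : X.Modules}

/-- The sections of a subobject of `F_* M` over `W`, as sections of `M`. -/
noncomputable def secs (L : Subobject ((Scheme.Modules.pushforward (relativeFrobenius p f)).obj M))
    (W : (twist p f).Opens) : AddSubgroup Γ(M, relativeFrobenius p f ⁻¹ᵁ W) :=
  (toPush L.arrow W).range

variable {L L' : Subobject ((Scheme.Modules.pushforward (relativeFrobenius p f)).obj M)}
  {W W' : (twist p f).Opens}

lemma toPush_arrow_injective : Function.Injective (toPush L.arrow W) :=
  app_injective L.arrow W

lemma res_mem_secs (h : W' ≤ W) {m : Γ(M, relativeFrobenius p f ⁻¹ᵁ W)} (hm : m ∈ secs L W) :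
    res M ((relativeFrobenius p f).preimage_mono h) m ∈ secs L W' := by
  obtain ⟨l, rfl⟩ := hm
  exact ⟨_, toPush_res L.arrow h l⟩

lemma smul_mem_secs (a : Γ(twist p f, W)) {m : Γ(M, relativeFrobenius p f ⁻¹ᵁ W)}
    (hm : m ∈ secs L W) : fr p f W a • m ∈ secs L W := by
  obtain ⟨l, rfl⟩ := hm
  exact ⟨_, toPush_smul L.arrow W a l⟩

lemma mem_secs_of_local {m : Γ(M, relativeFrobenius p f ⁻¹ᵁ W)}
    (h : ∀ y ∈ W, ∃ (W' : (twist p f).Opens) (hW : W' ≤ W), y ∈ W' ∧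
      res M ((relativeFrobenius p f).preimage_mono hW) m ∈ secs L W') : m ∈ secs L W := by
  obtain ⟨l, hl⟩ := exists_section_of_local (L : (twist p f).Modules) (V := W)
    (fun W' hW l => toPush L.arrow W' l = res M ((relativeFrobenius p f).preimage_mono hW) m)
    (fun W₁ W₂ h₁ h₂ l hl => by rw [toPush_res, hl, res_res])
    (fun W₁ h₁ l l' hl hl' => toPush_arrow_injective (hl.trans hl'.symm))
    (fun y hy => by
      obtain ⟨W', hW, hy', l, hl⟩ := h y hy
      exact ⟨W', hW, hy', l, hl⟩)
  refine ⟨l, eq_of_local M fun u hu => ?_⟩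
  obtain ⟨W', hW, hy', l', hl'⟩ := h (relativeFrobenius p f u) hu
  refine ⟨_, (relativeFrobenius p f).preimage_mono hW, hy', ?_⟩
  rw [← toPush_res _ hW, hl W' hW l' hl', hl']

lemma secs_mono (h : L ≤ L') (W : (twist p f).Opens) : secs L W ≤ secs L' W := by
  rintro _ ⟨l, rfl⟩
  refine ⟨(Subobject.ofLE L L' h).app W l, ?_⟩
  exact ConcreteCategory.congr_hom
    (congrArg (fun φ => Scheme.Modules.Hom.app φ W) (Subobject.ofLE_arrow h)) l

/-- The inclusion of subobjects can be tested on sections. -/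
theorem le_of_secs_le (h : ∀ W, secs L W ≤ secs L' W) : L ≤ L' := by
  have hex : ∀ W (l : Γ((L : (twist p f).Modules), W)), ∃ l', toPush L'.arrow W l' =
      toPush L.arrow W l := fun W l => h W ⟨l, rfl⟩
  choose φ hφ using hex
  refine Subobject.le_of_comm (homOfSections φ ?_ ?_ ?_) (hom_ext_sections hφ)
  · exact fun W l l' => toPush_arrow_injective (by rw [map_add, hφ, hφ, hφ, map_add])
  · exact fun W a l => toPush_arrow_injective (by rw [toPush_smul, hφ, hφ, toPush_smul])
  · exact fun W W' h l => toPush_arrow_injective (by rw [toPush_res, hφ, hφ, toPush_res])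

lemma eq_of_secs_eq (h : ∀ W, secs L W = secs L' W) : L = L' :=
  le_antisymm (le_of_secs_le fun W => (h W).le) (le_of_secs_le fun W => (h W).ge)

lemma mem_secs_kernel {N : (twist p f).Modules}
    (φ : (Scheme.Modules.pushforward (relativeFrobenius p f)).obj M ⟶ N)
    (m : Γ(M, relativeFrobenius p f ⁻¹ᵁ W)) :
    m ∈ secs (kernelSubobject φ) W ↔ fromPush φ W m = 0 := by
  constructor
  · rintro ⟨l, rfl⟩
    exact ConcreteCategory.congr_hom
      (congrArg (fun φ => Scheme.Modules.Hom.app φ W) (kernelSubobject_arrow_comp φ)) l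
  · intro h
    obtain ⟨k, hk⟩ := exists_kernel_app_eq φ W m h
    refine ⟨(kernelSubobjectIso φ).inv.app W k, ?_⟩
    refine Eq.trans ?_ hk
    exact ConcreteCategory.congr_hom
      (congrArg (fun φ => Scheme.Modules.Hom.app φ W) (kernelSubobject_arrow' φ)) k

lemma mem_secs_horizontal (nabla : Connection f M) (m : Γ(M, relativeFrobenius p f ⁻¹ᵁ W)) :
    m ∈ secs (horizontal p nabla) W ↔ nabla.toHom.app (op _) m = 0 :=
  mem_secs_kernel (frobeniusConnection p nabla) m

lemma d_mem_secs (g : Γ(X, relativeFrobenius p f ⁻¹ᵁ W)) : d f g ∈ secs (locallyExact p f) W := by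
  refine ⟨(factorThruImageSubobject (frobeniusD p f)).app W g, ?_⟩
  exact ConcreteCategory.congr_hom
    (congrArg (fun φ => Scheme.Modules.Hom.app φ W) (imageSubobject_arrow_comp (frobeniusD p f))) g

variable {C : (Scheme.Modules.pushforward (relativeFrobenius p f)).obj (Ω f) ⟶ Ω (twistHom p f)}

lemma IsCartierOperator.locallyExact_le (hC : IsCartierOperator p f C) :
    locallyExact p f ≤ kernelSubobject C := by
  have h : frobeniusD p f ≫ C = 0 :=
    hom_ext_sections fun W g => ((isCartierOperator_iff C).mp hC).1 W g
  exact imageSubobject_le _ (factorThruKernelSubobject C (frobeniusD p f) h)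
    (factorThruKernelSubobject_comp_arrow C _ h)

variable [SmoothOfRelativeDimension 1 f]

/-- The kernel of the Cartier operator consists of the locally exact forms. -/
theorem IsCartierOperator.locallyExact_eq (hC : IsCartierOperator p f C) :
    locallyExact p f = kernelSubobject C := by
  refine le_antisymm hC.locallyExact_le
    (le_of_secs_le fun W ω hω => mem_secs_of_local fun y hy => ?_)
  rw [mem_secs_kernel] at hω
  obtain ⟨W', h, hy', x, hx⟩ := exists_isChart_le (f := f) hy
  refine ⟨W', h, hy', ?_⟩
  have h1 := fromPush_res C h ω
  rw [hω, map_zero, hC.fromPush_eq hx] at h1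
  obtain ⟨g, hg⟩ := hx.exists_eq_d h1
  rw [hg]
  exact d_mem_secs g

lemma IsChart.mem_secs_locallyExact_iff {x : Γ(X, relativeFrobenius p f ⁻¹ᵁ W)} (hx : IsChart f W x)
    (ω : Γ(Ω f, relativeFrobenius p f ⁻¹ᵁ W)) :
    ω ∈ secs (locallyExact p f) W ↔ hx.cartier ω = 0 := by
  obtain ⟨C, hC, -⟩ := existsUnique_isCartierOperator p f
  rw [hC.locallyExact_eq, mem_secs_kernel, hC.fromPush_eq hx]

end Subobjects

/-! ### Covariant derivatives and horizontal frames -/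

section Covariant

variable {X Y : Scheme.{u}} {p : ℕ} {f : X ⟶ Y} {M : X.Modules}

lemma tmul_zero {M N : X.Modules} {V : X.Opens} (m : Γ(M, V)) : tmul m (0 : Γ(N, V)) = 0 := by
  have h := tmul_add m (0 : Γ(N, V)) 0
  rwa [add_zero, left_eq_add] at h

lemma tmul_neg {M N : X.Modules} {V : X.Opens} (m : Γ(M, V)) (n : Γ(N, V)) :
    tmul m (-n) = -tmul m n := by
  rw [eq_neg_iff_add_eq_zero, ← tmul_add, neg_add_cancel, tmul_zero]

/-- The covariant derivative `∇_D`, on the sections over an open subset. -/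
noncomputable def Connection.along (nabla : Connection f M) {V₀ : X.Opens} (D : VectorField f V₀)
    {V : X.Opens} (h : V ≤ V₀) : Γ(M, V) →+ Γ(M, V) :=
  (restrictApp (contraction D M) h).toAddMonoidHom.comp (nabla.toHom.app (op V)).hom

lemma Connection.along_apply (nabla : Connection f M) {V₀ : X.Opens} (D : VectorField f V₀)
    {V : X.Opens} (h : V ≤ V₀) (m : Γ(M, V)) :
    nabla.along D h m = restrictApp (contraction D M) h (nabla.toHom.app (op V) m) := rfl

lemma Connection.along_smul (nabla : Connection f M) {V₀ : X.Opens} (D : VectorField f V₀)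
    {V : X.Opens} (h : V ≤ V₀) (a : Γ(X, V)) (m : Γ(M, V)) :
    nabla.along D h (a • m) = D.toDerivation h a • m + a • nabla.along D h m := by
  rw [along_apply, nabla.leibniz, map_add, restrictApp_contraction_tmul, map_smul]
  rfl

lemma Connection.along_res (nabla : Connection f M) {V₀ : X.Opens} (D : VectorField f V₀)
    {V V' : X.Opens} (h : V ≤ V₀) (h' : V' ≤ V) (m : Γ(M, V)) :
    nabla.along D (h'.trans h) (res M h' m) = res M h' (nabla.along D h m) := by
  rw [along_apply, along_apply, ← restrictApp_res, ← presheafHom_res]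

lemma Connection.covariantDerivative_eq (nabla : Connection f M) {V₀ : X.Opens}
    (D : VectorField f V₀) (W : (V₀ : Scheme.{u}).Opens) :
    nabla.covariantDerivative D W = nabla.along D (image_ι_le W) := by
  funext m
  exact (restrictApp_image (contraction D M) W _).symm

lemma VectorField.derivation_eq {V₀ : X.Opens} (D : VectorField f V₀)
    (W : (V₀ : Scheme.{u}).Opens) : D.derivation W = D.toDerivation (image_ι_le W) := by
  funext g
  exact congrArg sectionOfUnit (restrictApp_image D W _).symm

lemma exists_eq_image {V₀ V : X.Opens} (h : V ≤ V₀) :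
    ∃ W : (V₀ : Scheme.{u}).Opens, V = V₀.ι ''ᵁ W :=
  ⟨V₀.ι ⁻¹ᵁ V, le_antisymm (le_image_preimage h) (V₀.ι.image_preimage_le V)⟩

lemma VectorField.isPower_iff {V₀ : X.Opens} (D E : VectorField f V₀) :
    VectorField.IsPower p D E ↔
      ∀ (V : X.Opens) (h : V ≤ V₀) (g : Γ(X, V)),
        E.toDerivation h g = (D.toDerivation h)^[p] g := by
  constructor
  · intro hE V h g
    obtain ⟨W, rfl⟩ := exists_eq_image h
    rw [← D.derivation_eq W, ← hE W, E.derivation_eq]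
  · intro hE W
    rw [D.derivation_eq, E.derivation_eq]
    funext g
    exact hE _ _ g

lemma Connection.hasVanishingPCurvature_iff (nabla : Connection f M) :
    nabla.HasVanishingPCurvature p ↔
      ∀ (V₀ : X.Opens) (D E : VectorField f V₀), VectorField.IsPower p D E →
        ∀ (V : X.Opens) (h : V ≤ V₀) (m : Γ(M, V)),
          (nabla.along D h)^[p] m = nabla.along E h m := by
  constructor
  · intro H V₀ D E hE V h m
    obtain ⟨W, rfl⟩ := exists_eq_image h
    have := H V₀ D E hE W m
    rwa [sub_eq_zero, nabla.covariantDerivative_eq, nabla.covariantDerivative_eq] at this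
  · intro H V₀ D E hE W m
    rw [sub_eq_zero, nabla.covariantDerivative_eq, nabla.covariantDerivative_eq]
    exact H V₀ D E hE _ _ m

variable [hp : Fact p.Prime] [hY : IsOfChar Y p]

section Coordinate

/-- Over a chart, every section of `Ω ⊗ M` is `dx ⊗ n`, with `n` its contraction by `d/dx`. -/
theorem IsCoordinate.eq_tmul_contraction {W₀ : (twist p f).Opens}
    {x : Γ(X, relativeFrobenius p f ⁻¹ᵁ W₀)} (hx : IsCoordinate p f W₀ x)
    {D : VectorField f (relativeFrobenius p f ⁻¹ᵁ W₀)} (hD : D.toDerivation le_rfl x = 1)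
    {V : X.Opens} (h : V ≤ relativeFrobenius p f ⁻¹ᵁ W₀) (t : Γ(tensor (Ω f) M, V)) :
    t = tmul (res (Ω f) h (d f x)) (restrictApp (contraction D M) h t) := by
  refine eq_of_local _ fun u hu => ?_
  obtain ⟨V', h', hu', ht⟩ := exists_mem_span_tmul t u hu
  refine ⟨V', h', hu', ?_⟩
  rw [res_tmul, res_res, ← restrictApp_res]
  generalize res (tensor (Ω f) M) h' t = s at ht ⊢
  induction ht using AddSubgroup.closure_induction with
  | mem _ hq =>
    obtain ⟨⟨ω, m⟩, rfl⟩ := hq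
    obtain ⟨b, hb, -⟩ := hx.isFrame V' (h'.trans h) ω
    have h1 : formApp D (h'.trans h) (res (Ω f) (h'.trans h) (d f x)) = 1 := by
      rw [formApp_res D le_rfl, ← VectorField.toDerivation_apply, hD, map_one]
    show tmul ω m = tmul _ (restrictApp _ _ (tmul ω m))
    rw [restrictApp_contraction_tmul, hb, map_smul, h1, smul_eq_mul, mul_one, tmul_smul_eq,
      smul_tmul_eq]
  | zero => rw [map_zero, tmul_zero]
  | add a b _ _ ha hb => rw [map_add, tmul_add, ← ha, ← hb]
  | neg a _ ha => rw [map_neg, tmul_neg, ← ha]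

variable {W₀ : (twist p f).Opens} {x : Γ(X, relativeFrobenius p f ⁻¹ᵁ W₀)}
  {D : VectorField f (relativeFrobenius p f ⁻¹ᵁ W₀)}

lemma IsCoordinate.toHom_eq_zero_iff (hx : IsCoordinate p f W₀ x)
    (hD : D.toDerivation le_rfl x = 1) (nabla : Connection f M) {V : X.Opens}
    (h : V ≤ relativeFrobenius p f ⁻¹ᵁ W₀) (m : Γ(M, V)) :
    nabla.toHom.app (op V) m = 0 ↔ nabla.along D h m = 0 := by
  constructor
  · intro h0
    rw [Connection.along_apply, h0, map_zero]
  · intro h0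
    rw [hx.eq_tmul_contraction hD h (nabla.toHom.app (op V) m), ← Connection.along_apply, h0,
      tmul_zero]

/-- The vector field `d/dx` has vanishing `p`-th power, so that `(∇_{d/dx})^p = 0` if `∇` has
vanishing `p`-curvature. -/
theorem IsCoordinate.along_iterate_eq_zero (hx : IsCoordinate p f W₀ x)
    (hD : D.toDerivation le_rfl x = 1) {nabla : Connection f M}
    (hnabla : nabla.HasVanishingPCurvature p) {V : X.Opens}
    (h : V ≤ relativeFrobenius p f ⁻¹ᵁ W₀) (m : Γ(M, V)) : (nabla.along D h)^[p] m = 0 := by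
  have hform : ∀ (V : X.Opens) (h : V ≤ relativeFrobenius p f ⁻¹ᵁ W₀) (ω : Γ(Ω f, V)),
      formApp (0 : VectorField f (relativeFrobenius p f ⁻¹ᵁ W₀)) h ω = 0 :=
    fun V h ω => map_zero (rs (le_image_preimage h))
  have h0 : VectorField.IsPower p D 0 := by
    rw [VectorField.isPower_iff]
    intro V h g
    obtain ⟨W, rfl⟩ := exists_eq_preimage p f V
    have hW := (preimage_le_preimage_iff p f).mp h
    rw [(VectorField.isPartialDerivative p hD hW).iterate_eq_zero (hx W hW)]
    exact hform _ h _
  rw [(nabla.hasVanishingPCurvature_iff.mp hnabla) _ D 0 h0 V h m, Connection.along_apply,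
    hx.eq_tmul_contraction hD h (nabla.toHom.app (op V) m), restrictApp_contraction_tmul, hform,
    zero_smul]

end Coordinate

/-- Functions that generate the unit ideal have no common zero. -/
lemma exists_mem_basicOpen_of_span_eq_top {V : X.Opens} {S : Set Γ(X, V)} (hS : Ideal.span S = ⊤)
    {u : X} (hu : u ∈ V) : ∃ b ∈ S, u ∈ X.basicOpen b := by
  by_contra! hb
  have h1 : Ideal.span S ≤ (IsLocalRing.maximalIdeal (X.presheaf.stalk u)).comap
      (X.presheaf.germ V u hu).hom := by
    rw [Ideal.span_le]
    intro b hbS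
    rw [SetLike.mem_coe, Ideal.mem_comap, IsLocalRing.mem_maximalIdeal, mem_nonunits_iff]
    intro h
    exact hb b hbS ((X.mem_basicOpen b u hu).mpr h)
  rw [hS] at h1
  have h2 := h1 (Submodule.mem_top (x := (1 : Γ(X, V))))
  rw [Ideal.mem_comap, map_one] at h2
  exact (Ideal.ne_top_iff_one _).mp (IsLocalRing.maximalIdeal.isMaximal _).ne_top h2

lemma IsFrame.smul {V : X.Opens} {e : Γ(M, V)} (he : IsFrame M e) {b : Γ(X, V)}
    (hb : IsUnit b) : IsFrame M (b • e) := by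
  intro W h m
  obtain ⟨c, hc, huniq⟩ := he W h m
  have hb' : IsUnit (rs h b) := hb.map (rs h)
  obtain ⟨v, hv⟩ := hb'.exists_right_inv
  refine ⟨c * v, ?_, fun c' hc' => ?_⟩
  · show m = _
    rw [res_smul_rs, smul_smul, mul_assoc, mul_comm v, hv, mul_one]
    exact hc
  · have h1 : c' * rs h b = c := by
      refine huniq _ ?_
      show m = _
      rw [mul_smul, ← res_smul_rs]
      exact hc'
    rw [← h1, mul_assoc, hv, mul_one]

variable [SmoothOfRelativeDimension 1 f]

/-- Cartier's theorem: a connection on `Ω` with vanishing `p`-curvature has local horizontal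
frames. -/
theorem Connection.exists_horizontal_isFrame {nabla : Connection f (Ω f)}
    (hnabla : nabla.HasVanishingPCurvature p) {W : (twist p f).Opens} {y : twist p f} (hy : y ∈ W) :
    ∃ (W' : (twist p f).Opens) (_ : W' ≤ W) (_ : y ∈ W')
      (e : Γ(Ω f, relativeFrobenius p f ⁻¹ᵁ W')),
      IsFrame (Ω f) e ∧ nabla.toHom.app (op _) e = 0 := by
  obtain ⟨W₀, h₀, hy₀, x, hx⟩ := exists_isChart_le (f := f) hy
  obtain ⟨D, hD⟩ := hx.1.exists_vectorField
  have := IsOfChar.of_hom f p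
  have h1 := mem_span_horizontal (IsOfChar.section_eq_zero X p _) (D.toDerivation le_rfl) hD
    (nabla.along D le_rfl) (nabla.along_smul D le_rfl) p le_rfl (d f x)
    (hx.1.along_iterate_eq_zero hD hnabla le_rfl _)
  -- the coefficients `b` of the horizontal `b dx` generate the unit ideal, so that one of them is
  -- invertible at `y`
  let S : Set Γ(X, relativeFrobenius p f ⁻¹ᵁ W₀) := {b | nabla.along D le_rfl (b • d f x) = 0}
  have h2 : Submodule.span Γ(X, relativeFrobenius p f ⁻¹ᵁ W₀)
      {k | nabla.along D le_rfl k = 0} ≤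
        Submodule.map (LinearMap.toSpanSingleton Γ(X, relativeFrobenius p f ⁻¹ᵁ W₀) _ (d f x))
          (Ideal.span S) := by
    rw [Submodule.span_le]
    intro k hk
    obtain ⟨b, rfl⟩ := hx.1.isFrame.exists_eq_smul k
    exact ⟨b, Ideal.subset_span hk, rfl⟩
  obtain ⟨b, hb, hbx⟩ := h2 h1
  have hb1 : b = 1 := hx.1.isFrame.eq_of_smul_eq (hbx.trans (one_smul _ _).symm)
  rw [hb1] at hb
  have hS : Ideal.span S = ⊤ := (Ideal.eq_top_iff_one _).mpr hb
  obtain ⟨u, rfl⟩ := relativeFrobenius_surjective p f y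
  obtain ⟨b, hbS, hub⟩ := exists_mem_basicOpen_of_span_eq_top hS (u := u) hy₀
  obtain ⟨W', hW'⟩ := exists_eq_preimage p f (X.basicOpen b)
  have h3 : W' ≤ W₀ := by
    rw [← preimage_le_preimage_iff p f, ← hW']
    exact X.basicOpen_le b
  have h4 := (relativeFrobenius p f).preimage_mono h3
  refine ⟨W', h3.trans h₀, show u ∈ relativeFrobenius p f ⁻¹ᵁ W' from hW' ▸ hub,
    res (Ω f) h4 (b • d f x), ?_, ?_⟩
  · rw [res_smul_rs]
    refine (hx.1.isFrame.mono h4).smul ?_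
    have key : ∀ (V' : X.Opens) (e : V' = X.basicOpen b) (h : V' ≤ _), IsUnit (rs h b) := by
      rintro _ rfl h
      exact RingedSpace.isUnit_res_basicOpen _ b
    exact key _ hW'.symm h4
  · rw [presheafHom_res, (hx.1.toHom_eq_zero_iff hD nabla le_rfl _).mpr hbS, map_zero]

end Covariant

/-! ### Connections and local generators of their horizontal sections -/

section Generators

variable {X Y : Scheme.{u}} {p : ℕ} [hp : Fact p.Prime] {f : X ⟶ Y} [hY : IsOfChar Y p]
  {M : X.Modules}

/-- The section `e` of `M` over `F⁻¹ W` generates the subobject `L` of `F_* M`: it is a frame of `M`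
over `O_X`, and `L` consists of the `O_{X^(1)}`-multiples of `e`. -/
def IsGenerator (L : Subobject ((Scheme.Modules.pushforward (relativeFrobenius p f)).obj M))
    {W : (twist p f).Opens} (e : Γ(M, relativeFrobenius p f ⁻¹ᵁ W)) : Prop :=
  IsFrame M e ∧ ∀ (W' : (twist p f).Opens) (h : W' ≤ W) (m : Γ(M, relativeFrobenius p f ⁻¹ᵁ W')),
    m ∈ secs L W' ↔ ∃ c : Γ(twist p f, W'),
      m = fr p f W' c • res M ((relativeFrobenius p f).preimage_mono h) e

/-- The subobject `L` has generators locally on `X^(1)`. -/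
def HasLocalGenerators
    (L : Subobject ((Scheme.Modules.pushforward (relativeFrobenius p f)).obj M)) : Prop :=
  ∀ y : twist p f, ∃ (W : (twist p f).Opens) (_ : y ∈ W)
    (e : Γ(M, relativeFrobenius p f ⁻¹ᵁ W)), IsGenerator L e

variable {L : Subobject ((Scheme.Modules.pushforward (relativeFrobenius p f)).obj M)}
  {W : (twist p f).Opens} {e : Γ(M, relativeFrobenius p f ⁻¹ᵁ W)}

lemma IsGenerator.mono (he : IsGenerator L e) {W' : (twist p f).Opens} (h : W' ≤ W) :
    IsGenerator L (res M ((relativeFrobenius p f).preimage_mono h) e) := by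
  refine ⟨he.1.mono _, fun W'' h' m => ?_⟩
  rw [res_res]
  exact he.2 W'' (h'.trans h) m

lemma IsGenerator.mem_secs (he : IsGenerator L e) : e ∈ secs L W :=
  (he.2 W le_rfl e).mpr ⟨1, by rw [map_one, one_smul, res_self]⟩

lemma IsGenerator.mem_secs_iff (he : IsGenerator L e) (m : Γ(M, relativeFrobenius p f ⁻¹ᵁ W)) :
    m ∈ secs L W ↔ ∃ c : Γ(twist p f, W), m = fr p f W c • e := by
  rw [he.2 W le_rfl m, res_self]

lemma HasLocalGenerators.exists_le (hL : HasLocalGenerators L) {y : twist p f} (hy : y ∈ W) :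
    ∃ (W' : (twist p f).Opens) (_ : W' ≤ W) (_ : y ∈ W')
      (e : Γ(M, relativeFrobenius p f ⁻¹ᵁ W')), IsGenerator L e := by
  obtain ⟨W₁, hy₁, e, he⟩ := hL y
  exact ⟨W ⊓ W₁, inf_le_left, ⟨hy, hy₁⟩, _, he.mono inf_le_right⟩

/-- Every section is locally a multiple of a generator. -/
lemma HasLocalGenerators.exists_eq_smul (hL : HasLocalGenerators L) {V : X.Opens} (m : Γ(M, V)) :
    ∀ u ∈ V, ∃ (W : (twist p f).Opens) (h : relativeFrobenius p f ⁻¹ᵁ W ≤ V)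
      (_ : u ∈ relativeFrobenius p f ⁻¹ᵁ W) (e : Γ(M, relativeFrobenius p f ⁻¹ᵁ W))
      (_ : IsGenerator L e) (b : Γ(X, relativeFrobenius p f ⁻¹ᵁ W)), res M h m = b • e := by
  intro u hu
  obtain ⟨W₁, rfl⟩ := exists_eq_preimage p f V
  obtain ⟨W, h, hy, e, he⟩ := hL.exists_le (W := W₁) (y := relativeFrobenius p f u) hu
  obtain ⟨b, hb⟩ := he.1.exists_eq_smul (res M ((relativeFrobenius p f).preimage_mono h) m)
  exact ⟨W, _, hy, e, he, b, hb⟩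

lemma IsPartialDerivative.eq_zero_iff {W₀ : (twist p f).Opens}
    {x : Γ(X, relativeFrobenius p f ⁻¹ᵁ W₀)} (hx : IsCoordinate p f W₀ x)
    {D : VectorField f (relativeFrobenius p f ⁻¹ᵁ W₀)} (hD : D.toDerivation le_rfl x = 1)
    (h : W ≤ W₀) (b : Γ(X, relativeFrobenius p f ⁻¹ᵁ W)) :
    D.toDerivation ((relativeFrobenius p f).preimage_mono h) b = 0 ↔ ∃ c, b = fr p f W c := by
  have hpd := VectorField.isPartialDerivative p hD h
  refine ⟨fun h0 => hpd.exists_eq_of_eq_zero (hx W h) (IsOfChar.section_eq_zero _ p W) h0, ?_⟩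
  rintro ⟨c, rfl⟩
  exact hpd.map_F c

/-- The horizontal multiples of a horizontal frame. -/
lemma Connection.toHom_smul_eq_zero_iff {W₀ : (twist p f).Opens}
    {x : Γ(X, relativeFrobenius p f ⁻¹ᵁ W₀)} (hx : IsCoordinate p f W₀ x) (nabla : Connection f M)
    (h : W ≤ W₀) (he : IsFrame M e) (he0 : nabla.toHom.app (op _) e = 0)
    (b : Γ(X, relativeFrobenius p f ⁻¹ᵁ W)) :
    nabla.toHom.app (op _) (b • e) = 0 ↔ ∃ c, b = fr p f W c := by
  obtain ⟨D, hD⟩ := hx.exists_vectorField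
  have h' := (relativeFrobenius p f).preimage_mono h
  rw [hx.toHom_eq_zero_iff hD nabla h'] at he0 ⊢
  rw [nabla.along_smul, he0, smul_zero, add_zero, ← IsPartialDerivative.eq_zero_iff hx hD h]
  refine ⟨fun h0 => he.eq_of_smul_eq (h0.trans (zero_smul _ _).symm), fun h0 => ?_⟩
  rw [h0, zero_smul]

lemma Connection.ext_toHom {nabla nabla' : Connection f M} (h : nabla.toHom = nabla'.toHom) :
    nabla = nabla' := by
  cases nabla
  cases nabla'
  congr

variable [SmoothOfRelativeDimension 1 f]

/-- The horizontal sections of a connection on `Ω` with vanishing `p`-curvature. -/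
theorem Connection.hasLocalGenerators_horizontal {nabla : Connection f (Ω f)}
    (hnabla : nabla.HasVanishingPCurvature p) : HasLocalGenerators (horizontal p nabla) := by
  intro y
  obtain ⟨W₀, hy₀, x, hx⟩ := exists_isChart (f := f) y
  obtain ⟨W, h, hy, e, he, he0⟩ := Connection.exists_horizontal_isFrame hnabla hy₀
  refine ⟨W, hy, e, he, fun W' h' m => ?_⟩
  have h1 := (relativeFrobenius p f).preimage_mono h'
  have he' := he.mono h1
  obtain ⟨b, rfl⟩ := he'.exists_eq_smul m
  rw [mem_secs_horizontal, nabla.toHom_smul_eq_zero_iff hx.1 (h'.trans h) he'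
    (by rw [presheafHom_res, he0, map_zero])]
  constructor
  · rintro ⟨c, rfl⟩
    exact ⟨c, rfl⟩
  · rintro ⟨c, hc⟩
    exact ⟨c, he'.eq_of_smul_eq hc⟩

/-- A connection with vanishing `p`-curvature is determined by its horizontal sections. -/
theorem Connection.eq_of_horizontal_eq {nabla nabla' : Connection f (Ω f)}
    (hnabla : nabla.HasVanishingPCurvature p) (h : horizontal p nabla = horizontal p nabla') :
    nabla = nabla' := by
  refine Connection.ext_toHom ?_
  ext V ω
  refine eq_of_local _ fun u hu => ?_
  obtain ⟨W, hW, hu', e, he, b, hb⟩ :=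
    (Connection.hasLocalGenerators_horizontal hnabla).exists_eq_smul (V := V) ω u hu
  refine ⟨_, hW, hu', ?_⟩
  have h1 := he.mem_secs
  have h2 := he.mem_secs
  rw [mem_secs_horizontal] at h1
  rw [h, mem_secs_horizontal] at h2
  refine (presheafHom_res nabla.toHom hW ω).symm.trans
    (Eq.trans ?_ (presheafHom_res nabla'.toHom hW ω))
  rw [hb, nabla.leibniz, nabla'.leibniz, h1, h2]

end Generators

section ConnectionOfGenerators

variable {X Y : Scheme.{u}} {p : ℕ} [hp : Fact p.Prime] {f : X ⟶ Y} [hY : IsOfChar Y p]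
  {M : X.Modules} {L : Subobject ((Scheme.Modules.pushforward (relativeFrobenius p f)).obj M)}

/-- Two generators differ by a function on `X^(1)`. -/
lemma IsGenerator.exists_smul_eq {W₁ W₂ : (twist p f).Opens}
    {e₁ : Γ(M, relativeFrobenius p f ⁻¹ᵁ W₁)} {e₂ : Γ(M, relativeFrobenius p f ⁻¹ᵁ W₂)}
    (he₁ : IsGenerator L e₁) (he₂ : IsGenerator L e₂) :
    ∃ c : Γ(twist p f, W₁ ⊓ W₂),
      res M ((relativeFrobenius p f).preimage_mono inf_le_left) e₁ =
        fr p f _ c • res M ((relativeFrobenius p f).preimage_mono inf_le_right) e₂ :=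
  (he₂.2 (W₁ ⊓ W₂) inf_le_right _).mp (he₁.mono inf_le_left).mem_secs

/-- The canonical connection on a module with local generators, for which the generators are
horizontal: it sends `b e` to `db ⊗ e`. -/
theorem HasLocalGenerators.exists_connection (hL : HasLocalGenerators L) :
    ∃ nabla : Connection f M, ∀ (W : (twist p f).Opens) (e : Γ(M, relativeFrobenius p f ⁻¹ᵁ W)),
      IsGenerator L e → nabla.toHom.app (op _) e = 0 := by
  let R : ∀ V : X.Opens, Γ(M, V) → Γ(tensor (Ω f) M, V) → Prop := fun V m t =>
    ∃ (W : (twist p f).Opens) (h : V ≤ relativeFrobenius p f ⁻¹ᵁ W)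
      (e : Γ(M, relativeFrobenius p f ⁻¹ᵁ W)) (_ : IsGenerator L e) (b : Γ(X, V)),
      m = b • res M h e ∧ t = tmul (d f b) (res M h e)
  have hind : ∀ (V : X.Opens) (m : Γ(M, V)) (t : Γ(tensor (Ω f) M, V)), R V m t →
      ∀ (W : (twist p f).Opens) (h : V ≤ relativeFrobenius p f ⁻¹ᵁ W)
        (e : Γ(M, relativeFrobenius p f ⁻¹ᵁ W)) (_ : IsGenerator L e), ∃ b : Γ(X, V),
        m = b • res M h e ∧ t = tmul (d f b) (res M h e) := by
    rintro V _ _ ⟨W₁, h₁, e₁, he₁, b, rfl, rfl⟩ W₂ h₂ e₂ he₂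
    obtain ⟨c, hc⟩ := he₁.exists_smul_eq he₂
    have h : V ≤ relativeFrobenius p f ⁻¹ᵁ (W₁ ⊓ W₂) := le_inf h₁ h₂
    have hc' := congrArg (res M h) hc
    rw [res_smul_rs, res_res, res_res] at hc'
    have hd : d f (rs h (fr p f _ c)) = 0 := by rw [d_rs, d_fr, map_zero]
    refine ⟨b * rs h (fr p f _ c), ?_, ?_⟩
    · rw [hc', smul_smul]
    · rw [hc', d_mul, hd, smul_zero, zero_add, tmul_smul_eq, smul_tmul_eq]
  have hfun : ∀ (V : X.Opens) (m : Γ(M, V)) (t t' : Γ(tensor (Ω f) M, V)), R V m t → R V m t' →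
      t = t' := by
    rintro V _ _ t' ⟨W, h, e, he, b, rfl, rfl⟩ h'
    obtain ⟨b', hb', rfl⟩ := hind V _ _ h' W h e he
    rw [(he.1.mono h).eq_of_smul_eq hb']
  have hloc : ∀ (V : X.Opens) (m : Γ(M, V)), ∀ u ∈ V, ∃ (V' : X.Opens) (h : V' ≤ V), u ∈ V' ∧
      ∃ t, R V' (res M h m) t := by
    intro V m u hu
    obtain ⟨W, h, hu', e, he, b, hb⟩ := hL.exists_eq_smul m u hu
    exact ⟨_, h, hu', _, W, le_rfl, e, he, b, by rw [res_self, hb], rfl⟩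
  obtain ⟨φ, hφ⟩ := exists_presheafHom_of_relation M (tensor (Ω f) M) R
    (by
      rintro V V' h m _ ⟨W, h', e, he, b, rfl, rfl⟩
      exact ⟨W, h.trans h', e, he, rs h b, by rw [res_smul_rs, res_res],
        by rw [res_tmul, ← d_rs, res_res]⟩)
    (by
      rintro V m m' _ t' ⟨W, h, e, he, b, rfl, rfl⟩ h' u hu
      obtain ⟨b', rfl, rfl⟩ := hind V _ _ h' W h e he
      refine ⟨V, le_rfl, hu, W, h, e, he, b + b', ?_, ?_⟩
      · rw [res_self, add_smul]
      · rw [res_self, d_add, add_tmul])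
    hfun hloc
  have hφ' : ∀ (V : X.Opens) (a : Γ(X, V)) (m : Γ(M, V)),
      φ.app (op V) (a • m) = tmul (d f a) m + a • φ.app (op V) m := by
    intro V a m
    refine eq_of_local _ fun u hu => ?_
    obtain ⟨V', h, hu', t, W, h', e, he, b, hb, rfl⟩ := hloc V m u hu
    refine ⟨V', h, hu', ?_⟩
    rw [map_add, ← presheafHom_res, res_smul_rs, res_smul_rs, ← presheafHom_res, res_tmul, ← d_rs,
      hφ V' _ _ ⟨W, h', e, he, b, hb, rfl⟩, hb, smul_smul,
      hφ V' _ _ ⟨W, h', e, he, rs h a * b, rfl, rfl⟩, d_mul, add_tmul, smul_tmul_eq, smul_tmul_eq,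
      tmul_smul_eq, add_comm]
  refine ⟨⟨φ, hφ', fun W V h c m => ?_⟩, fun W e he => ?_⟩
  · rw [hφ', d_appLE, zero_tmul, zero_add]
  · refine hφ _ _ _ ⟨W, le_rfl, e, he, 1, by rw [res_self, one_smul], ?_⟩
    rw [d_one, zero_tmul]

/-- A connection with local horizontal frames has vanishing `p`-curvature: in such a frame,
`∇_D` is the derivation `D` of the coefficient. -/
theorem HasLocalGenerators.hasVanishingPCurvature (hL : HasLocalGenerators L)
    {nabla : Connection f M} (hnabla : ∀ (W : (twist p f).Opens)
      (e : Γ(M, relativeFrobenius p f ⁻¹ᵁ W)), IsGenerator L e → nabla.toHom.app (op _) e = 0) :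
    nabla.HasVanishingPCurvature p := by
  rw [Connection.hasVanishingPCurvature_iff]
  intro V₀ D E hE V h m
  rw [VectorField.isPower_iff] at hE
  have hres : ∀ (V' : X.Opens) (h' : V' ≤ V) (n : ℕ) (m : Γ(M, V)),
      res M h' ((nabla.along D h)^[n] m) = (nabla.along D (h'.trans h))^[n] (res M h' m) := by
    intro V' h' n m
    induction n generalizing m with
    | zero => rfl
    | succ n ih => rw [Function.iterate_succ_apply, Function.iterate_succ_apply, ih,
        nabla.along_res]
  refine eq_of_local _ fun u hu => ?_
  obtain ⟨W, h', hu', e, he, b, hb⟩ := hL.exists_eq_smul m u hu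
  refine ⟨_, h', hu', ?_⟩
  rw [hres, ← nabla.along_res, hb]
  have key : ∀ (D : VectorField f V₀) (b : Γ(X, relativeFrobenius p f ⁻¹ᵁ W)),
      nabla.along D (h'.trans h) (b • e) = D.toDerivation (h'.trans h) b • e := by
    intro D b
    rw [nabla.along_smul, nabla.along_apply D _ e, hnabla W e he, map_zero, smul_zero, add_zero]
  have key' : ∀ (n : ℕ) (b : Γ(X, relativeFrobenius p f ⁻¹ᵁ W)),
      (nabla.along D (h'.trans h))^[n] (b • e) = (D.toDerivation (h'.trans h))^[n] b • e := by
    intro n b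
    induction n generalizing b with
    | zero => rfl
    | succ n ih => rw [Function.iterate_succ_apply, Function.iterate_succ_apply, key, ih]
  rw [key', key, hE]

variable [SmoothOfRelativeDimension 1 f]

/-- A connection for which the generators of `L` are horizontal has no horizontal sections besides
those of `L`. -/
theorem HasLocalGenerators.horizontal_eq (hL : HasLocalGenerators L)
    {nabla : Connection f M} (hnabla : ∀ (W : (twist p f).Opens)
      (e : Γ(M, relativeFrobenius p f ⁻¹ᵁ W)), IsGenerator L e → nabla.toHom.app (op _) e = 0) :
    horizontal p nabla = L := by
  refine eq_of_secs_eq fun W => ?_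
  have key : ∀ (W : (twist p f).Opens) (y : twist p f) (_ : y ∈ W), ∃ (W' : (twist p f).Opens)
      (_ : W' ≤ W), y ∈ W' ∧ secs (horizontal p nabla) W' = secs L W' := by
    intro W y hy
    obtain ⟨W₀, h₀, hy₀, x, hx⟩ := exists_isChart_le (f := f) hy
    obtain ⟨W', h, hy', e, he⟩ := hL.exists_le hy₀
    refine ⟨W', h.trans h₀, hy', ?_⟩
    ext m
    rw [mem_secs_horizontal, he.mem_secs_iff]
    obtain ⟨b, rfl⟩ := he.1.exists_eq_smul m
    rw [nabla.toHom_smul_eq_zero_iff hx.1 h he.1 (hnabla _ _ he)]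
    constructor
    · rintro ⟨c, rfl⟩
      exact ⟨c, rfl⟩
    · rintro ⟨c, hc⟩
      exact ⟨c, he.1.eq_of_smul_eq hc⟩
  ext m
  constructor <;>
  · intro hm
    refine mem_secs_of_local fun y hy => ?_
    obtain ⟨W', h, hy', heq⟩ := key W y hy
    refine ⟨W', h, hy', ?_⟩
    first | rw [← heq] | rw [heq]
    exact res_mem_secs h hm

end ConnectionOfGenerators

/-! ### Free modules and split cokernels -/

section RestrictHom

variable {X : Scheme.{u}} {M N K : X.Modules} {V : X.Opens}

lemma restrictHom_ext {φ ψ : M.restrict V.ι ⟶ N.restrict V.ι}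
    (h : ∀ (W : X.Opens) (h : W ≤ V) (m : Γ(M, W)), restrictApp φ h m = restrictApp ψ h m) :
    φ = ψ := by
  refine hom_ext_sections fun W m => ?_
  exact (restrictApp_image φ W m).symm.trans ((h _ (image_ι_le W) m).trans
    (restrictApp_image ψ W m))

lemma restrictApp_comp (φ : M.restrict V.ι ⟶ N.restrict V.ι) (ψ : N.restrict V.ι ⟶ K.restrict V.ι)
    {W : X.Opens} (h : W ≤ V) (m : Γ(M, W)) :
    restrictApp (φ ≫ ψ) h m = restrictApp ψ h (restrictApp φ h m) := by
  obtain ⟨W, rfl⟩ := exists_eq_image h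
  rw [restrictApp_image, restrictApp_image, restrictApp_image]
  rfl

lemma restrictApp_id {W : X.Opens} (h : W ≤ V) (m : Γ(M, W)) :
    restrictApp (𝟙 (M.restrict V.ι)) h m = m := by
  obtain ⟨W, rfl⟩ := exists_eq_image h
  rw [restrictApp_image]
  rfl

lemma restrictApp_add (φ ψ : M.restrict V.ι ⟶ N.restrict V.ι) {W : X.Opens} (h : W ≤ V)
    (m : Γ(M, W)) : restrictApp (φ + ψ) h m = restrictApp φ h m + restrictApp ψ h m := by
  obtain ⟨W, rfl⟩ := exists_eq_image h
  rw [restrictApp_image, restrictApp_image, restrictApp_image]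
  rfl

lemma restrictApp_zero {W : X.Opens} (h : W ≤ V) (m : Γ(M, W)) :
    restrictApp (0 : M.restrict V.ι ⟶ N.restrict V.ι) h m = 0 := by
  obtain ⟨W, rfl⟩ := exists_eq_image h
  rw [restrictApp_image]
  rfl

lemma restrictApp_sum {I : Type*} (s : Finset I) (φ : I → (M.restrict V.ι ⟶ N.restrict V.ι))
    {W : X.Opens} (h : W ≤ V) (m : Γ(M, W)) :
    restrictApp (∑ i ∈ s, φ i) h m = ∑ i ∈ s, restrictApp (φ i) h m :=
  map_sum (AddMonoidHom.mk' (fun φ : M.restrict V.ι ⟶ N.restrict V.ι => restrictApp φ h m)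
    (fun φ ψ => restrictApp_add φ ψ h m)) φ s

lemma restrictApp_map (φ : M ⟶ N) {W : X.Opens} (h : W ≤ V) (m : Γ(M, W)) :
    restrictApp ((Scheme.Modules.restrictFunctor V.ι).map φ) h m = φ.app W m := by
  obtain ⟨W, rfl⟩ := exists_eq_image h
  rw [restrictApp_image]
  rfl

/-- The linear map `b ↦ b m` to the sections of a module. -/
noncomputable def smulSection {W : X.Opens} (m : Γ(M, W)) : Γ(𝒪 X, W) →ₗ[Γ(X, W)] Γ(M, W) :=
  (LinearMap.toSpanSingleton Γ(X, W) Γ(M, W) m).comp sectionOfUnit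

/-- The morphism `O_V → M|_V` given by a section over `V`. -/
noncomputable def homOfSection (e : Γ(M, V)) : (𝒪 X).restrict V.ι ⟶ M.restrict V.ι :=
  restrictHomOfSections (fun _ h => smulSection (res M h e))
    (fun W W' h h' m => by
      refine Eq.trans ?_ (res_smul_rs M h' (sectionOfUnit m) (res M h e)).symm
      rw [res_res]
      rfl)

lemma restrictApp_homOfSection (e : Γ(M, V)) {W : X.Opens} (h : W ≤ V) (b : Γ(𝒪 X, W)) :
    restrictApp (homOfSection e) h b = sectionOfUnit b • res M h e :=
  restrictApp_restrictHomOfSections _ _ h _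

/-- The restriction of the structure sheaf. -/
noncomputable def restrictUnit (V : X.Opens) : (𝒪 X).restrict V.ι ≅ 𝒪 (V : Scheme.{u}) :=
  Scheme.Modules.restrictUnitIso V.ι

lemma IsFrame.nonempty_iso {e : Γ(M, V)} (he : IsFrame M e) :
    Nonempty (M.restrict V.ι ≅ 𝒪 (V : Scheme.{u})) := by
  have : IsIso (homOfSection e) := by
    rw [Scheme.Modules.Hom.isIso_iff_isIso_app]
    intro W
    rw [ConcreteCategory.isIso_iff_bijective]
    constructor
    · intro b b' h
      have h1 : ∀ b, (homOfSection e).app W b =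
          (sectionOfUnit (show Γ(𝒪 X, V.ι ''ᵁ W) from b) • res M (image_ι_le W) e :
            Γ(M, V.ι ''ᵁ W)) := fun b =>
        (restrictApp_image (homOfSection e) W b).symm.trans
          (restrictApp_homOfSection e (image_ι_le W) b)
      exact (he.mono (image_ι_le W)).eq_of_smul_eq ((h1 b).symm.trans (h.trans (h1 b')))
    · intro m
      obtain ⟨b, hb⟩ := (he.mono (image_ι_le W)).exists_eq_smul m
      exact ⟨b, ((restrictApp_image (homOfSection e) W b).symm.trans
        (restrictApp_homOfSection e (image_ι_le W) b)).trans hb.symm⟩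
  exact ⟨(asIso (homOfSection e)).symm ≪≫ restrictUnit V⟩

lemma exists_isFrame_of_iso (ψ : M.restrict V.ι ≅ 𝒪 (V : Scheme.{u})) :
    ∃ e : Γ(M, V), IsFrame M e := by
  let θ : (𝒪 X).restrict V.ι ≅ M.restrict V.ι := restrictUnit V ≪≫ ψ.symm
  refine ⟨restrictApp θ.hom le_rfl (show Γ(𝒪 X, V) from (1 : Γ(X, V))), fun W h m => ?_⟩
  have h1 : ∀ b : Γ(X, W), restrictApp θ.hom h (show Γ(𝒪 X, W) from b) =
      b • res M h (restrictApp θ.hom le_rfl (show Γ(𝒪 X, V) from (1 : Γ(X, V)))) := by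
    intro b
    rw [← restrictApp_res, ← map_smul]
    congr 1
    show b = b * rs h 1
    rw [map_one, mul_one]
  refine ⟨restrictApp θ.inv h m, ?_, fun b hb => ?_⟩
  · show m = _
    refine Eq.trans ?_ (h1 _)
    refine Eq.trans ?_ (restrictApp_comp θ.inv θ.hom h m)
    rw [θ.inv_hom_id, restrictApp_id]
  · have h2 : m = _ := hb.trans (h1 b).symm
    rw [h2]
    refine Eq.trans ?_ (restrictApp_comp θ.hom θ.inv h _)
    rw [θ.hom_inv_id, restrictApp_id]

end RestrictHom

section Cokernel

/-- If `B = i(L) ⊕ ⨁ a_k(O)`, with projections `q_k` to the free part, then the cokernel of `i` is a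
coproduct of copies of `O`. -/
theorem nonempty_cokernel_iso {A : Type*} [Category* A] [Abelian A] {I : Type*} [Fintype I]
    [DecidableEq I] {L B O P : A} (ι : I → (O ⟶ P))
    (hdesc : ∀ {N : A} (g : I → (O ⟶ N)), ∃ h : P ⟶ N, ∀ k, ι k ≫ h = g k)
    (hext : ∀ {N : A} (h h' : P ⟶ N), (∀ k, ι k ≫ h = ι k ≫ h') → h = h')
    (i : L ⟶ B) (r : B ⟶ L) (a : I → (O ⟶ B)) (q : I → (B ⟶ O)) (hiq : ∀ k, i ≫ q k = 0)
    (haq : ∀ k l, a k ≫ q l = if k = l then 𝟙 O else 0)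
    (hsum : r ≫ i + ∑ k, q k ≫ a k = 𝟙 B) : Nonempty (cokernel i ≅ P) := by
  obtain ⟨h, hh⟩ := hdesc fun k => a k ≫ cokernel.π i
  refine ⟨⟨cokernel.desc i (∑ k, q k ≫ ι k) ?_, h, ?_, ?_⟩⟩
  · rw [Preadditive.comp_sum]
    exact Finset.sum_eq_zero fun k _ => by rw [← Category.assoc, hiq, zero_comp]
  · rw [← cancel_epi (cokernel.π i), cokernel.π_desc_assoc, Preadditive.sum_comp, Category.comp_id]
    have h1 := congrArg (· ≫ cokernel.π i) hsum
    simp only [Preadditive.add_comp, Category.assoc, cokernel.condition, comp_zero, zero_add,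
      Preadditive.sum_comp, Category.id_comp] at h1
    simp only [Category.assoc, hh, h1]
  · refine hext _ _ fun k => ?_
    rw [reassoc_of% hh, cokernel.π_desc, Category.comp_id, Preadditive.comp_sum,
      Finset.sum_eq_single k]
    · rw [← Category.assoc, haq, if_pos rfl, Category.id_comp]
    · intro l _ hl
      rw [← Category.assoc, haq, if_neg hl.symm, zero_comp]
    · simp

/-- The free module on a set. -/
noncomputable def freeModule (Z : Scheme.{u}) (I : Type u) : Z.Modules :=
  SheafOfModules.free (R := Z.ringCatSheaf) I

/-- The universal property of the free module. -/
theorem exists_ιFree (Z : Scheme.{u}) (I : Type u) :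
    ∃ ι : I → (𝒪 Z ⟶ freeModule Z I),
      (∀ {N : Z.Modules} (g : I → (𝒪 Z ⟶ N)), ∃ h, ∀ k, ι k ≫ h = g k) ∧
      ∀ {N : Z.Modules} (h h' : freeModule Z I ⟶ N),
        (∀ k, ι k ≫ h = ι k ≫ h') → h = h' := by
  refine ⟨fun i => SheafOfModules.ιFree i, fun {N} g => ?_, fun {N} h h' hk => ?_⟩
  · exact ⟨Cofan.IsColimit.desc (SheafOfModules.isColimitFreeCofan I) g,
      fun k => Cofan.IsColimit.fac (SheafOfModules.isColimitFreeCofan I) g k⟩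
  · exact Cofan.IsColimit.hom_ext (SheafOfModules.isColimitFreeCofan I) _ _ hk

/-- The local criterion for a cokernel to be a vector bundle. -/
theorem nonempty_cokernel_restrict_iso {Z : Scheme.{u}} {L B : Z.Modules} {V : Z.Opens} (n : ℕ)
    (i : L ⟶ B) (r : B.restrict V.ι ⟶ L.restrict V.ι)
    (a : Fin n → ((𝒪 Z).restrict V.ι ⟶ B.restrict V.ι))
    (q : Fin n → (B.restrict V.ι ⟶ (𝒪 Z).restrict V.ι))
    (hiq : ∀ k, (Scheme.Modules.restrictFunctor V.ι).map i ≫ q k = 0)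
    (haq : ∀ k l, a k ≫ q l = if k = l then 𝟙 _ else 0)
    (hsum : r ≫ (Scheme.Modules.restrictFunctor V.ι).map i + ∑ k, q k ≫ a k = 𝟙 _) :
    Nonempty ((cokernel i).restrict V.ι ≅
      freeModule (V : Scheme.{u}) (ULift.{u} (Fin n))) := by
  obtain ⟨ι, hdesc, hext⟩ := exists_ιFree (V : Scheme.{u}) (ULift.{u} (Fin n))
  let θ := restrictUnit V
  have : (Scheme.Modules.restrictFunctor V.ι).PreservesZeroMorphisms :=
    ⟨fun _ _ => rfl⟩
  obtain ⟨e⟩ := nonempty_cokernel_iso (I := ULift.{u} (Fin n)) (fun k => θ.hom ≫ ι k)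
    (fun {N} g => by
      obtain ⟨h, hh⟩ := hdesc fun k => θ.inv ≫ g k
      exact ⟨h, fun k => by rw [Category.assoc, hh, θ.hom_inv_id_assoc]⟩)
    (fun {N} h h' hk => hext h h' fun k => by
      have := congrArg (θ.inv ≫ ·) (hk k)
      simpa only [Category.assoc, θ.inv_hom_id_assoc] using this)
    ((Scheme.Modules.restrictFunctor V.ι).map i) r (fun k => a k.down) (fun k => q k.down)
    (fun k => hiq _) (fun k l => by rw [haq]; simp only [ULift.ext_iff])
    (by
      rw [← hsum]
      congr 1
      exact Fintype.sum_equiv Equiv.ulift _ _ fun _ => rfl)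
  exact ⟨PreservesCokernel.iso (Scheme.Modules.restrictFunctor V.ι) i ≪≫ e⟩

end Cokernel

/-! ### The quotient of the locally exact forms by a generator -/

section Coordinates

variable {X Y : Scheme.{u}} {p : ℕ} [hp : Fact p.Prime] {f : X ⟶ Y} [hY : IsOfChar Y p]
  {W : (twist p f).Opens} {x : Γ(X, relativeFrobenius p f ⁻¹ᵁ W)}

/-- The coordinates of a form in the basis `dx, x dx, …, x ^ (p - 1) dx`. -/
noncomputable def IsCoordinate.coord (hx : IsCoordinate p f W x)
    (ω : Γ(Ω f, relativeFrobenius p f ⁻¹ᵁ W)) : Fin p → Γ(twist p f, W) :=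
  hx.isPBasis.coeff (hx.isFrame.exists_eq_smul ω).choose

lemma IsCoordinate.coord_smul_d (hx : IsCoordinate p f W x)
    (b : Γ(X, relativeFrobenius p f ⁻¹ᵁ W)) : hx.coord (b • d f x) = hx.isPBasis.coeff b := by
  have h := (hx.isFrame.exists_eq_smul (b • d f x)).choose_spec
  rw [IsCoordinate.coord, ← hx.isFrame.eq_of_smul_eq h]

lemma IsCoordinate.coord_add (hx : IsCoordinate p f W x)
    (ω ω' : Γ(Ω f, relativeFrobenius p f ⁻¹ᵁ W)) :
    hx.coord (ω + ω') = hx.coord ω + hx.coord ω' := by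
  obtain ⟨b, rfl⟩ := hx.isFrame.exists_eq_smul ω
  obtain ⟨b', rfl⟩ := hx.isFrame.exists_eq_smul ω'
  rw [← add_smul, hx.coord_smul_d, hx.coord_smul_d, hx.coord_smul_d, IsPBasis.coeff_add]

lemma IsCoordinate.coord_fr_smul (hx : IsCoordinate p f W x) (a : Γ(twist p f, W))
    (ω : Γ(Ω f, relativeFrobenius p f ⁻¹ᵁ W)) :
    hx.coord (fr p f W a • ω) = a • hx.coord ω := by
  obtain ⟨b, rfl⟩ := hx.isFrame.exists_eq_smul ω
  rw [smul_smul, hx.coord_smul_d, hx.coord_smul_d, IsPBasis.coeff_mul]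

lemma IsCoordinate.coord_pow_smul_d (hx : IsCoordinate p f W x) (n : Fin p) :
    hx.coord (x ^ (n : ℕ) • d f x) = Pi.single n 1 := by
  have h := hx.isPBasis.coeff_mul_pow 1 n
  rw [map_one, one_mul] at h
  rw [hx.coord_smul_d, h]

lemma IsCoordinate.coord_injective (hx : IsCoordinate p f W x) : Function.Injective hx.coord := by
  intro ω ω' h
  obtain ⟨b, rfl⟩ := hx.isFrame.exists_eq_smul ω
  obtain ⟨b', rfl⟩ := hx.isFrame.exists_eq_smul ω'
  rw [hx.coord_smul_d, hx.coord_smul_d] at h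
  rw [← hx.isPBasis.sum_coeff b, h, hx.isPBasis.sum_coeff]

lemma IsCoordinate.coord_res (hx : IsCoordinate p f W x) {W' : (twist p f).Opens} (h : W' ≤ W)
    (ω : Γ(Ω f, relativeFrobenius p f ⁻¹ᵁ W)) (n : Fin p) :
    (hx.mono p h).coord (res (Ω f) ((relativeFrobenius p f).preimage_mono h) ω) n =
      rs h (hx.coord ω n) := by
  obtain ⟨b, rfl⟩ := hx.isFrame.exists_eq_smul ω
  rw [res_smul_rs, ← d_rs, IsCoordinate.coord_smul_d, hx.coord_smul_d, ← hx.coeff_rs h]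

lemma IsCoordinate.coord_res_res (hx : IsCoordinate p f W x) {W' W'' : (twist p f).Opens}
    (h : W' ≤ W) (h' : W'' ≤ W') (ω : Γ(Ω f, relativeFrobenius p f ⁻¹ᵁ W')) (n : Fin p) :
    (hx.mono p (h'.trans h)).coord (res (Ω f) ((relativeFrobenius p f).preimage_mono h') ω) n =
      rs h' ((hx.mono p h).coord ω n) := by
  rw [← (hx.mono p h).coord_res h' ω n]
  congr 1
  simp only [rs_rs]

lemma IsChart.cartier_eq_coord (hx : IsChart f W x) (ω : Γ(Ω f, relativeFrobenius p f ⁻¹ᵁ W)) :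
    hx.cartier ω = hx.1.coord ω (lastIndex p) • d (twistHom p f) (tw p f W x) := rfl

/-- The `n`-th coordinate, as a linear form on a module with a map to `F_* Ω`. -/
noncomputable def IsCoordinate.coordHom (hx : IsCoordinate p f W x) {B : (twist p f).Modules}
    (φ : B ⟶ (Scheme.Modules.pushforward (relativeFrobenius p f)).obj (Ω f)) (n : Fin p) :
    B.restrict W.ι ⟶ (𝒪 (twist p f)).restrict W.ι :=
  restrictHomOfSections
    (fun W' h =>
      { toFun := fun β => (hx.mono p h).coord (toPush φ W' β) n
        map_add' := fun β β' => by
          rw [map_add, IsCoordinate.coord_add]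
          rfl
        map_smul' := fun a β => by
          rw [toPush_smul, IsCoordinate.coord_fr_smul]
          rfl })
    (fun W₁ W₂ h h' β => by
      show (hx.mono p (h'.trans h)).coord (toPush φ W₂ (res B h' β)) n =
        rs h' ((hx.mono p h).coord (toPush φ W₁ β) n)
      rw [toPush_res, hx.coord_res_res h h'])

lemma IsCoordinate.restrictApp_coordHom (hx : IsCoordinate p f W x) {B : (twist p f).Modules}
    (φ : B ⟶ (Scheme.Modules.pushforward (relativeFrobenius p f)).obj (Ω f)) (n : Fin p)
    {W' : (twist p f).Opens} (h : W' ≤ W) (β : Γ(B, W')) :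
    sectionOfUnit (restrictApp (hx.coordHom φ n) h β) = (hx.mono p h).coord (toPush φ W' β) n := by
  rw [coordHom, restrictApp_restrictHomOfSections]
  rfl

end Coordinates

section Quotient

variable {X Y : Scheme.{u}} {p : ℕ} [hp : Fact p.Prime] {f : X ⟶ Y} [hY : IsOfChar Y p]
  {L : Subobject ((Scheme.Modules.pushforward (relativeFrobenius p f)).obj (Ω f))}
  {W : (twist p f).Opens} {e : Γ(Ω f, relativeFrobenius p f ⁻¹ᵁ W)}

lemma toPush_ofLE {A : X.Modules}
    {L L' : Subobject ((Scheme.Modules.pushforward (relativeFrobenius p f)).obj A)} (h : L ≤ L')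
    (l : Γ((L : (twist p f).Modules), W)) :
    toPush L'.arrow W ((Subobject.ofLE L L' h).app W l) = toPush L.arrow W l :=
  ConcreteCategory.congr_hom
    (congrArg (fun φ => Scheme.Modules.Hom.app φ W) (Subobject.ofLE_arrow h)) l

/-- A generator of `L` is the image of a frame of `L`. -/
lemma IsGenerator.exists_isFrame {A : X.Modules}
    {L : Subobject ((Scheme.Modules.pushforward (relativeFrobenius p f)).obj A)}
    {e : Γ(A, relativeFrobenius p f ⁻¹ᵁ W)} (he : IsGenerator L e)
    (hinj : ∀ W' ≤ W, Function.Injective (fr p f W')) :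
    ∃ l : Γ((L : (twist p f).Modules), W), toPush L.arrow W l = e ∧ IsFrame _ l := by
  obtain ⟨l, hl⟩ := he.mem_secs
  refine ⟨l, hl, fun W' h m => ?_⟩
  obtain ⟨c, hc⟩ := (he.2 W' h _).mp ⟨m, rfl⟩
  refine ⟨c, toPush_arrow_injective ?_, fun c' hc' => hinj W' h ?_⟩
  · rw [toPush_smul, toPush_res, hl, hc]
  · refine (he.1.mono ((relativeFrobenius p f).preimage_mono h)).eq_of_smul_eq ?_
    rw [← hc, show m = _ from hc', toPush_smul, toPush_res, hl]

variable [SmoothOfRelativeDimension 1 f]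

/-- On a chart, a generator some of whose coordinates is invertible has a free complement in the
module of exact forms. -/
theorem IsGenerator.nonempty_quotient_iso {x : Γ(X, relativeFrobenius p f ⁻¹ᵁ W)}
    (hx : IsChart f W x) (he : IsGenerator L e) (hle : L ≤ locallyExact p f) {j : Fin p}
    (hj : IsUnit (hx.1.coord e j)) : ∃ n : ℕ, Nonempty
      ((cokernel (Subobject.ofLE L (locallyExact p f) hle)).restrict W.ι ≅
        freeModule (W : Scheme.{u}) (ULift.{u} (Fin n))) := by
  classical
  let B := locallyExact p f
  obtain ⟨l, hl, -⟩ := he.exists_isFrame fun W' h => (hx.1 W' h).injective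
  have hlast : ∀ (W' : (twist p f).Opens) (h : W' ≤ W) (ω : Γ(Ω f, relativeFrobenius p f ⁻¹ᵁ W')),
      ω ∈ secs B W' → (hx.1.mono p h).coord ω (lastIndex p) = 0 := by
    intro W' h ω hω
    rw [(hx.mono h).mem_secs_locallyExact_iff, (hx.mono h).cartier_eq_coord,
      ← zero_smul Γ(twist p f, W')] at hω
    exact (hx.mono h).2.eq_of_smul_eq hω
  -- the coordinates other than the `j`-th and the last one
  let S := {k : Fin p // k ≠ j ∧ k ≠ lastIndex p}
  let n := Fintype.card S
  let σ : Fin n ≃ S := (Fintype.equivFin S).symm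
  have hσ : ∀ k l : Fin n, (σ k : Fin p) = σ l ↔ k = l := fun k l => by
    rw [Subtype.val_inj, σ.apply_eq_iff_eq]
  obtain ⟨v, hv⟩ := hj.exists_right_inv
  have hβ : ∀ k : Fin n, ∃ β : Γ((B : (twist p f).Modules), W),
      toPush B.arrow W β = x ^ ((σ k : Fin p) : ℕ) • d f x := by
    intro k
    have h1 : x ^ ((σ k : Fin p) : ℕ) • d f x ∈ secs B W := by
      rw [hx.mem_secs_locallyExact_iff, hx.cartier_eq_coord, hx.1.coord_pow_smul_d,
        Pi.single_eq_of_ne (σ k).2.2.symm, zero_smul]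
    exact h1
  choose β hβ using hβ
  -- `r` is the retraction onto `L` that reads off the `j`-th coordinate, and `q k` is the
  -- coordinate at `σ k` after subtraction of the part in `L`
  let q₀ : Fin p → (_ ⟶ _) := hx.1.coordHom B.arrow
  let r : (B : (twist p f).Modules).restrict W.ι ⟶ (L : (twist p f).Modules).restrict W.ι :=
    q₀ j ≫ homOfSection (v • l)
  let a : Fin n → (_ ⟶ _) := fun k => homOfSection (β k)
  let w : Fin n → Γ(𝒪 (twist p f), W) := fun k => -(v * hx.1.coord e (σ k))
  let q : Fin n → (_ ⟶ _) := fun k => q₀ (σ k) + q₀ j ≫ homOfSection (w k)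
  have hcoordβ : ∀ (W' : (twist p f).Opens) (h : W' ≤ W) (b : Γ(twist p f, W')) (k : Fin n),
      (hx.1.mono p h).coord (toPush B.arrow W' (b • res _ h (β k))) =
        Pi.single (σ k : Fin p) b := by
    intro W' h b k
    rw [toPush_smul, toPush_res, hβ, IsCoordinate.coord_fr_smul, res_smul_rs, map_pow, ← d_rs,
      (hx.1.mono p h).coord_pow_smul_d, ← Pi.single_smul, smul_eq_mul, mul_one]
  have hq : ∀ (k : Fin n) (W' : (twist p f).Opens) (h : W' ≤ W)
      (b : Γ((B : (twist p f).Modules), W')),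
      sectionOfUnit (restrictApp (q k) h b) = (hx.1.mono p h).coord (toPush B.arrow W' b) (σ k) -
        (hx.1.mono p h).coord (toPush B.arrow W' b) j * (rs h v * rs h (hx.1.coord e (σ k))) := by
    intro k W' h b
    show sectionOfUnit (restrictApp (q₀ (σ k) + q₀ j ≫ homOfSection (w k)) h b) = _
    rw [restrictApp_add, restrictApp_comp, restrictApp_homOfSection, map_add, map_smul,
      IsCoordinate.restrictApp_coordHom, IsCoordinate.restrictApp_coordHom, sub_eq_add_neg,
      ← mul_neg, ← map_mul, ← map_neg]
    rfl
  refine ⟨n, nonempty_cokernel_restrict_iso n _ r a q (fun k => restrictHom_ext fun W' h m => ?_)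
    (fun k k' => restrictHom_ext fun W' h b => ?_) (restrictHom_ext fun W' h b => ?_)⟩
  · refine (restrictApp_comp _ _ h m).trans (Eq.trans ?_ (restrictApp_zero h m).symm)
    rw [restrictApp_map]
    show sectionOfUnit (restrictApp (q k) h _) = 0
    obtain ⟨c, hc⟩ := (he.2 W' h _).mp ⟨m, rfl⟩
    rw [hq, toPush_ofLE, hc, IsCoordinate.coord_fr_smul, Pi.smul_apply, Pi.smul_apply,
      hx.1.coord_res h, hx.1.coord_res h, smul_eq_mul, smul_eq_mul]
    have hv' := congrArg (rs h) hv
    rw [map_mul, map_one] at hv'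
    linear_combination (-(c * rs h (hx.1.coord e (σ k)))) * hv'
  · refine (restrictApp_comp _ _ h b).trans ?_
    rw [restrictApp_homOfSection]
    show sectionOfUnit (restrictApp (q k') h _) = _
    rw [hq, hcoordβ, Pi.single_eq_of_ne (σ k).2.1.symm, zero_mul, sub_zero]
    by_cases hk : k = k'
    · subst hk
      rw [if_pos rfl, Pi.single_eq_same, restrictApp_id]
      rfl
    · rw [if_neg hk, Pi.single_eq_of_ne (fun h => hk ((hσ _ _).mp h.symm)), restrictApp_zero]
      rfl
  · rw [restrictApp_add, restrictApp_sum, restrictApp_id]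
    apply toPush_arrow_injective (L := B)
    apply (hx.1.mono p h).coord_injective
    have h1 : restrictApp (r ≫ (Scheme.Modules.restrictFunctor W.ι).map
        (Subobject.ofLE L B hle)) h b = (Subobject.ofLE L B hle).app W'
          ((hx.1.mono p h).coord (toPush B.arrow W' b) j • res _ h (v • l)) := by
      refine (restrictApp_comp _ _ h b).trans ?_
      rw [restrictApp_map, restrictApp_comp, restrictApp_homOfSection,
        IsCoordinate.restrictApp_coordHom]
    have h2 : ∀ k, restrictApp (q k ≫ a k) h b =
        sectionOfUnit (restrictApp (q k) h b) • res _ h (β k) := by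
      intro k
      refine (restrictApp_comp _ _ h b).trans ?_
      rw [restrictApp_homOfSection]
    rw [h1]
    simp only [h2]
    rw [map_add, map_sum, IsCoordinate.coord_add, toPush_ofLE, toPush_smul, toPush_res,
      toPush_smul, hl, IsCoordinate.coord_fr_smul]
    have h3 : ∀ s : Fin n → Γ(Ω f, relativeFrobenius p f ⁻¹ᵁ W'),
        (hx.1.mono p h).coord (∑ k, s k) = ∑ k, (hx.1.mono p h).coord (s k) := fun s =>
      map_sum (AddMonoidHom.mk' (hx.1.mono p h).coord (hx.1.mono p h).coord_add) s Finset.univ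
    rw [h3]
    simp only [hcoordβ, hq]
    rw [res_smul_rs, ← fr_rs p f h, IsCoordinate.coord_fr_smul]
    have hcr := hx.1.coord_res h e
    funext m
    simp only [Pi.add_apply, Pi.smul_apply, smul_eq_mul, Finset.sum_apply, hcr]
    have hv' := congrArg (rs h) hv
    rw [map_mul, map_one] at hv'
    by_cases hmj : m = j
    · subst hmj
      rw [Finset.sum_eq_zero fun k _ => Pi.single_eq_of_ne (σ k).2.1.symm _]
      linear_combination (hx.1.mono p h).coord (toPush B.arrow W' b) m * hv'
    by_cases hml : m = lastIndex p
    · subst hml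
      rw [Finset.sum_eq_zero fun k _ => Pi.single_eq_of_ne (σ k).2.2.symm _,
        hlast W' h _ ⟨b, rfl⟩]
      have h4 := hlast W' h _ (secs_mono hle W' (res_mem_secs h he.mem_secs))
      rw [hcr] at h4
      rw [h4, mul_zero, mul_zero, add_zero]
    · obtain ⟨k, hk⟩ : ∃ k, (σ k : Fin p) = m := ⟨σ.symm ⟨m, hmj, hml⟩, by rw [σ.apply_symm_apply]⟩
      rw [Finset.sum_eq_single k, ← hk, Pi.single_eq_same]
      · ring
      · intro k' _ hk'
        rw [← hk, Pi.single_eq_of_ne (fun h => hk' ((hσ _ _).mp h.symm))]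
      · simp

end Quotient

/-! ### Tango structures from local generators -/

section Tango

variable {X Y : Scheme.{u}} {p : ℕ} [hp : Fact p.Prime] {f : X ⟶ Y} [hY : IsOfChar Y p]

section Extension

variable {M : X.Modules}
  {L : Subobject ((Scheme.Modules.pushforward (relativeFrobenius p f)).obj M)}

/-- A linear map on `M` is determined by its restriction to `L`. -/
lemma map_eq_of_isGenerator (hL : HasLocalGenerators L) {N : X.Modules} {φ φ' : M ⟶ N}
    (h : L.arrow ≫ (Scheme.Modules.pushforward (relativeFrobenius p f)).map φ =
      L.arrow ≫ (Scheme.Modules.pushforward (relativeFrobenius p f)).map φ') : φ = φ' := by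
  refine hom_ext_sections fun V m => eq_of_local N fun u hu => ?_
  obtain ⟨W, hW, hu', e, he, b, hb⟩ := hL.exists_eq_smul m u hu
  refine ⟨_, hW, hu', ?_⟩
  obtain ⟨l, rfl⟩ := he.mem_secs
  have h1 : φ.app _ (toPush L.arrow W l) = φ'.app _ (toPush L.arrow W l) :=
    ConcreteCategory.congr_hom (congrArg (fun ψ => Scheme.Modules.Hom.app ψ W) h) l
  rw [← app_res, ← app_res, hb, Scheme.Modules.Hom.app_smul, Scheme.Modules.Hom.app_smul, h1]

/-- A linear map on `L` with values in `F_* N` extends to an `O_X`-linear map on `M`, which sends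
`b e` to `b ψ(e)` for every generator `e`. -/
theorem HasLocalGenerators.exists_extension (hL : HasLocalGenerators L) {N : X.Modules}
    (ψ : (L : (twist p f).Modules) ⟶ (Scheme.Modules.pushforward (relativeFrobenius p f)).obj N) :
    ∃ φ : M ⟶ N, L.arrow ≫ (Scheme.Modules.pushforward (relativeFrobenius p f)).map φ = ψ := by
  let R : ∀ V : X.Opens, Γ(M, V) → Γ(N, V) → Prop := fun V m n =>
    ∃ (W : (twist p f).Opens) (h : V ≤ relativeFrobenius p f ⁻¹ᵁ W)
      (l : Γ((L : (twist p f).Modules), W)) (_ : IsGenerator L (toPush L.arrow W l)) (b : Γ(X, V)),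
      m = b • res M h (toPush L.arrow W l) ∧ n = b • res N h (toPush ψ W l)
  have hind : ∀ (V : X.Opens) (m : Γ(M, V)) (n : Γ(N, V)), R V m n →
      ∀ (W : (twist p f).Opens) (h : V ≤ relativeFrobenius p f ⁻¹ᵁ W)
        (l : Γ((L : (twist p f).Modules), W)) (_ : IsGenerator L (toPush L.arrow W l)),
        ∃ b : Γ(X, V), m = b • res M h (toPush L.arrow W l) ∧ n = b • res N h (toPush ψ W l) := by
    rintro V _ _ ⟨W₁, h₁, l₁, hl₁, b, rfl, rfl⟩ W₂ h₂ l₂ hl₂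
    obtain ⟨c, hc⟩ := hl₁.exists_smul_eq hl₂
    have hl : res _ inf_le_left l₁ = c • res _ inf_le_right l₂ := by
      apply toPush_arrow_injective
      rw [toPush_res, toPush_smul, toPush_res, hc]
    have h : V ≤ relativeFrobenius p f ⁻¹ᵁ (W₁ ⊓ W₂) := le_inf h₁ h₂
    have hc' := congrArg (res M h) hc
    rw [res_smul_rs, res_res, res_res] at hc'
    have hψ := congrArg (fun l => res N h (toPush ψ _ l)) hl
    simp only [toPush_smul, toPush_res, res_smul_rs, res_res] at hψ
    exact ⟨b * rs h (fr p f _ c), by rw [hc', smul_smul], by rw [hψ, smul_smul]⟩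
  have hloc : ∀ (V : X.Opens) (m : Γ(M, V)), ∀ u ∈ V, ∃ (V' : X.Opens) (h : V' ≤ V), u ∈ V' ∧
      ∃ n, R V' (res M h m) n := by
    intro V m u hu
    obtain ⟨W, h, hu', e, he, b, hb⟩ := hL.exists_eq_smul m u hu
    obtain ⟨l, rfl⟩ := he.mem_secs
    exact ⟨_, h, hu', _, W, le_rfl, l, he, b, by rw [res_self, hb], rfl⟩
  obtain ⟨φ, hφ⟩ := exists_hom_of_relation M N R
    (by
      rintro V V' h m _ ⟨W, h', l, hl, b, rfl, rfl⟩
      exact ⟨W, h.trans h', l, hl, rs h b, by rw [res_smul_rs, res_res],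
        by rw [res_smul_rs, res_res]⟩)
    (by
      rintro V m m' _ t' ⟨W, h, l, hl, b, rfl, rfl⟩ h' u hu
      obtain ⟨b', rfl, rfl⟩ := hind V _ _ h' W h l hl
      refine ⟨V, le_rfl, hu, W, h, l, hl, b + b', ?_, ?_⟩
      · rw [res_self, add_smul]
      · rw [res_self, add_smul])
    (by
      rintro V a _ _ ⟨W, h, l, hl, b, rfl, rfl⟩
      exact ⟨W, h, l, hl, a * b, by rw [mul_smul], by rw [mul_smul]⟩)
    (by
      rintro V _ _ t' ⟨W, h, l, hl, b, rfl, rfl⟩ h'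
      obtain ⟨b', hb', rfl⟩ := hind V _ _ h' W h l hl
      rw [(hl.1.mono h).eq_of_smul_eq hb'])
    hloc
  refine ⟨φ, hom_ext_sections fun W l => ?_⟩
  refine eq_of_local N (V := relativeFrobenius p f ⁻¹ᵁ W)
    (m := φ.app _ (toPush L.arrow W l)) (m' := toPush ψ W l) fun u hu => ?_
  obtain ⟨W', h, hy, e, he⟩ := hL.exists_le (W := W) (y := relativeFrobenius p f u) hu
  obtain ⟨l', rfl⟩ := he.mem_secs
  refine ⟨_, (relativeFrobenius p f).preimage_mono h, hy, ?_⟩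
  have h1 : toPush L.arrow W' (res _ h l) ∈ secs L W' := ⟨_, rfl⟩
  obtain ⟨c, hc⟩ := (he.mem_secs_iff _).mp h1
  have hl : res _ h l = c • l' := by
    apply toPush_arrow_injective
    rw [hc, toPush_smul]
  rw [← app_res, ← toPush_res L.arrow h, ← toPush_res ψ h, hc, hl, toPush_smul]
  exact hφ _ _ _ ⟨W', le_rfl, l', he, fr p f W' c, by rw [res_self], by rw [res_self]⟩

end Extension

variable {L : Subobject ((Scheme.Modules.pushforward (relativeFrobenius p f)).obj (Ω f))}

lemma homEquiv_xi_comp {N : X.Modules} (φ : Ω f ⟶ N) :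
    (Scheme.Modules.pullbackPushforwardAdjunction (relativeFrobenius p f)).homEquiv _ _
      (xi p L ≫ φ) = L.arrow ≫ (Scheme.Modules.pushforward (relativeFrobenius p f)).map φ := by
  rw [Adjunction.homEquiv_naturality_right, xi, Equiv.apply_symm_apply]

/-- By the Yoneda lemma, `ξ_L` is an isomorphism since `L` generates `Ω` freely. -/
theorem HasLocalGenerators.isIso_xi (hL : HasLocalGenerators L) : IsIso (xi p L) := by
  refine isIso_of_coyoneda_map_bijective _ fun N => ⟨fun φ φ' h => ?_, fun ψ => ?_⟩
  · refine map_eq_of_isGenerator hL ?_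
    rw [← homEquiv_xi_comp, ← homEquiv_xi_comp]
    exact congrArg _ h
  · obtain ⟨φ, hφ⟩ := hL.exists_extension
      ((Scheme.Modules.pullbackPushforwardAdjunction (relativeFrobenius p f)).homEquiv _ _ ψ)
    refine ⟨φ, ((Scheme.Modules.pullbackPushforwardAdjunction
      (relativeFrobenius p f)).homEquiv _ _).injective ?_⟩
    exact (homEquiv_xi_comp φ).trans hφ

lemma IsFrame.isUnit_of_smul {A : X.Modules} {V : X.Opens} {e : Γ(A, V)} (he : IsFrame A e)
    {b : Γ(X, V)} (h : IsFrame A (b • e)) : IsUnit b := by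
  obtain ⟨c, hc⟩ := h.exists_eq_smul e
  rw [smul_smul] at hc
  have h1 : c * b = 1 := he.eq_of_smul_eq (hc.symm.trans (one_smul _ _).symm)
  exact IsUnit.of_mul_eq_one_right c h1

/-- Some coordinate of a frame of `Ω` is invertible near a given point. -/
lemma IsCoordinate.exists_isUnit_coord {W : (twist p f).Opens}
    {x : Γ(X, relativeFrobenius p f ⁻¹ᵁ W)} (hx : IsCoordinate p f W x)
    {e : Γ(Ω f, relativeFrobenius p f ⁻¹ᵁ W)} (he : IsFrame (Ω f) e) {y : twist p f} (hy : y ∈ W) :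
    ∃ (W' : (twist p f).Opens) (h : W' ≤ W) (_ : y ∈ W') (j : Fin p),
      IsUnit (rs h (hx.coord e j)) := by
  obtain ⟨b, rfl⟩ := hx.isFrame.exists_eq_smul e
  have hb := hx.isFrame.isUnit_of_smul he
  have hspan : Ideal.span (Set.range fun j => fr p f W (hx.isPBasis.coeff b j)) = ⊤ := by
    refine Ideal.eq_top_of_isUnit_mem _ ?_ hb
    have h1 := hx.isPBasis.sum_coeff b
    rw [← h1]
    refine Ideal.sum_mem _ fun j _ => Ideal.mul_mem_right _ _ ?_
    rw [h1]
    exact Ideal.subset_span ⟨j, rfl⟩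
  obtain ⟨u, rfl⟩ := relativeFrobenius_surjective p f y
  obtain ⟨_, ⟨j, rfl⟩, hu⟩ := exists_mem_basicOpen_of_span_eq_top hspan (u := u) hy
  rw [hx.coord_smul_d]
  refine ⟨(twist p f).basicOpen (hx.isPBasis.coeff b j), (twist p f).basicOpen_le _, ?_, j,
    RingedSpace.isUnit_res_basicOpen _ _⟩
  have h2 := Scheme.preimage_basicOpen (relativeFrobenius p f) (hx.isPBasis.coeff b j)
  have h3 : u ∈ X.basicOpen ((relativeFrobenius p f).app W (hx.isPBasis.coeff b j)) := hu
  rw [← h2] at h3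
  exact h3

variable [SmoothOfRelativeDimension 1 f]

/-- A subobject of `F_* B` with local generators is a Tango structure. -/
theorem HasLocalGenerators.isTango (hL : HasLocalGenerators L) (hle : L ≤ locallyExact p f) :
    IsTango p f L where
  isLineBundle y := by
    obtain ⟨W₀, hy₀, x, hx⟩ := exists_isChart (f := f) y
    obtain ⟨W, h, hy, e, he⟩ := hL.exists_le hy₀
    obtain ⟨l, -, hl⟩ := he.exists_isFrame fun W' h' => (hx.1 W' (h'.trans h)).injective
    exact ⟨W, hy, hl.nonempty_iso⟩
  le := hle
  quotient y := by
    obtain ⟨W₀, hy₀, x, hx⟩ := exists_isChart (f := f) y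
    obtain ⟨W₁, h₁, hy₁, e, he⟩ := hL.exists_le hy₀
    obtain ⟨W₂, h₂, hy₂, j, hj⟩ := (hx.mono h₁).1.exists_isUnit_coord he.1 hy₁
    rw [← (hx.mono h₁).1.coord_res h₂] at hj
    exact ⟨W₂, hy₂, (he.mono h₂).nonempty_quotient_iso ((hx.mono h₁).mono h₂) hle hj⟩
  isIso := hL.isIso_xi

end Tango

/-! ### Local generators of Tango structures -/

section Residue

variable {X : Scheme.{u}} {M : X.Modules} {V : X.Opens} {e : Γ(M, V)}

lemma isUnit_of_forall_mem_basicOpen {b : Γ(X, V)} (h : ∀ u ∈ V, u ∈ X.basicOpen b) : IsUnit b := by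
  have h1 : V ≤ X.basicOpen b := h
  have h2 : IsUnit (rs (X.basicOpen_le b) b) := RingedSpace.isUnit_res_basicOpen X.toRingedSpace b
  have h3 := h2.map (rs h1)
  rwa [rs_rs, rs_self] at h3

/-- The coefficient of a section with respect to a frame. -/
noncomputable def IsFrame.coeff (he : IsFrame M e) {W : X.Opens} (h : W ≤ V) (m : Γ(M, W)) :
    Γ(X, W) :=
  (he W h m).exists.choose

lemma IsFrame.coeff_eq_iff (he : IsFrame M e) {W : X.Opens} (h : W ≤ V) (m : Γ(M, W))
    (b : Γ(X, W)) : he.coeff h m = b ↔ m = b • res M h e := by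
  have h1 := (he W h m).exists.choose_spec
  refine ⟨?_, fun h2 => (he W h m).unique h1 h2⟩
  rintro rfl
  exact h1

lemma IsFrame.eq_coeff_smul (he : IsFrame M e) {W : X.Opens} (h : W ≤ V) (m : Γ(M, W)) :
    m = he.coeff h m • res M h e :=
  (he.coeff_eq_iff h m _).mp rfl

lemma preimage_le_fromSpecResidueField {u : X} (hu : u ∈ V) (W : X.Opens) :
    X.fromSpecResidueField u ⁻¹ᵁ W ≤ X.fromSpecResidueField u ⁻¹ᵁ (W ⊓ V) := by
  intro s hs
  refine ⟨hs, ?_⟩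
  show X.fromSpecResidueField u s ∈ V
  rwa [Scheme.fromSpecResidueField_apply]

/-- Functions that are not invertible at `u` vanish in the residue field of `u`. -/
lemma fromSpecResidueField_appLE_eq_zero {u : X} {b : Γ(X, V)} (hb : u ∉ X.basicOpen b)
    {A : (Spec (X.residueField u)).Opens} (hA : A ≤ X.fromSpecResidueField u ⁻¹ᵁ V) :
    (X.fromSpecResidueField u).appLE V A hA b = 0 := by
  have h0 : X.fromSpecResidueField u ⁻¹ᵁ X.basicOpen b = ⊥ := by
    refine le_bot_iff.mp fun s hs => (hb ?_).elim
    have h1 : X.fromSpecResidueField u s ∈ X.basicOpen b := hs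
    rwa [Scheme.fromSpecResidueField_apply] at h1
  rw [Scheme.preimage_basicOpen, AlgebraicGeometry.basicOpen_eq_bot_iff] at h0
  rw [Scheme.Hom.appLE, CommRingCat.comp_apply]
  refine (congrArg _ h0).trans (map_zero _)

/-- Taking the value at `u` of the coefficient with respect to a frame is a morphism to a
skyscraper sheaf. It shows that a section which is a non-invertible multiple of a frame does not
generate. -/
theorem IsFrame.exists_value (he : IsFrame M e) {u : X} (hu : u ∈ V) :
    ∃ (N : X.Modules) (φ : M ⟶ N), φ ≠ 0 ∧ ∀ (W : X.Opens) (m : Γ(M, W)) (b : Γ(X, W ⊓ V)),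
      u ∉ X.basicOpen b → res M inf_le_left m = b • res M inf_le_right e → φ.app W m = 0 := by
  let g := X.fromSpecResidueField u
  let val : ∀ W : X.Opens, Γ(M, W) → Γ(Spec (X.residueField u), g ⁻¹ᵁ W) := fun W m =>
    g.appLE (W ⊓ V) (g ⁻¹ᵁ W) (preimage_le_fromSpecResidueField hu W)
      (he.coeff inf_le_right (res M inf_le_left m))
  have hsmul : ∀ (W : X.Opens) (a : Γ(X, W)) (m : Γ(M, W)),
      val W (a • m) = g.app W a * val W m := by
    intro W a m
    have h1 : he.coeff inf_le_right (res M inf_le_left (a • m)) =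
        rs inf_le_left a * he.coeff inf_le_right (res M inf_le_left m) := by
      rw [he.coeff_eq_iff, mul_smul, ← he.eq_coeff_smul, res_smul_rs]
    simp only [val]
    rw [h1, map_mul]
    congr 1
    have h2 : X.presheaf.map (homOfLE (inf_le_left : W ⊓ V ≤ W)).op ≫ g.appLE (W ⊓ V) (g ⁻¹ᵁ W)
        (preimage_le_fromSpecResidueField hu W) = g.app W := by
      rw [Scheme.Hom.map_appLE, Scheme.Hom.appLE_eq_app]
    exact ConcreteCategory.congr_hom h2 a
  let φ : M ⟶ (Scheme.Modules.pushforward g).obj (𝒪 (Spec (X.residueField u))) :=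
    homOfSections val
      (by
        intro W m m'
        have h1 : he.coeff inf_le_right (res M (inf_le_left : W ⊓ V ≤ W) (m + m')) =
            he.coeff inf_le_right (res M inf_le_left m) +
              he.coeff inf_le_right (res M inf_le_left m') := by
          rw [he.coeff_eq_iff, add_smul, ← he.eq_coeff_smul, ← he.eq_coeff_smul, map_add]
        refine (congrArg _ h1).trans (map_add _ _ _))
      hsmul
      (by
        intro W W' h m
        have h0 : W' ⊓ V ≤ W ⊓ V := inf_le_inf_right V h
        have h1 : he.coeff inf_le_right (res M inf_le_left (res M h m)) =
            rs h0 (he.coeff inf_le_right (res M (inf_le_left : W ⊓ V ≤ W) m)) := by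
          rw [he.coeff_eq_iff, res_res]
          have h2 := congrArg (res M h0) (he.eq_coeff_smul inf_le_right
            (res M (inf_le_left : W ⊓ V ≤ W) m))
          rwa [res_res, res_smul_rs, res_res] at h2
        refine Eq.trans (congrArg (g.appLE (W' ⊓ V) (g ⁻¹ᵁ W')
          (preimage_le_fromSpecResidueField hu W')) h1) ?_
        have h3 : X.presheaf.map (homOfLE h0).op ≫ g.appLE (W' ⊓ V) (g ⁻¹ᵁ W')
            (preimage_le_fromSpecResidueField hu W') =
          g.appLE (W ⊓ V) (g ⁻¹ᵁ W) (preimage_le_fromSpecResidueField hu W) ≫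
            (Spec (X.residueField u)).presheaf.map (homOfLE (g.preimage_mono h)).op := by
          rw [Scheme.Hom.map_appLE, Scheme.Hom.appLE_map]
        exact ConcreteCategory.congr_hom h3 _)
  have hφ : ∀ W m, φ.app W m = val W m := fun W m => rfl
  refine ⟨_, φ, fun h0 => ?_, fun W m b hb hm => ?_⟩
  · have h1 : val V e = 0 := (hφ V e).symm.trans (by rw [h0]; rfl)
    have h2 : he.coeff inf_le_right (res M (inf_le_left : V ⊓ V ≤ V) e) = 1 := by
      rw [he.coeff_eq_iff, one_smul]
    have h3 : val V e = 1 := (congrArg _ h2).trans (map_one _)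
    have h4 : Nonempty (g ⁻¹ᵁ V : (Spec (X.residueField u)).Opens) := by
      refine ⟨⟨IsLocalRing.closedPoint (X.residueField u), ?_⟩⟩
      exact (congrArg (· ∈ V) (Scheme.fromSpecResidueField_apply u _)).mpr hu
    have : Nontrivial Γ(Spec (X.residueField u), g ⁻¹ᵁ V) := inferInstance
    exact one_ne_zero (h3.symm.trans h1)
  · rw [hφ]
    have h1 := (he.coeff_eq_iff _ _ _).mpr hm
    simp only [val]
    rw [h1]
    exact fromSpecResidueField_appLE_eq_zero hb _

end Residue

section Generator

variable {X Y : Scheme.{u}} {p : ℕ} [hp : Fact p.Prime] {f : X ⟶ Y} [hY : IsOfChar Y p]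
  {L : Subobject ((Scheme.Modules.pushforward (relativeFrobenius p f)).obj (Ω f))}
  {W : (twist p f).Opens}

/-- If `ξ_L` is an isomorphism, then it sends a frame of `L` to a frame of `Ω`. -/
lemma isGenerator_of_isIso_xi [IsIso (xi p L)] {x : Γ(X, relativeFrobenius p f ⁻¹ᵁ W)}
    (hx : IsCoordinate p f W x) {l : Γ((L : (twist p f).Modules), W)} (hl : IsFrame _ l) :
    IsGenerator L (toPush L.arrow W l) := by
  obtain ⟨b, hb⟩ := hx.isFrame.exists_eq_smul (toPush L.arrow W l)
  have hunit : IsUnit b := by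
    refine isUnit_of_forall_mem_basicOpen fun u hu => ?_
    by_contra hub
    -- otherwise the value at `u` of the coefficient of `dx` is nonzero on `Ω` but zero on `L`
    obtain ⟨N, φ, hφ0, hφ⟩ := hx.isFrame.exists_value hu
    refine hφ0 ((cancel_epi (xi p L)).mp ?_)
    rw [comp_zero]
    refine ((Scheme.Modules.pullbackPushforwardAdjunction
      (relativeFrobenius p f)).homEquiv _ _).injective ?_
    rw [homEquiv_xi_comp, ← comp_zero (f := xi p L), homEquiv_xi_comp]
    refine hom_ext_sections fun W' l' => ?_
    obtain ⟨c, hc⟩ := (hl.mono (inf_le_right : W' ⊓ W ≤ W)).exists_eq_smul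
      (res _ (inf_le_left : W' ⊓ W ≤ W') l')
    have hc' := congrArg (toPush L.arrow (W' ⊓ W)) hc
    rw [toPush_smul, toPush_res, toPush_res L.arrow inf_le_right, hb, res_smul_rs, smul_smul] at hc'
    refine (hφ _ (toPush L.arrow W' l') _ (fun h => hub ?_) hc').trans rfl
    have h1 := (Scheme.basicOpen_mul X (U := relativeFrobenius p f ⁻¹ᵁ (W' ⊓ W)) _ _).le h
    exact ((Scheme.basicOpen_res X b _).le h1.2).2
  refine ⟨?_, fun W' h m => ?_⟩
  · rw [hb]
    exact hx.isFrame.smul hunit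
  constructor
  · rintro ⟨l', rfl⟩
    obtain ⟨c, hc⟩ := (hl.mono h).exists_eq_smul l'
    exact ⟨c, by rw [hc, toPush_smul, toPush_res]⟩
  · rintro ⟨c, rfl⟩
    exact smul_mem_secs c (res_mem_secs h ⟨l, rfl⟩)

/-- The local frames of a Tango structure are generators. -/
theorem IsTango.hasLocalGenerators [SmoothOfRelativeDimension 1 f] (hL : IsTango p f L) :
    HasLocalGenerators L := by
  intro y
  obtain ⟨V, hV, ⟨ψ⟩⟩ := hL.isLineBundle y
  obtain ⟨l, hl⟩ := exists_isFrame_of_iso ψ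
  obtain ⟨W, h, hy, x, hx⟩ := exists_isChart_le (f := f) hV
  have := hL.isIso
  exact ⟨W, hy, _, isGenerator_of_isIso_xi hx.1 (hl.mono h)⟩

end Generator

end TangoCurve

theorem proposition4p3 (p : ℕ) [Fact p.Prime] (hp : 2 < p) {k : Type u} [Field k] [PerfectField k]
    [CharP k p] {T U : Scheme.{u}} (s : T ⟶ Spec (CommRingCat.of k)) (f : U ⟶ T)
    [SmoothOfRelativeDimension 1 f] :
    haveI := IsOfChar.of_field p s
    (∃! C, IsCartierOperator p f C) ∧
      ∀ C, IsCartierOperator p f C →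
        Set.BijOn (fun nabla : Connection f (Ω f) => horizontal p nabla)
          {nabla | IsPreTango p C nabla} {L | IsTango p f L} := by
  have := IsOfChar.of_field p s
  refine ⟨existsUnique_isCartierOperator p f, fun C hC => ⟨fun nabla h => ?_, ?_, fun L hL => ?_⟩⟩
  · have hle := h.horizontal_le
    rw [← hC.locallyExact_eq] at hle
    exact (Connection.hasLocalGenerators_horizontal h.pCurvature).isTango hle
  · intro nabla h nabla' _ heq
    exact Connection.eq_of_horizontal_eq h.pCurvature heq
  · have hgen := IsTango.hasLocalGenerators hL
    obtain ⟨nabla, hnabla⟩ := hgen.exists_connection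
    have heq := hgen.horizontal_eq hnabla
    refine ⟨nabla, ⟨hgen.hasVanishingPCurvature hnabla, ?_⟩, heq⟩
    rw [heq, ← hC.locallyExact_eq]
    exact hL.le
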